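/- Let $0<\nu<2$ and $\gamma>\max\{-3,-\nu-3/2\}$. Let $b=b(\cos\theta)\ge 0$ be a measurable angular kernel on $[0,\pi]$ which vanishes for $\theta>\pi/2$, is bounded on $[\delta,\pi/2]$ for every $\delta>0$, and satisfies $b(\cos\theta)\sim K\theta^{-2-\nu}$ as $\theta\downarrow0$ for some $K>0$. Let $\varphi_0\in C_0^\infty(\mathbb R)$ with $\operatorname{supp}\varphi_0\subset[-1,1]$ and $\varphi_0(t)=1$ for $|t|\le 1/2$, and put $\Phi_c(r)=r^\gamma\varphi_0(r)$. For $v,v_*\in\mathbb R^3$, $\sigma\in\mathbb S^2$ write $v'=\frac{v+v_*}2+\frac{|v-v_*|}2\sigma$, $v_*'=\frac{v+v_*}2-\frac{|v-v_*|}2\sigma$, $\cos\theta=\frac{v-v_*}{|v-v_*|}\cdot\sigma$, and define $$Q_c(f,g)(v)=\lim_{\varepsilon\downarrow0}\int_{\mathbb R^3}\int_{\{\sigma\in\mathbb S^2:\ \theta\ge\varepsilon\}}\Phi_c(|v-v_*|)\,b(\cos\theta)\,\bigl(f(v_*')g(v')-f(v_*)g(v)\bigr)\,d\sigma\,dv_*,$$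 $$(Q_c(f,g),h)=\int_{\mathbb R^3}Q_c(f,g)(v)\,\overline{h(v)}\,dv .$$ For complex-valued Schwartz functions $f,g,h$ on $\mathbb R^3$ the integrals over $\theta\ge\varepsilon$ converge absolutely, the limit exists for every $v$, and $Q_c(f,g)\,\overline h$ is integrable. Write $\|u\|_{H^s}=\|\langle\xi\rangle^s\hat u\|_{L^2}$ with $\langle\xi\rangle=(1+|\xi|^2)^{1/2}$. (i) For every $m\in[-\nu/2,\nu/2]$ there is a constant $C$, depending only on $\nu,\gamma,m,b,\varphi_0$, such that $$|(Q_c(f,g),h)|\le C\,\|f\|_{L^2}\,\|g\|_{H^{\nu/2+m}}\,\|h\|_{H^{\nu/2-m}}$$ for all Schwartz functions $f,g,h$; consequently the form $(Q_c(f,g),h)$ extends by continuity to all $f\in L^2$, $g\in H^{\nu/2+m}$, $h\in H^{\nu/2-m}$, with the same bound. (ii) Let $q\in[1,2)$, $\gamma>\max\{-3,-\nu-3+3/q\}$ and $-\nu/2\le m\le\min\{\nu/2,3/2-\nu/2\}$. Then there is a constant $C$, depending only on $\nu,\gamma,m,q,b,\varphi_0$, such that $$|(Q_c(f,g),h)|\le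 C\,\|f\|_{L^q}\,\|g\|_{H^{\nu/2+m}}\,\|h\|_{H^{\nu/2-m}}$$ for all Schwartz functions $f,g,h$; consequently the form extends by continuity to all $f\in L^q$, $g\in H^{\nu/2+m}$, $h\in H^{\nu/2-m}$, with the same bound. -/

import Mathlib

open MeasureTheory Filter Topology Asymptotics
open scoped SchwartzMap FourierTransform ENNReal NNReal

namespace Boltzmann

/-- Velocity space `ℝ³` with its Euclidean norm. -/
abbrev V : Type := EuclideanSpace ℝ (Fin 3)

/-- The unit sphere `𝕊²` of `ℝ³`. -/
abbrev S2 : Type := Metric.sphere (0 : V) 1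

/-- The surface measure `dσ` on `𝕊²`. -/
noncomputable def sphereMeasure : Measure S2 := (volume : Measure V).toSphere

/-- The post-collisional velocity `v' = (v + v_*) / 2 + (|v - v_*| / 2) σ`. -/
noncomputable def post (v vs : V) (σ : S2) : V :=
  (1 / 2 : ℝ) • (v + vs) + (‖v - vs‖ / 2) • (σ : V)

/-- The post-collisional velocity `v_*' = (v + v_*) / 2 - (|v - v_*| / 2) σ`. -/
noncomputable def postStar (v vs : V) (σ : S2) : V :=
  (1 / 2 : ℝ) • (v + vs) - (‖v - vs‖ / 2) • (σ : V)

/-- The deviation angle `θ ∈ [0, π]`, with `cos θ = (v - v_*) / |v - v_*| · σ`. -/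
noncomputable def devAngle (v vs : V) (σ : S2) : ℝ :=
  InnerProductGeometry.angle (v - vs) (σ : V)

/-- Non-cutoff angular kernels `b = b(cos θ)` of order `ν`: nonnegative, supported in
`0 ≤ θ ≤ π / 2`, with `b(cos θ) ∼ K θ ^ (-2 - ν)` as `θ ↓ 0` for some `K > 0`, and with no
singularity other than the one at `θ = 0`. -/
structure IsNonCutoffKernel (ν : ℝ) (b : ℝ → ℝ) : Prop where
  measurable : Measurable b
  nonneg : ∀ t, 0 ≤ b t
  eq_zero_of_neg : ∀ t < 0, b t = 0
  singular : ∃ K : ℝ, 0 < K ∧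
    (fun θ : ℝ => b (Real.cos θ)) ~[𝓝[>] 0] (fun θ : ℝ => K * θ ^ (-2 - ν))
  bounded_away : ∀ δ > 0, ∃ M : ℝ, ∀ θ ∈ Set.Icc δ (Real.pi / 2), b (Real.cos θ) ≤ M

/-- The cutoff functions `φ₀ ∈ C_0^∞(ℝ)`, supported in `[-1, 1]`, equal to `1` on
`[-1/2, 1/2]`. -/
structure IsCutoff (φ₀ : ℝ → ℝ) : Prop where
  smooth : ContDiff ℝ ((⊤ : ℕ∞) : WithTop ℕ∞) φ₀
  support_subset : tsupport φ₀ ⊆ Set.Icc (-1) 1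
  eq_one : ∀ t : ℝ, |t| ≤ 1 / 2 → φ₀ t = 1

/-- The singular part `Φ_c(r) = r ^ γ φ₀(r)` of the kinetic factor. -/
noncomputable def phiC (φ₀ : ℝ → ℝ) (γ r : ℝ) : ℝ := r ^ γ * φ₀ r

/-- The singular-part kernel `B_c = Φ_c(|v - v_*|) b(cos θ)`. -/
noncomputable def kernelC (b φ₀ : ℝ → ℝ) (γ : ℝ) (v vs : V) (σ : S2) : ℝ :=
  phiC φ₀ γ ‖v - vs‖ * b (Real.cos (devAngle v vs σ))

/-- The integrand `B_c (f_*' g' - f_* g)` at `p = (v_*, σ)`, restricted to deviation angles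
`θ ≥ ε`. -/
noncomputable def integrandC (b φ₀ : ℝ → ℝ) (γ ε : ℝ) (f g : V → ℂ) (v : V) (p : V × S2) : ℂ :=
  if ε ≤ devAngle v p.1 p.2 then
    (kernelC b φ₀ γ v p.1 p.2 : ℂ) *
      (f (postStar v p.1 p.2) * g (post v p.1 p.2) - f p.1 * g v)
  else 0

/-- The collision integral over the deviation angles `θ ≥ ε`. -/
noncomputable def collisionCTrunc (b φ₀ : ℝ → ℝ) (γ ε : ℝ) (f g : V → ℂ) (v : V) : ℂ :=
  ∫ p, integrandC b φ₀ γ ε f g v p ∂((volume : Measure V).prod sphereMeasure)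

/-- The collision operator `Q_c(f, g)(v) = ∫∫ B_c (f_*' g' - f_* g) dσ dv_*`. As `b` is not
integrable on the sphere (and the integral does not converge absolutely when `ν ≥ 1`), it is
understood, as usual, as the principal value at `θ = 0`. -/
noncomputable def collisionC (b φ₀ : ℝ → ℝ) (γ : ℝ) (f g : V → ℂ) (v : V) : ℂ :=
  limUnder (𝓝[>] (0 : ℝ)) (fun ε => collisionCTrunc b φ₀ γ ε f g v)

/-- The pairing `(Q_c(f, g), h) = ∫ Q_c(f, g)(v) conj(h(v)) dv`. -/
noncomputable def pairingC (b φ₀ : ℝ → ℝ) (γ : ℝ) (f g h : V → ℂ) : ℂ :=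
  ∫ v, collisionC b φ₀ γ f g v * (starRingEnd ℂ) (h v)

/-- The Sobolev norm `‖u‖_{H^s} = ‖⟨ξ⟩^s û‖_{L²}`, `⟨ξ⟩ = (1 + |ξ|²)^{1/2}`, of `u ∈ L²`. For
`s ≥ 0`, the space `H^s` consists of the `u ∈ L²` for which it is finite. -/
noncomputable def sobolevNorm (s : ℝ) (u : Lp ℂ 2 (volume : Measure V)) : ℝ≥0∞ :=
  eLpNorm (fun ξ : V => (((1 + ‖ξ‖ ^ 2) ^ (s / 2) : ℝ) : ℂ) * (𝓕 u : Lp ℂ 2 (volume : Measure V)) ξ)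
    2 volume

/-- `T` is the extension by continuity of the form `P`, given on Schwartz functions, to
`L^q × H^s × H^r` (`s, r ≥ 0`): whenever Schwartz functions `F n`, `G n`, `H n` converge to `f`,
`g`, `h` in these spaces, `P (F n) (G n) (H n)` converges to `T f g h`. -/
def IsExtension (q : ℝ≥0∞) (s r : ℝ) (P : 𝓢(V, ℂ) → 𝓢(V, ℂ) → 𝓢(V, ℂ) → ℂ)
    (T : Lp ℂ q (volume : Measure V) → Lp ℂ 2 (volume : Measure V) →
      Lp ℂ 2 (volume : Measure V) → ℂ) : Prop :=
  ∀ (f : Lp ℂ q (volume : Measure V)) (g h : Lp ℂ 2 (volume : Measure V)),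
    sobolevNorm s g < ∞ → sobolevNorm r h < ∞ →
    ∀ F G H : ℕ → 𝓢(V, ℂ),
      Tendsto (fun n => eLpNorm (fun v => F n v - f v) q volume) atTop (𝓝 0) →
      Tendsto (fun n => sobolevNorm s ((G n).toLp 2 volume - g)) atTop (𝓝 0) →
      Tendsto (fun n => sobolevNorm r ((H n).toLp 2 volume - h)) atTop (𝓝 0) →
      Tendsto (fun n => P (F n) (G n) (H n)) atTop (𝓝 (T f g h))

/-- The estimate `|(Q_c(f, g), h)| ≤ C ‖f‖_{L^q} ‖g‖_{H^s} ‖h‖_{H^r}`: for all Schwartz functions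
and, through the extension by continuity, for all `f ∈ L^q`, `g ∈ H^s`, `h ∈ H^r`. -/
def TrilinearEstimate (b φ₀ : ℝ → ℝ) (γ : ℝ) (q : ℝ≥0∞) (s r : ℝ) : Prop :=
  ∃ C : ℝ≥0,
    (∀ f g h : 𝓢(V, ℂ), ‖pairingC b φ₀ γ f g h‖ₑ ≤
      C * eLpNorm f q volume * sobolevNorm s (g.toLp 2 volume) * sobolevNorm r (h.toLp 2 volume)) ∧
    ∃ T : Lp ℂ q (volume : Measure V) → Lp ℂ 2 (volume : Measure V) →
        Lp ℂ 2 (volume : Measure V) → ℂ,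
      IsExtension q s r (fun f g h => pairingC b φ₀ γ f g h) T ∧
      ∀ (f : Lp ℂ q (volume : Measure V)) (g h : Lp ℂ 2 (volume : Measure V)),
        sobolevNorm s g < ∞ → sobolevNorm r h < ∞ →
        ‖T f g h‖ₑ ≤ C * eLpNorm f q volume * sobolevNorm s g * sobolevNorm r h

end Boltzmann

open scoped Pointwise

namespace Boltzmann

/-! On the Fourier side the form with kernel truncated to θ ≥ ε is ∫∫ f̂(ξ_*) ĝ(ξ-ξ_*) conj ĥ(ξ)
K(ξ,ξ_*), where K(ξ,ξ_*) = ∫ b (Φ̂(ξ_*-ξ⁻) - Φ̂(ξ_*)) dσ, Φ̂ is the transform of Φ_c and ξ^± = (ξ ±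
|ξ|σ)/2 (`integral_collDiff_eq`). All estimates are proved for truncated kernels with constants
independent of ε. The principal value is recovered by dominated convergence: averaging over the
half-turn of σ about v-v_* makes f_*'g' - f_*g of size θ², which tames θ^(-2-ν) because ν < 2.

Φ̂ obeys symbol-type bounds of order -p for every 0 ≤ p < γ+3 (`exists_symbolBound_phiC`). Write X,
Y, Z for 1+|ξ_*|, 1+|ξ|, 1+|ξ-ξ_*| and d for |ξ/|ξ| - σ|. Where |ξ|d ≤ X the half-turn cancels the
first-order term of Φ̂(ξ_*-ξ⁻) - Φ̂(ξ_*), and this range contributes O(X^(-p) κ(Y/X)), with κ(r) = r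
for r ≤ 1 and κ(r) = r^ν beyond. Where |ξ|d > X the two values are bounded separately, and unless Y
≤ 10Z both obey the same bound. What is left is the resonant part, in which ξ_*-ξ⁻ may be close to 0
although ξ_* is not (`exists_multiplier_bound`).

The Sobolev norms of g and h provide the weights Z^(-a) Y^(-r), a + r = ν. In the non-resonant part
an elementary inequality (`weight_le`) replaces the weighted multiplier by a sum of
square-integrable functions, each of a single frequency variable, and Cauchy–Schwarz is applied
twice. In the resonant part the integral is cut into shells |ξ_*-ξ⁻| ~ 2^j. Only deviations d ≳
2^j/Y occur there, of angular mass 2^(-jν) Y^ν, and Y^ν is absorbed by the weights since Y ≤ 10Z.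
Cauchy–Schwarz separates f and h from g. The factor with g is treated by the change of variables ξ ↦
ξ⁺, whose Jacobian is bounded below on the forward half-space. The shells sum geometrically if 3/q <
p + ν (`exists_shell_bound`, `exists_resonant_bound`).

The function f enters only through the L² norms of f̂ on balls of radius U ≥ 1, which are
O(U^(3/q-3/2) ‖f‖_q) (`exists_fourier_ball_bound`); so the L² and the L^q statements are one
estimate. It needs γ > -3, 3/q < γ+3+ν and 3/q - 3/2 < γ+3+r. The extension to all f, g, h is the
usual Cauchy sequence argument. -/

instance : IsFiniteMeasure sphereMeasure := by unfold sphereMeasure; infer_instance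

/-! ### Surface measure of the sphere. -/

/-- The action of a linear isometry on the sphere. -/
noncomputable def sphereMap (R : V ≃ₗᵢ[ℝ] V) (σ : S2) : S2 :=
  ⟨R σ, by simp⟩

@[simp] lemma coe_sphereMap (R : V ≃ₗᵢ[ℝ] V) (σ : S2) : (sphereMap R σ : V) = R σ := rfl

@[simp] lemma norm_coe_sphere (σ : S2) : ‖(σ : V)‖ = 1 := by simp

lemma continuous_sphereMap (R : V ≃ₗᵢ[ℝ] V) : Continuous (sphereMap R) :=
  Continuous.subtype_mk (R.continuous.comp continuous_subtype_val) _

/-- The surface measure is read off from the volume of the cone over a set; a linear isometry maps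
cones to cones and preserves volume. -/
lemma measurePreserving_sphereMap (R : V ≃ₗᵢ[ℝ] V) :
    MeasurePreserving (sphereMap R) sphereMeasure sphereMeasure := by
  refine ⟨(continuous_sphereMap R).measurable, ?_⟩
  ext s hs
  rw [Measure.map_apply (continuous_sphereMap R).measurable hs, sphereMeasure,
    Measure.toSphere_apply' _ hs,
    Measure.toSphere_apply' _ ((continuous_sphereMap R).measurable hs)]
  congr 1
  have h : Set.Ioo (0 : ℝ) 1 • ((↑) '' (sphereMap R ⁻¹' s) : Set V) =
      R.toMeasurableEquiv ⁻¹' (Set.Ioo (0 : ℝ) 1 • ((↑) '' s : Set V)) := by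
    ext x
    simp only [Set.mem_smul, Set.mem_preimage, Set.mem_image]
    constructor
    · rintro ⟨t, ht, _, ⟨σ, hσ, rfl⟩, rfl⟩
      exact ⟨t, ht, _, ⟨_, hσ, rfl⟩, by simp⟩
    · rintro ⟨t, ht, _, ⟨σ, hσ, rfl⟩, hx⟩
      refine ⟨t, ht, _, ⟨sphereMap R.symm σ, ?_, rfl⟩, ?_⟩
      · have : sphereMap R (sphereMap R.symm σ) = σ := by ext1; simp
        simpa [this] using hσ
      · apply R.injective
        simpa using hx
  rw [h, (R.measurePreserving).measure_preimage_equiv]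

/-- The area of a spherical cap is at most a multiple of the square of its radius. -/
lemma exists_cap_bound : ∃ C : ℝ≥0, ∀ (e : S2) (r : ℝ), 0 ≤ r →
    sphereMeasure {σ : S2 | ‖(e : V) - σ‖ ≤ r} ≤ C * ENNReal.ofReal (r ^ 2) := by
  set B : ℝ≥0∞ := volume (Metric.closedBall (0 : V) 1) with hB
  have hBt : B ≠ ∞ := measure_closedBall_lt_top.ne
  have hpos : ∀ (e : S2) (r : ℝ), 0 < r → r ≤ 1 →
      sphereMeasure {σ : S2 | ‖(e : V) - σ‖ ≤ r} ≤ 72 * B * ENNReal.ofReal (r ^ 2) := by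
    intro e r hr hr1
    -- The measure of the cap is three times the volume of the cone over it. About n ≈ 1/r balls of
    -- radius 2r centred on the axis cover this cone, so its volume is of order n r³ ≲ r².
    obtain ⟨n, hn⟩ : ∃ n : ℕ, 1 / r ≤ n ∧ (n : ℝ) ≤ 1 / r + 1 :=
      ⟨⌈1 / r⌉₊, Nat.le_ceil _, (Nat.ceil_lt_add_one (by positivity)).le⟩
    have hn0 : (0 : ℝ) < n := lt_of_lt_of_le (by positivity) hn.1
    have hcl : MeasurableSet {σ : S2 | ‖(e : V) - σ‖ ≤ r} := by
      apply IsClosed.measurableSet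
      exact isClosed_le (by fun_prop) continuous_const
    rw [sphereMeasure, Measure.toSphere_apply' _ hcl]
    have hsub : Set.Ioo (0 : ℝ) 1 • ((↑) '' {σ : S2 | ‖(e : V) - σ‖ ≤ r} : Set V) ⊆
        ⋃ k ∈ Finset.range n, Metric.closedBall (((k : ℝ) / n) • (e : V)) (2 * r) := by
      rintro _ ⟨t, ht, _, ⟨σ, hσ, rfl⟩, rfl⟩
      simp only [Set.mem_ofPred_eq] at hσ
      have htn : 0 ≤ t * n := by have := ht.1; positivity
      have hk1 : ((⌊t * n⌋₊ : ℕ) : ℝ) ≤ t * n := Nat.floor_le htn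
      have hk2 : t * n < (⌊t * n⌋₊ : ℕ) + 1 := Nat.lt_floor_add_one _
      simp only [Set.mem_iUnion, Finset.mem_range]
      refine ⟨⌊t * n⌋₊, ?_, ?_⟩
      · rw [Nat.floor_lt htn]
        have := ht.2
        nlinarith
      · rw [mem_closedBall_iff_norm]
        have h1 : t • (σ : V) - (((⌊t * n⌋₊ : ℕ) : ℝ) / n) • (e : V) =
            t • ((σ : V) - e) + (t - ((⌊t * n⌋₊ : ℕ) : ℝ) / n) • (e : V) := by
          module
        have h2 : |t - ((⌊t * n⌋₊ : ℕ) : ℝ) / n| ≤ r := by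
          have h3 : t - ((⌊t * n⌋₊ : ℕ) : ℝ) / n = (t * n - (⌊t * n⌋₊ : ℕ)) / n := by
            field_simp
          rw [h3, abs_div, abs_of_pos hn0, div_le_iff₀ hn0, abs_of_nonneg (by linarith)]
          have h4 : 1 ≤ r * n := by
            have := hn.1
            rw [div_le_iff₀ hr] at this
            linarith
          linarith
        calc _ ≤ ‖t • ((σ : V) - e)‖ + ‖(t - ((⌊t * n⌋₊ : ℕ) : ℝ) / n) • (e : V)‖ := by
              rw [h1]; exact norm_add_le _ _
          _ ≤ 1 * r + r * 1 := by
              rw [norm_smul, norm_smul, norm_coe_sphere, norm_sub_rev (σ : V) e]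
              gcongr
              · rw [Real.norm_eq_abs, abs_of_pos ht.1]; exact ht.2.le
              · exact h2
          _ = 2 * r := by ring
    have hfin : Module.finrank ℝ V = 3 := by simp
    calc (Module.finrank ℝ V : ℝ≥0∞) * volume _
        ≤ 3 * ∑ k ∈ Finset.range n, volume (Metric.closedBall (((k : ℝ) / n) • (e : V)) (2 * r)) := by
          rw [hfin]
          push_cast
          gcongr
          exact (measure_mono hsub).trans (measure_biUnion_finset_le _ _)
      _ = 3 * (n * (ENNReal.ofReal ((2 * r) ^ 3) * B)) := by
          congr 1
          rw [Finset.sum_congr rfl fun (k : ℕ) _ =>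
            Measure.addHaar_closedBall' volume (((k : ℝ) / n) • (e : V)) (by positivity : 0 ≤ 2 * r)]
          rw [hfin, Finset.sum_const, Finset.card_range, nsmul_eq_mul]
      _ ≤ 72 * B * ENNReal.ofReal (r ^ 2) := by
          have h5 : (n : ℝ≥0∞) * ENNReal.ofReal ((2 * r) ^ 3) ≤ 24 * ENNReal.ofReal (r ^ 2) := by
            rw [← ENNReal.ofReal_natCast, ← ENNReal.ofReal_mul hn0.le,
              show (24 : ℝ≥0∞) = ENNReal.ofReal 24 by simp, ← ENNReal.ofReal_mul (by norm_num)]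
            apply ENNReal.ofReal_le_ofReal
            have h6 : n * r ≤ 2 := by
              have := mul_le_mul_of_nonneg_right hn.2 hr.le
              rw [add_mul, div_mul_cancel₀ _ hr.ne'] at this
              linarith
            have : (n : ℝ) * (2 * r) ^ 3 = 8 * (n * r) * r ^ 2 := by ring
            rw [this]
            nlinarith [sq_nonneg r]
          calc (3 : ℝ≥0∞) * (n * (ENNReal.ofReal ((2 * r) ^ 3) * B))
              = 3 * (n * ENNReal.ofReal ((2 * r) ^ 3)) * B := by ring
            _ ≤ 3 * (24 * ENNReal.ofReal (r ^ 2)) * B := by gcongr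
            _ = 72 * B * ENNReal.ofReal (r ^ 2) := by ring
  -- The second summand takes care of radii above 1; radius 0 is reached as a limit of positive
  -- radii.
  set A : ℝ≥0∞ := 72 * B + sphereMeasure Set.univ
  have hA : A ≠ ∞ := by
    simp only [A, ne_eq, ENNReal.add_eq_top, not_or]
    exact ⟨ENNReal.mul_ne_top (by simp) hBt, measure_ne_top _ _⟩
  refine ⟨A.toNNReal, fun e r hr => ?_⟩
  rw [ENNReal.coe_toNNReal hA]
  rcases le_or_gt r 1 with h | h
  · rcases hr.eq_or_lt with rfl | hr'
    · have hlim : ∀ ρ : ℝ, 0 < ρ → ρ ≤ 1 →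
          sphereMeasure {σ : S2 | ‖(e : V) - σ‖ ≤ 0} ≤ 72 * B * ENNReal.ofReal (ρ ^ 2) :=
        fun ρ h0 h1 => (measure_mono fun σ hσ => by
          simp only [Set.mem_ofPred_eq] at hσ ⊢; linarith).trans (hpos e ρ h0 h1)
      have ht : Tendsto (fun ρ : ℝ => 72 * B * ENNReal.ofReal (ρ ^ 2)) (𝓝[>] 0)
          (𝓝 (72 * B * ENNReal.ofReal (0 ^ 2))) := by
        refine Tendsto.mono_left ?_ nhdsWithin_le_nhds
        refine ENNReal.Tendsto.const_mul ?_ (Or.inr (ENNReal.mul_ne_top (by simp) hBt))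
        exact (ENNReal.continuous_ofReal.comp (continuous_pow 2)).tendsto 0
      refine (ge_of_tendsto ht ?_).trans (by gcongr; exact le_self_add)
      filter_upwards [Ioc_mem_nhdsGT (zero_lt_one' ℝ)] with ρ hρ
      exact hlim ρ hρ.1 hρ.2
    · exact (hpos e r hr' h).trans (by gcongr; exact le_self_add)
  · calc _ ≤ sphereMeasure Set.univ := measure_mono (Set.subset_univ _)
      _ ≤ A * 1 := by rw [mul_one]; exact le_add_self
      _ ≤ A * ENNReal.ofReal (r ^ 2) := by
        gcongr
        rw [ENNReal.one_le_ofReal]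
        nlinarith

lemma tsum_ofReal_geometric {c r : ℝ} (hc : 0 ≤ c) (hr : 0 ≤ r) (hr1 : r < 1) :
    ∑' k : ℕ, ENNReal.ofReal (c * r ^ k) = ENNReal.ofReal (c * (1 - r)⁻¹) := by
  rw [← ENNReal.ofReal_tsum_of_nonneg (fun k => by positivity)
    ((summable_geometric_of_lt_one hr hr1).mul_left c), tsum_mul_left,
    tsum_geometric_of_lt_one hr hr1]

/-! ### Power singularities on the sphere. -/

section Dyadic

variable {α : Type*} [MeasurableSpace α] {μ : Measure α} {d : α → ℝ} {C : ℝ≥0∞}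

/-- If the sublevel sets of `d` grow quadratically, then `d ^ (-2 - ν)` is integrable away
from the zero set of `d`. -/
lemma setLIntegral_rpow_far_le (hd : Measurable d)
    (hC : ∀ r, 0 ≤ r → μ {x | d x ≤ r} ≤ C * ENNReal.ofReal (r ^ 2)) {ν : ℝ} (hν : 0 < ν)
    {δ : ℝ} (hδ : 0 < δ) :
    ∫⁻ x in {x | δ ≤ d x}, ENNReal.ofReal (d x ^ (-2 - ν)) ∂μ ≤
      C * ENNReal.ofReal (4 * (1 - 2 ^ (-ν))⁻¹) * ENNReal.ofReal (δ ^ (-ν)) := by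
  have hms : ∀ r : ℝ, MeasurableSet {x | d x ≤ r} := fun r => hd measurableSet_Iic
  calc ∫⁻ x in {x | δ ≤ d x}, ENNReal.ofReal (d x ^ (-2 - ν)) ∂μ
      ≤ ∫⁻ x in {x | δ ≤ d x}, ∑' k : ℕ, {x | d x ≤ 2 ^ (k + 1) * δ}.indicator
          (fun _ => ENNReal.ofReal ((2 ^ k * δ) ^ (-2 - ν))) x ∂μ := by
        refine setLIntegral_mono' (hd measurableSet_Ici) fun x (hx : δ ≤ d x) => ?_
        -- On 2^k δ ≤ d < 2^(k+1) δ the integrand times the measure is at most (2^k δ)^(-2-ν)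
        -- (2^(k+1) δ)² = 4 δ^(-ν) 2^(-νk), up to `C`.
        obtain ⟨k, hk1, hk2⟩ := exists_nat_pow_near ((one_le_div hδ).2 hx) (one_lt_two (α := ℝ))
        rw [le_div_iff₀ hδ] at hk1
        rw [div_lt_iff₀ hδ] at hk2
        refine le_trans ?_ (ENNReal.le_tsum k)
        rw [Set.indicator_of_mem (show x ∈ {x | d x ≤ 2 ^ (k + 1) * δ} from hk2.le)]
        exact ENNReal.ofReal_le_ofReal
          (Real.rpow_le_rpow_of_nonpos (by positivity) hk1 (by linarith))
    _ ≤ ∫⁻ x, ∑' k : ℕ, {x | d x ≤ 2 ^ (k + 1) * δ}.indicator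
          (fun _ => ENNReal.ofReal ((2 ^ k * δ) ^ (-2 - ν))) x ∂μ := setLIntegral_le_lintegral _ _
    _ = ∑' k : ℕ, ENNReal.ofReal ((2 ^ k * δ) ^ (-2 - ν)) * μ {x | d x ≤ 2 ^ (k + 1) * δ} := by
        rw [lintegral_tsum fun k => (measurable_const.indicator (hms _)).aemeasurable]
        simp_rw [lintegral_indicator_const (hms _)]
    _ ≤ ∑' k : ℕ, C * ENNReal.ofReal (4 * δ ^ (-ν) * (2 ^ (-ν)) ^ k) := by
        refine ENNReal.tsum_le_tsum fun k => ?_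
        refine (mul_le_mul_right (hC _ (by positivity)) _).trans_eq ?_
        rw [mul_left_comm, ← ENNReal.ofReal_mul (by positivity)]
        congr 2
        have h2 : ((2 : ℝ) ^ k * δ) ^ (-2 - ν) = ((2 : ℝ) ^ k * δ) ^ (-ν) / ((2 : ℝ) ^ k * δ) ^ 2 := by
          rw [show -2 - ν = -ν - 2 by ring, Real.rpow_sub (by positivity)]
          norm_num
        have h3 : ((2 : ℝ) ^ k * δ) ^ (-ν) = δ ^ (-ν) * (2 ^ (-ν)) ^ k := by
          rw [Real.mul_rpow (by positivity) hδ.le, mul_comm, ← Real.rpow_natCast 2 k,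
            ← Real.rpow_natCast _ k, ← Real.rpow_mul (by norm_num), ← Real.rpow_mul (by norm_num),
            mul_comm (k : ℝ)]
        rw [h2, h3]
        field_simp
        ring
    _ = _ := by
        have h1 : (2 : ℝ) ^ (-ν) < 1 := Real.rpow_lt_one_of_one_lt_of_neg (by norm_num) (by linarith)
        rw [ENNReal.tsum_mul_left, tsum_ofReal_geometric (by positivity) (by positivity) h1,
          mul_assoc C, ← ENNReal.ofReal_mul
            (mul_nonneg (by norm_num) (inv_nonneg.2 (by linarith)))]
        congr 2
        ring

/-- If the sublevel sets of `d` grow quadratically, then `d ^ (-ν)` with `ν < 2` is integrable near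
the zero set of `d`. -/
lemma setLIntegral_rpow_near_le (hd : Measurable d) (hd0 : ∀ x, 0 ≤ d x)
    (hC : ∀ r, 0 ≤ r → μ {x | d x ≤ r} ≤ C * ENNReal.ofReal (r ^ 2)) {ν : ℝ} (hν : 0 < ν)
    (hν2 : ν < 2) {δ : ℝ} (hδ : 0 < δ) :
    ∫⁻ x in {x | d x ≤ δ}, ENNReal.ofReal (d x ^ (-ν)) ∂μ ≤
      C * ENNReal.ofReal (2 ^ ν * (1 - 2 ^ (ν - 2))⁻¹) * ENNReal.ofReal (δ ^ (2 - ν)) := by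
  have hms : ∀ r : ℝ, MeasurableSet {x | d x ≤ r} := fun r => hd measurableSet_Iic
  calc ∫⁻ x in {x | d x ≤ δ}, ENNReal.ofReal (d x ^ (-ν)) ∂μ
      ≤ ∫⁻ x in {x | d x ≤ δ}, ∑' k : ℕ, {x | d x ≤ (1 / 2) ^ k * δ}.indicator
          (fun _ => ENNReal.ofReal (((1 / 2) ^ (k + 1) * δ) ^ (-ν))) x ∂μ := by
        refine setLIntegral_mono' (hms δ) fun x (hx : d x ≤ δ) => ?_
        rcases (hd0 x).eq_or_lt with h0 | h0
        -- By the convention for powers of 0 the integrand vanishes where `d` does.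
        · rw [← h0, Real.zero_rpow (by linarith)]
          simp
        obtain ⟨k, hk1, hk2⟩ := exists_nat_pow_near_of_lt_one (div_pos h0 hδ)
          ((div_le_one hδ).2 hx) (by norm_num : (0 : ℝ) < 1 / 2) (by norm_num)
        rw [lt_div_iff₀ hδ] at hk1
        rw [div_le_iff₀ hδ] at hk2
        refine le_trans ?_ (ENNReal.le_tsum k)
        rw [Set.indicator_of_mem (show x ∈ {x | d x ≤ (1 / 2) ^ k * δ} from hk2)]
        exact ENNReal.ofReal_le_ofReal
          (Real.rpow_le_rpow_of_nonpos (by positivity) hk1.le (by linarith))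
    _ ≤ ∫⁻ x, ∑' k : ℕ, {x | d x ≤ (1 / 2) ^ k * δ}.indicator
          (fun _ => ENNReal.ofReal (((1 / 2) ^ (k + 1) * δ) ^ (-ν))) x ∂μ :=
        setLIntegral_le_lintegral _ _
    _ = ∑' k : ℕ, ENNReal.ofReal (((1 / 2) ^ (k + 1) * δ) ^ (-ν)) * μ {x | d x ≤ (1 / 2) ^ k * δ} := by
        rw [lintegral_tsum fun k => (measurable_const.indicator (hms _)).aemeasurable]
        simp_rw [lintegral_indicator_const (hms _)]
    _ ≤ ∑' k : ℕ, C * ENNReal.ofReal (2 ^ ν * δ ^ (2 - ν) * (2 ^ (ν - 2)) ^ k) := by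
        refine ENNReal.tsum_le_tsum fun k => ?_
        refine (mul_le_mul_right (hC _ (by positivity)) _).trans_eq ?_
        rw [mul_left_comm, ← ENNReal.ofReal_mul (by positivity)]
        congr 2
        have h1 : ((1 / 2 : ℝ)) = 2 ^ (-1 : ℝ) := by rw [Real.rpow_neg_one]; norm_num
        have e1 : ((1 / 2 : ℝ) ^ (k + 1) * δ) ^ (-ν) = 2 ^ (ν * (k + 1)) * δ ^ (-ν) := by
          rw [Real.mul_rpow (by positivity) hδ.le, h1, ← Real.rpow_natCast, ← Real.rpow_mul
            (by norm_num), ← Real.rpow_mul (by norm_num)]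
          push_cast
          ring_nf
        have e2 : ((1 / 2 : ℝ) ^ k * δ) ^ 2 = 2 ^ (-2 * k : ℝ) * δ ^ (2 : ℝ) := by
          rw [mul_pow, ← pow_mul, h1, ← Real.rpow_natCast, ← Real.rpow_mul (by norm_num)]
          push_cast
          norm_num
          left
          ring_nf
        rw [e1, e2, ← Real.rpow_natCast _ k, ← Real.rpow_mul (by norm_num)]
        rw [show (2 : ℝ) ^ (ν * (k + 1)) * δ ^ (-ν) * (2 ^ (-2 * k : ℝ) * δ ^ (2 : ℝ)) =
          (2 ^ (ν * (k + 1)) * 2 ^ (-2 * k : ℝ)) * (δ ^ (2 : ℝ) * δ ^ (-ν)) by ring,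
          ← Real.rpow_add (by norm_num), ← Real.rpow_add hδ, mul_right_comm,
          ← Real.rpow_add (by norm_num)]
        ring_nf
    _ = _ := by
        have h1 : (2 : ℝ) ^ (ν - 2) < 1 :=
          Real.rpow_lt_one_of_one_lt_of_neg (by norm_num) (by linarith)
        rw [ENNReal.tsum_mul_left, tsum_ofReal_geometric (by positivity) (by positivity) h1,
          mul_assoc C, ← ENNReal.ofReal_mul
            (mul_nonneg (by positivity) (inv_nonneg.2 (by linarith)))]
        congr 2
        ring

end Dyadic

lemma exists_sphere_far_bound {ν : ℝ} (hν : 0 < ν) : ∃ C : ℝ≥0, ∀ (e : S2) (δ : ℝ), 0 < δ →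
    ∫⁻ σ in {σ : S2 | δ ≤ ‖(e : V) - σ‖}, ENNReal.ofReal (‖(e : V) - σ‖ ^ (-2 - ν)) ∂sphereMeasure
      ≤ C * ENNReal.ofReal (δ ^ (-ν)) := by
  obtain ⟨C, hC⟩ := exists_cap_bound
  refine ⟨C * Real.toNNReal (4 * (1 - 2 ^ (-ν))⁻¹), fun e δ hδ => ?_⟩
  rw [ENNReal.coe_mul]
  exact setLIntegral_rpow_far_le (by fun_prop) (hC e) hν hδ

lemma exists_sphere_near_bound {ν : ℝ} (hν : 0 < ν) (hν2 : ν < 2) :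
    ∃ C : ℝ≥0, ∀ (e : S2) (δ : ℝ), 0 < δ →
    ∫⁻ σ in {σ : S2 | ‖(e : V) - σ‖ ≤ δ}, ENNReal.ofReal (‖(e : V) - σ‖ ^ (-ν)) ∂sphereMeasure
      ≤ C * ENNReal.ofReal (δ ^ (2 - ν)) := by
  obtain ⟨C, hC⟩ := exists_cap_bound
  refine ⟨C * Real.toNNReal (2 ^ ν * (1 - 2 ^ (ν - 2))⁻¹), fun e δ hδ => ?_⟩
  rw [ENNReal.coe_mul]
  exact setLIntegral_rpow_near_le (by fun_prop) (fun _ => norm_nonneg _) (hC e) hν hν2 hδ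

/-! ### Half-turns, post-collisional vectors and the exchange of directions. -/

/-- The cosine of the angle between two unit vectors. -/
noncomputable def sdot (e σ : S2) : ℝ := inner ℝ (e : V) (σ : V)

lemma sdot_comm (e σ : S2) : sdot e σ = sdot σ e := real_inner_comm _ _

lemma continuous_sdot : Continuous fun p : S2 × S2 => sdot p.1 p.2 := by
  unfold sdot; fun_prop

lemma norm_sub_sq_sphere (e σ : S2) : ‖(e : V) - σ‖ ^ 2 = 2 - 2 * sdot e σ := by
  rw [norm_sub_sq_real, norm_coe_sphere, norm_coe_sphere, sdot]; ring

lemma norm_add_sq_sphere (e σ : S2) : ‖(e : V) + σ‖ ^ 2 = 2 + 2 * sdot e σ := by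
  rw [norm_add_sq_real, norm_coe_sphere, norm_coe_sphere, sdot]; ring

lemma sdot_le_one (e σ : S2) : sdot e σ ≤ 1 := by
  have := real_inner_le_norm (e : V) (σ : V)
  simpa [sdot] using this

lemma neg_one_le_sdot (e σ : S2) : -1 ≤ sdot e σ := by
  have := neg_le_of_abs_le (abs_real_inner_le_norm (e : V) (σ : V))
  simpa [sdot] using this

lemma norm_sub_sphere_le_two (e σ : S2) : ‖(e : V) - σ‖ ≤ 2 := by
  refine (norm_sub_le _ _).trans ?_
  norm_num

/-- The image of `σ` under the half-turn about the axis `e`. -/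
noncomputable def halfTurn (e σ : S2) : S2 :=
  ⟨(2 * sdot e σ) • (e : V) - σ, by
    rw [mem_sphere_zero_iff_norm, ← sq_eq_sq₀ (norm_nonneg _) zero_le_one, norm_sub_sq_real,
      norm_smul, inner_smul_left, norm_coe_sphere, norm_coe_sphere]
    simp only [Real.norm_eq_abs, mul_one, sq_abs, conj_trivial]
    unfold sdot
    ring⟩

lemma coe_halfTurn (e σ : S2) : (halfTurn e σ : V) = (2 * sdot e σ) • (e : V) - σ := rfl

lemma continuous_halfTurn : Continuous fun p : S2 × S2 => halfTurn p.1 p.2 := by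
  refine Continuous.subtype_mk ?_ _
  have := continuous_sdot
  fun_prop

lemma sdot_halfTurn (e σ : S2) : sdot e (halfTurn e σ) = sdot e σ := by
  rw [sdot, coe_halfTurn, inner_sub_right, inner_smul_right, real_inner_self_eq_norm_sq,
    norm_coe_sphere, sdot]
  ring

lemma halfTurn_eq_sphereMap (e : S2) :
    halfTurn e = sphereMap (Submodule.reflection (Submodule.span ℝ {(e : V)})) := by
  ext1 σ
  apply Subtype.ext
  rw [coe_halfTurn, coe_sphereMap, Submodule.reflection_singleton_apply]
  simp [sdot, two_smul, two_mul, add_smul]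

lemma measurePreserving_halfTurn (e : S2) :
    MeasurePreserving (halfTurn e) sphereMeasure sphereMeasure := by
  rw [halfTurn_eq_sphereMap]
  exact measurePreserving_sphereMap _

/-- The half-turn reverses the component of `σ` orthogonal to `e`. The first-order parts of the two
deviations therefore cancel, and a vector along `e` of quadratic size remains. This is the source of
the cancellation both in velocity and in frequency variables. -/
lemma sub_add_sub_halfTurn (e σ : S2) :
    ((e : V) - σ) + (e - halfTurn e σ) = (‖(e : V) - σ‖ ^ 2) • (e : V) := by
  rw [norm_sub_sq_sphere, coe_halfTurn]
  module

lemma norm_sub_halfTurn (e σ : S2) : ‖(e : V) - halfTurn e σ‖ = ‖(e : V) - σ‖ := by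
  rw [← sq_eq_sq₀ (norm_nonneg _) (norm_nonneg _), norm_sub_sq_sphere, norm_sub_sq_sphere,
    sdot_halfTurn]

/-- Integrals over the sphere of functions of `e · σ` and `e' · σ` are symmetric in `e`, `e'`. -/
lemma integral_sdot_sdot_comm (F : ℝ → ℝ → ℂ) (e e' : S2) :
    ∫ σ, F (sdot e σ) (sdot e' σ) ∂sphereMeasure = ∫ σ, F (sdot e' σ) (sdot e σ) ∂sphereMeasure := by
  -- The reflection in the hyperplane orthogonal to `e - e'` interchanges `e` and `e'`.
  set R := Submodule.reflection (Submodule.span ℝ {(e : V) - e'})ᗮ with hR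
  have h1 : R e = e' := Submodule.reflection_sub (by simp)
  have h2 : R e' = e := by rw [← h1, Submodule.reflection_reflection]
  have hs : ∀ σ, sdot e (sphereMap R σ) = sdot e' σ := fun σ => by
    rw [sdot, coe_sphereMap, ← h2, R.inner_map_map, sdot]
  have hs' : ∀ σ, sdot e' (sphereMap R σ) = sdot e σ := fun σ => by
    rw [sdot, coe_sphereMap, ← h1, R.inner_map_map, sdot]
  have hemb : MeasurableEmbedding (sphereMap R) := by
    refine (Homeomorph.measurableEmbedding ⟨⟨sphereMap R, sphereMap R.symm, ?_, ?_⟩,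
      continuous_sphereMap R, continuous_sphereMap R.symm⟩ : MeasurableEmbedding (sphereMap R)) <;>
    · intro σ; ext1; simp
  rw [← (measurePreserving_sphereMap R).integral_comp hemb]
  simp_rw [hs, hs']

instance : Nonempty S2 := ⟨⟨EuclideanSpace.single 0 1, by simp⟩⟩

open Classical in
/-- The direction `z / |z|` (an arbitrary unit vector for `z = 0`). -/
noncomputable def dir (z : V) : S2 :=
  if h : z = 0 then Classical.arbitrary S2 else ⟨‖z‖⁻¹ • z, by simp [norm_smul, h]⟩

lemma coe_dir_of_ne {z : V} (h : z ≠ 0) : (dir z : V) = ‖z‖⁻¹ • z := by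
  simp [dir, h]

@[simp] lemma norm_smul_dir (z : V) : ‖z‖ • (dir z : V) = z := by
  rcases eq_or_ne z 0 with rfl | h
  · simp
  · rw [coe_dir_of_ne h, smul_smul, mul_inv_cancel₀ (norm_ne_zero_iff.2 h), one_smul]

lemma dir_smul {r : ℝ} (hr : 0 < r) (σ : S2) : dir (r • (σ : V)) = σ := by
  have h : r • (σ : V) ≠ 0 := by
    rw [← norm_ne_zero_iff, norm_smul]; simp [hr.ne']
  apply Subtype.ext
  rw [coe_dir_of_ne h, norm_smul, norm_coe_sphere, smul_smul, Real.norm_eq_abs, abs_of_pos hr]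
  simp [hr.ne']

lemma measurable_dir : Measurable dir := by
  classical
  have h : Measurable fun z : V => if z = 0 then ((Classical.arbitrary S2 : S2) : V) else ‖z‖⁻¹ • z :=
    Measurable.ite (measurableSet_singleton 0) measurable_const (by fun_prop)
  refine (MeasurableEmbedding.subtype_coe Metric.isClosed_sphere.measurableSet).measurable_comp_iff.1
    ?_
  convert h using 1
  ext1 z
  by_cases hz : z = 0 <;> simp [dir, hz]

attribute [irreducible] dir halfTurn

/-- The vector `z⁻ = (z - |z| σ) / 2`. -/
noncomputable def zm (z : V) (σ : S2) : V := (1 / 2 : ℝ) • (z - ‖z‖ • (σ : V))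

/-- The vector `z⁺ = (z + |z| σ) / 2`. -/
noncomputable def zp (z : V) (σ : S2) : V := (1 / 2 : ℝ) • (z + ‖z‖ • (σ : V))

lemma continuous_zm : Continuous fun p : V × S2 => zm p.1 p.2 := by unfold zm; fun_prop

lemma continuous_zp : Continuous fun p : V × S2 => zp p.1 p.2 := by unfold zp; fun_prop

lemma zm_eq (z : V) (σ : S2) : zm z σ = (‖z‖ / 2) • ((dir z : V) - σ) := by
  rw [smul_sub, div_eq_mul_one_div, mul_comm, mul_smul, norm_smul_dir, zm]
  module

lemma zp_eq (z : V) (σ : S2) : zp z σ = (‖z‖ / 2) • ((dir z : V) + σ) := by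
  rw [smul_add, div_eq_mul_one_div, mul_comm, mul_smul, norm_smul_dir, zp]
  module

lemma zp_add_zm (z : V) (σ : S2) : zp z σ + zm z σ = z := by unfold zp zm; module

lemma norm_zm (z : V) (σ : S2) : ‖zm z σ‖ = ‖z‖ / 2 * ‖(dir z : V) - σ‖ := by
  rw [zm_eq, norm_smul, Real.norm_of_nonneg (by positivity)]

lemma norm_zp (z : V) (σ : S2) : ‖zp z σ‖ = ‖z‖ / 2 * ‖(dir z : V) + σ‖ := by
  rw [zp_eq, norm_smul, Real.norm_of_nonneg (by positivity)]

lemma post_eq (v vs : V) (σ : S2) : post v vs σ = v - zm (v - vs) σ := by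
  unfold post zm; module

lemma postStar_eq (v vs : V) (σ : S2) : postStar v vs σ = v - zp (v - vs) σ := by
  unfold postStar zp; module

lemma norm_zm_halfTurn (z : V) (σ : S2) : ‖zm z (halfTurn (dir z) σ)‖ = ‖zm z σ‖ := by
  rw [norm_zm, norm_zm, norm_sub_halfTurn]

lemma norm_zm_add_zm_halfTurn (z : V) (σ : S2) :
    ‖zm z σ + zm z (halfTurn (dir z) σ)‖ = ‖z‖ / 2 * ‖(dir z : V) - σ‖ ^ 2 := by
  rw [zm_eq, zm_eq, ← smul_add, sub_add_sub_halfTurn, norm_smul, norm_smul, norm_coe_sphere]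
  rw [Real.norm_of_nonneg (by positivity), Real.norm_of_nonneg (by positivity), mul_one]

lemma measurable_halfTurn_dir : Measurable fun p : V × S2 => halfTurn (dir p.1) p.2 := by
  have h1 : Measurable fun p : S2 × S2 => halfTurn p.1 p.2 := continuous_halfTurn.measurable
  have h2 : Measurable fun p : V × S2 => (dir p.1, p.2) :=
    (measurable_dir.comp measurable_fst).prodMk measurable_snd
  have h3 := h1.comp h2
  simp only [Function.comp_def] at h3
  exact h3

/-- The half-turn about `z`, applied to the second variable, preserves `dz dσ`. -/
lemma measurePreserving_halfTurn_prod :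
    MeasurePreserving (fun p : V × S2 => (p.1, halfTurn (dir p.1) p.2))
      ((volume : Measure V).prod sphereMeasure) ((volume : Measure V).prod sphereMeasure) :=
  (MeasurePreserving.id (volume : Measure V)).skew_product (f := id)
    (g := fun z σ => halfTurn (dir z) σ) measurable_halfTurn_dir
    (ae_of_all _ fun z => (measurePreserving_halfTurn (dir z)).map_eq)

/-- Exchange of the direction of `z` with `σ`. -/
noncomputable def exchange (p : V × S2) : V × S2 := (‖p.1‖ • (p.2 : V), dir p.1)

lemma measurable_exchange : Measurable exchange :=
  Measurable.prodMk (by fun_prop) (measurable_dir.comp measurable_fst)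

/-- Polar coordinates parametrize the punctured space, and the origin is a null set. -/
lemma measurePreserving_polar : MeasurePreserving
    (fun p : S2 × Set.Ioi (0 : ℝ) => (p.2 : ℝ) • (p.1 : V))
    (sphereMeasure.prod (Measure.volumeIoiPow 2)) (volume : Measure V) := by
  have h1 := (volume : Measure V).measurePreserving_homeomorphUnitSphereProd
  have h2 := MeasurePreserving.symm (homeomorphUnitSphereProd V).toMeasurableEquiv h1
  have h3 : MeasurePreserving (Subtype.val : ({0}ᶜ : Set V) → V)
      ((volume : Measure V).comap Subtype.val) volume := by
    refine ⟨measurable_subtype_coe, ?_⟩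
    rw [map_comap_subtype_coe (measurableSet_singleton _).compl, restrict_compl_singleton]
  have h4 := h3.comp h2
  have hfin : Module.finrank ℝ V - 1 = 2 := by simp
  rw [hfin] at h4
  exact h4

/-- The exchange of the direction of `z` with `σ` preserves `dz dσ`. -/
lemma measurePreserving_exchange :
    MeasurePreserving exchange
      ((volume : Measure V).prod sphereMeasure) ((volume : Measure V).prod sphereMeasure) := by
  -- With z = r e the exchange is (e, r, σ) ↦ (σ, r, e), a permutation of the factors of a product
  -- measure.
  set ρ := Measure.volumeIoiPow 2
  have hQ := measurePreserving_polar.prod (MeasurePreserving.id sphereMeasure)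
  have hS : MeasurePreserving
      (fun p : (S2 × Set.Ioi (0 : ℝ)) × S2 => ((p.2, p.1.2), p.1.1))
      ((sphereMeasure.prod ρ).prod sphereMeasure) ((sphereMeasure.prod ρ).prod sphereMeasure) := by
    have h1 := measurePreserving_prodAssoc sphereMeasure ρ sphereMeasure
    have h2 : MeasurePreserving Prod.swap (sphereMeasure.prod (ρ.prod sphereMeasure))
      ((ρ.prod sphereMeasure).prod sphereMeasure) := Measure.measurePreserving_swap
    have h3 : MeasurePreserving Prod.swap (ρ.prod sphereMeasure) (sphereMeasure.prod ρ) :=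
      Measure.measurePreserving_swap
    exact ((h3.prod (MeasurePreserving.id sphereMeasure)).comp h2).comp h1
  refine ⟨measurable_exchange, ?_⟩
  conv_lhs => rw [← hQ.map_eq]
  rw [Measure.map_map measurable_exchange hQ.measurable]
  have hcomm : exchange ∘ Prod.map (fun p : S2 × Set.Ioi (0 : ℝ) => (p.2 : ℝ) • (p.1 : V)) id =
      Prod.map (fun p : S2 × Set.Ioi (0 : ℝ) => (p.2 : ℝ) • (p.1 : V)) id ∘
        fun p : (S2 × Set.Ioi (0 : ℝ)) × S2 => ((p.2, p.1.2), p.1.1) := by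
    ext1 ⟨⟨e, r⟩, σ⟩
    have hr : (0 : ℝ) < r := r.2
    simp only [exchange, Function.comp_apply, Prod.map_apply, id_eq, dir_smul hr, norm_smul,
      norm_coe_sphere, Real.norm_eq_abs, abs_of_pos hr, mul_one]
  rw [hcomm, ← Measure.map_map hQ.measurable hS.measurable, hS.map_eq, hQ.map_eq]

lemma norm_exchange_fst (p : V × S2) : ‖(exchange p).1‖ = ‖p.1‖ := by
  simp [exchange, norm_smul]

lemma sdot_exchange (p : V × S2) (hp : p.1 ≠ 0) :
    sdot (dir (exchange p).1) (exchange p).2 = sdot (dir p.1) p.2 := by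
  simp only [exchange]
  rw [dir_smul (norm_pos_iff.2 hp), sdot_comm]

lemma zm_exchange (p : V × S2) : zm (exchange p).1 (exchange p).2 = - zm p.1 p.2 := by
  simp only [exchange, zm, norm_smul, norm_coe_sphere, norm_norm, mul_one, norm_smul_dir]
  module

lemma exchange_fst (p : V × S2) : (exchange p).1 = zp p.1 p.2 - zm p.1 p.2 := by
  simp only [exchange, zp, zm]
  module

/-! ### Bounds on the angular kernel and its truncations. -/

section Kernel

variable {ν : ℝ} {b : ℝ → ℝ}

lemma cos_arccos_sdot (e σ : S2) : Real.cos (Real.arccos (sdot e σ)) = sdot e σ :=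
  Real.cos_arccos (neg_one_le_sdot e σ) (sdot_le_one e σ)

/-- A chord is no longer than its arc: 2 - 2 cos θ ≤ θ². -/
lemma norm_sub_le_arccos (e σ : S2) : ‖(e : V) - σ‖ ≤ Real.arccos (sdot e σ) := by
  refine abs_le_of_sq_le_sq' ?_ (Real.arccos_nonneg _) |>.2
  rw [norm_sub_sq_sphere]
  have := Real.one_sub_sq_div_two_le_cos (x := Real.arccos (sdot e σ))
  rw [cos_arccos_sdot] at this
  linarith

lemma arccos_sdot_pos {e σ : S2} (h : e ≠ σ) : 0 < Real.arccos (sdot e σ) :=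
  lt_of_lt_of_le (norm_pos_iff.2 (sub_ne_zero.2 fun h' => h (Subtype.ext h')))
    (norm_sub_le_arccos e σ)

/-- Near θ = 0 the asymptotics give a multiple of θ^(-2-ν), which only grows when θ is replaced by
the shorter chord; for θ ≥ δ the kernel is bounded and the chord is at most 2. The chord is
preferred to the angle because the half-turn identities are algebraic in it. -/
lemma IsNonCutoffKernel.exists_bound (hb : IsNonCutoffKernel ν b) (hν : 0 < ν) :
    ∃ C : ℝ, 0 ≤ C ∧ ∀ e σ : S2, e ≠ σ → b (sdot e σ) ≤ C * ‖(e : V) - σ‖ ^ (-2 - ν) := by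
  obtain ⟨K, hK, hsing⟩ := hb.singular
  obtain ⟨c, hc⟩ := hsing.isBigO.bound
  obtain ⟨δ, hδ, hδc⟩ := (nhdsGT_basis (0 : ℝ)).eventually_iff.1 hc
  obtain ⟨M, hM⟩ := hb.bounded_away δ hδ
  set C := max (c * K) 0 + max M 0 * 2 ^ (2 + ν)
  refine ⟨C, by positivity, fun e σ h => ?_⟩
  have hd0 : 0 < ‖(e : V) - σ‖ := norm_pos_iff.2 (sub_ne_zero.2 fun h' => h (Subtype.ext h'))
  set d := ‖(e : V) - σ‖
  set θ := Real.arccos (sdot e σ) with hθ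
  have hdθ : d ≤ θ := norm_sub_le_arccos e σ
  have hθ0 : 0 < θ := hd0.trans_le hdθ
  have hdp : 0 < d ^ (-2 - ν) := by positivity
  rcases lt_or_ge (sdot e σ) 0 with hneg | hpos
  · rw [hb.eq_zero_of_neg _ hneg]; positivity
  have hθ2 : θ ≤ Real.pi / 2 := Real.arccos_le_pi_div_two.2 hpos
  rw [← cos_arccos_sdot e σ, ← hθ]
  rcases lt_or_ge θ δ with h1 | h1
  · have h2 := hδc (show θ ∈ Set.Ioo 0 δ from ⟨hθ0, h1⟩)
    have h3 : b (Real.cos θ) ≤ c * (K * θ ^ (-2 - ν)) := by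
      refine (le_abs_self _).trans (h2.trans_eq ?_)
      rw [Real.norm_of_nonneg (by positivity)]
    calc b (Real.cos θ) ≤ (c * K) * θ ^ (-2 - ν) := by rw [mul_assoc]; exact h3
      _ ≤ max (c * K) 0 * d ^ (-2 - ν) := by
        refine mul_le_mul (le_max_left _ _)
          (Real.rpow_le_rpow_of_nonpos hd0 hdθ (by linarith)) (by positivity) (le_max_right _ _)
      _ ≤ C * d ^ (-2 - ν) := by
        gcongr
        exact le_add_of_nonneg_right (by positivity)
  · calc b (Real.cos θ) ≤ max M 0 := (hM θ ⟨h1, hθ2⟩).trans (le_max_left _ _)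
      _ = max M 0 * 2 ^ (2 + ν) * 2 ^ (-2 - ν) := by
        rw [mul_assoc, ← Real.rpow_add (by norm_num)]
        simp
      _ ≤ max M 0 * 2 ^ (2 + ν) * d ^ (-2 - ν) := by
        gcongr _ * ?_
        exact Real.rpow_le_rpow_of_nonpos hd0 (norm_sub_sphere_le_two e σ) (by linarith)
      _ ≤ C * d ^ (-2 - ν) := by
        gcongr
        exact le_add_of_nonneg_left (by positivity)

/-- The angular kernel, restricted to deviation angles `θ ≥ ε`, as a function of `cos θ`. -/
noncomputable def truncKernel (b : ℝ → ℝ) (ε t : ℝ) : ℝ := if ε ≤ Real.arccos t then b t else 0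

lemma measurable_truncKernel (hb : IsNonCutoffKernel ν b) (ε : ℝ) :
    Measurable (truncKernel b ε) :=
  Measurable.ite (measurableSet_le measurable_const Real.measurable_arccos) hb.measurable
    measurable_const

lemma truncKernel_nonneg (hb : IsNonCutoffKernel ν b) (ε t : ℝ) : 0 ≤ truncKernel b ε t := by
  unfold truncKernel
  split_ifs
  exacts [hb.nonneg t, le_rfl]

lemma truncKernel_le (hb : IsNonCutoffKernel ν b) (ε t : ℝ) : truncKernel b ε t ≤ b t := by
  unfold truncKernel
  split_ifs
  exacts [le_rfl, hb.nonneg t]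

lemma truncKernel_of_neg (hb : IsNonCutoffKernel ν b) (ε : ℝ) {t : ℝ} (ht : t < 0) :
    truncKernel b ε t = 0 := by
  simp [truncKernel, hb.eq_zero_of_neg t ht]

lemma truncKernel_self {ε : ℝ} (hε : 0 < ε) (e : S2) : truncKernel b ε (sdot e e) = 0 := by
  have : sdot e e = 1 := by rw [sdot, real_inner_self_eq_norm_sq]; simp
  simp [truncKernel, this, hε]

lemma exists_truncKernel_le (hb : IsNonCutoffKernel ν b) {ε : ℝ} (hε : 0 < ε) :
    ∃ M : ℝ, 0 ≤ M ∧ ∀ e σ : S2, truncKernel b ε (sdot e σ) ≤ M := by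
  obtain ⟨M, hM⟩ := hb.bounded_away ε hε
  refine ⟨max M 0, le_max_right _ _, fun e σ => ?_⟩
  rcases lt_or_ge (sdot e σ) 0 with h | h
  · rw [truncKernel_of_neg hb ε h]; exact le_max_right _ _
  unfold truncKernel
  split_ifs with h1
  · rw [← cos_arccos_sdot e σ]
    exact (hM _ ⟨h1, Real.arccos_le_pi_div_two.2 h⟩).trans (le_max_left _ _)
  · exact le_max_right _ _

lemma eventually_truncKernel_eq {e σ : S2} (h : e ≠ σ) :
    ∀ᶠ ε in 𝓝[>] (0 : ℝ), truncKernel b ε (sdot e σ) = b (sdot e σ) := by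
  filter_upwards [Ioc_mem_nhdsGT (arccos_sdot_pos h)] with ε hε
  simp [truncKernel, hε.2]

/-- The exceptional point `e = σ` disappears: there the right side is 0 by the convention for powers
of 0, and so is the truncated kernel. -/
lemma truncKernel_bound (hb : IsNonCutoffKernel ν b) {C : ℝ} (hC0 : 0 ≤ C)
    (hC : ∀ e σ : S2, e ≠ σ → b (sdot e σ) ≤ C * ‖(e : V) - σ‖ ^ (-2 - ν))
    {ε : ℝ} (hε : 0 < ε) (e σ : S2) :
    truncKernel b ε (sdot e σ) ≤ C * ‖(e : V) - σ‖ ^ (-2 - ν) := by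
  rcases eq_or_ne e σ with rfl | h
  · rw [truncKernel_self hε]; positivity
  · exact (truncKernel_le hb _ _).trans (hC e σ h)

end Kernel

/-! ### Integrability of the kinetic factor. -/

section Kinetic

variable {γ : ℝ} {φ₀ : ℝ → ℝ}

lemma IsCutoff.eq_zero (hφ : IsCutoff φ₀) {t : ℝ} (ht : 1 < t) : φ₀ t = 0 := by
  by_contra h
  have := hφ.support_subset (subset_tsupport _ h)
  exact absurd this.2 (not_le.2 ht)

lemma IsCutoff.exists_bound (hφ : IsCutoff φ₀) : ∃ M : ℝ, 0 ≤ M ∧ ∀ t, |φ₀ t| ≤ M := by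
  have hc : HasCompactSupport φ₀ :=
    HasCompactSupport.of_support_subset_isCompact isCompact_Icc
      ((subset_tsupport _).trans hφ.support_subset)
  obtain ⟨M, hM⟩ := hc.exists_bound_of_continuous hφ.smooth.continuous
  exact ⟨max M 0, le_max_right _ _, fun t => (hM t).trans (le_max_left _ _)⟩

lemma measurable_phiC (hφ : IsCutoff φ₀) : Measurable (phiC φ₀ γ) := by
  unfold phiC
  have := hφ.smooth.continuous.measurable
  fun_prop

lemma phiC_eq_zero (hφ : IsCutoff φ₀) {r : ℝ} (hr : 1 < r) : phiC φ₀ γ r = 0 := by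
  simp [phiC, hφ.eq_zero hr]

/-- In polar coordinates the integrand is O(r^(γ+2)) on (0, 1], and γ + 2 > -1. -/
lemma integrable_rpow_norm_mul (hγ : -3 < γ) {φ : ℝ → ℝ} (hφ : Measurable φ) {M : ℝ}
    (hM : ∀ t, |φ t| ≤ M) (hφ0 : ∀ t, 1 < t → φ t = 0) :
    Integrable (fun z : V => ‖z‖ ^ γ * φ ‖z‖) := by
  rw [integrable_fun_norm_addHaar (μ := volume) (f := fun r => r ^ γ * φ r)]
  have hfin : Module.finrank ℝ V - 1 = 2 := by simp
  rw [hfin]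
  have h1 : IntegrableOn (fun y : ℝ => M * y ^ (γ + 2)) (Set.Ioc 0 1) := by
    have := (intervalIntegral.intervalIntegrable_rpow' (a := 0) (b := 1)
      (by linarith : -1 < γ + 2)).const_mul M
    rwa [intervalIntegrable_iff_integrableOn_Ioc_of_le zero_le_one] at this
  have hmeas : Measurable fun y : ℝ => y ^ 2 • (y ^ γ * φ y) := by fun_prop
  have h2 : IntegrableOn (fun y : ℝ => y ^ 2 • (y ^ γ * φ y)) (Set.Ioc 0 1) := by
    refine Integrable.mono' h1 hmeas.aestronglyMeasurable ?_
    filter_upwards [ae_restrict_mem measurableSet_Ioc] with y hy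
    have hy0 : 0 < y := hy.1
    rw [smul_eq_mul, norm_mul, norm_mul, Real.norm_of_nonneg (by positivity),
      Real.norm_of_nonneg (by positivity), Real.rpow_add hy0]
    have := hM y
    calc y ^ 2 * (y ^ γ * ‖φ y‖) ≤ y ^ 2 * (y ^ γ * M) := by gcongr; exact this
      _ = M * (y ^ γ * y ^ (2 : ℝ)) := by norm_num; ring
  have h3 : IntegrableOn (fun y : ℝ => y ^ 2 • (y ^ γ * φ y)) (Set.Ioi 1) := by
    refine (integrableOn_zero).congr_fun (fun y hy => ?_) measurableSet_Ioi
    simp [hφ0 y hy]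
  rw [← Set.Ioc_union_Ioi_eq_Ioi (zero_le_one' ℝ)]
  exact h2.union h3

lemma integrable_phiC (hφ : IsCutoff φ₀) (hγ : -3 < γ) :
    Integrable (fun z : V => phiC φ₀ γ ‖z‖) := by
  obtain ⟨M, -, hM⟩ := hφ.exists_bound
  exact integrable_rpow_norm_mul hγ hφ.smooth.continuous.measurable hM fun t ht => hφ.eq_zero ht

end Kinetic

/-! ### Difference estimates for smooth functions. -/

section Difference

/-- Symmetric second differences are controlled by the first two derivatives. -/
lemma norm_second_difference_le {w : V → ℂ} {x y y' : V} {C₁ C₂ : ℝ} {s : Set V}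
    (hs : Convex ℝ s) (hx : x ∈ s) (hy : x + y ∈ s) (hy' : x + y' ∈ s)
    (hw : Differentiable ℝ w) (h1 : ‖fderiv ℝ w x‖ ≤ C₁) (hC₂ : 0 ≤ C₂)
    (h2 : ∀ u ∈ s, ‖fderiv ℝ w u - fderiv ℝ w x‖ ≤ C₂ * ‖u - x‖) :
    ‖w (x + y) + w (x + y') - 2 * w x‖ ≤ C₁ * ‖y + y'‖ + C₂ * (‖y‖ ^ 2 + ‖y'‖ ^ 2) := by
  have key : ∀ y, x + y ∈ s → ‖w (x + y) - w x - fderiv ℝ w x y‖ ≤ C₂ * ‖y‖ ^ 2 := by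
    intro y hy
    -- Mean value inequality on the points of `s` within ‖y‖ of `x`, where the derivative is within
    -- C₂‖y‖ of its value at `x`.
    have hconv : Convex ℝ (s ∩ Metric.closedBall x ‖y‖) := hs.inter (convex_closedBall _ _)
    have := Convex.norm_image_sub_le_of_norm_fderiv_le' (𝕜 := ℝ) (f := w) (φ := fderiv ℝ w x)
      (C := C₂ * ‖y‖) (x := x) (y := x + y) (fun u _ => hw u) (fun u hu => ?_) hconv
      ⟨hx, by simp⟩ ⟨hy, by simp⟩
    · simpa [sq, mul_assoc] using this
    · refine (h2 u hu.1).trans ?_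
      gcongr
      simpa [dist_eq_norm] using hu.2
  have h : w (x + y) + w (x + y') - 2 * w x = fderiv ℝ w x (y + y') +
      ((w (x + y) - w x - fderiv ℝ w x y) + (w (x + y') - w x - fderiv ℝ w x y')) := by
    rw [map_add]; ring
  rw [h]
  calc _ ≤ ‖fderiv ℝ w x (y + y')‖ + (‖w (x + y) - w x - fderiv ℝ w x y‖ +
        ‖w (x + y') - w x - fderiv ℝ w x y'‖) :=
        (norm_add_le _ _).trans (by gcongr; exact norm_add_le _ _)
    _ ≤ C₁ * ‖y + y'‖ + (C₂ * ‖y‖ ^ 2 + C₂ * ‖y'‖ ^ 2) := by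
        gcongr
        · exact (ContinuousLinearMap.le_opNorm _ _).trans (by gcongr)
        · exact key y hy
        · exact key y' hy'
    _ = _ := by ring

lemma exists_schwartz_decay {E : Type*} [NormedAddCommGroup E] [NormedSpace ℝ E]
    (f : 𝓢(V, E)) (r : ℝ) :
    ∃ C : ℝ, 0 ≤ C ∧ ∀ x, ‖f x‖ ≤ C * (1 + ‖x‖) ^ (-r) := by
  obtain ⟨k, hk⟩ := exists_nat_ge r
  refine ⟨2 ^ k * (Finset.Iic (k, 0)).sup (fun m => SchwartzMap.seminorm ℝ m.1 m.2) f,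
    by positivity, fun x => ?_⟩
  have h := f.one_add_le_sup_seminorm_apply (𝕜 := ℝ) (m := (k, 0)) (k := k) (n := 0) le_rfl le_rfl x
  rw [norm_iteratedFDeriv_zero] at h
  have h1 : (1 : ℝ) ≤ 1 + ‖x‖ := by linarith [norm_nonneg x]
  rw [Real.rpow_neg (by positivity), ← div_eq_mul_inv, le_div_iff₀ (by positivity), mul_comm]
  refine le_trans ?_ h
  gcongr
  rw [← Real.rpow_natCast]
  exact Real.rpow_le_rpow_of_exponent_le h1 hk

lemma exists_schwartz_bound {E : Type*} [NormedAddCommGroup E] [NormedSpace ℝ E] (f : 𝓢(V, E)) :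
    ∃ C : ℝ, 0 ≤ C ∧ ∀ x, ‖f x‖ ≤ C := by
  obtain ⟨C, hC, h⟩ := exists_schwartz_decay f 0
  exact ⟨C, hC, fun x => by simpa using h x⟩

lemma exists_schwartz_lipschitz {E : Type*} [NormedAddCommGroup E] [NormedSpace ℝ E]
    (f : 𝓢(V, E)) : ∃ C : ℝ, 0 ≤ C ∧ ∀ x y, ‖f y - f x‖ ≤ C * ‖y - x‖ := by
  obtain ⟨C, hC, h⟩ := exists_schwartz_bound (SchwartzMap.fderivCLM ℝ V E f)
  refine ⟨C, hC, fun x y => ?_⟩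
  exact Convex.norm_image_sub_le_of_norm_fderiv_le (𝕜 := ℝ) (fun u _ => f.differentiableAt)
    (fun u _ => h u) convex_univ (Set.mem_univ _) (Set.mem_univ _)

lemma exists_schwartz_second_difference (f : 𝓢(V, ℂ)) : ∃ C : ℝ, 0 ≤ C ∧ ∀ x y y',
    ‖f (x + y) + f (x + y') - 2 * f x‖ ≤ C * (‖y + y'‖ + ‖y‖ ^ 2 + ‖y'‖ ^ 2) := by
  obtain ⟨C₁, hC₁, h₁⟩ := exists_schwartz_bound (SchwartzMap.fderivCLM ℝ V ℂ f)
  obtain ⟨C₂, hC₂, h₂⟩ := exists_schwartz_lipschitz (SchwartzMap.fderivCLM ℝ V ℂ f)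
  refine ⟨max C₁ C₂, by positivity, fun x y y' => ?_⟩
  have := norm_second_difference_le (y := y) (y' := y') convex_univ (Set.mem_univ x)
    (Set.mem_univ _) (Set.mem_univ _) f.differentiable (h₁ x) hC₂ (fun u _ => h₂ x u)
  refine this.trans ?_
  rw [show max C₁ C₂ * (‖y + y'‖ + ‖y‖ ^ 2 + ‖y'‖ ^ 2) =
    max C₁ C₂ * ‖y + y'‖ + max C₁ C₂ * (‖y‖ ^ 2 + ‖y'‖ ^ 2) by ring]
  gcongr
  exacts [le_max_left _ _, le_max_right _ _]

end Difference

/-! ### Symmetrization and the principal value. -/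

lemma integral_comp_measurePreserving {α β E : Type*} [MeasurableSpace α] [MeasurableSpace β]
    [NormedAddCommGroup E] [NormedSpace ℝ E] {μ : Measure α} {μ' : Measure β} {T : α → β}
    (hT : MeasurePreserving T μ μ') {F : β → E} (hF : AEStronglyMeasurable F μ') :
    ∫ x, F (T x) ∂μ = ∫ y, F y ∂μ' := by
  rw [← hT.map_eq, integral_map hT.aemeasurable (by rwa [hT.map_eq])]

/-- The measure `dz dσ` on `ℝ³ × 𝕊²`. -/
noncomputable abbrev muVS : Measure (V × S2) := (volume : Measure V).prod sphereMeasure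

lemma measurable_sdot_dir : Measurable fun p : V × S2 => sdot (dir p.1) p.2 := by
  have h1 : Measurable fun p : S2 × S2 => sdot p.1 p.2 := continuous_sdot.measurable
  have h2 : Measurable fun p : V × S2 => (dir p.1, p.2) :=
    (measurable_dir.comp measurable_fst).prodMk measurable_snd
  have h3 := h1.comp h2
  simp only [Function.comp_def] at h3
  exact h3

lemma measurable_norm_dir_sub : Measurable fun p : V × S2 => ‖(dir p.1 : V) - p.2‖ := by
  have h2 : Measurable fun p : V × S2 => (dir p.1 : V) :=
    measurable_subtype_coe.comp (measurable_dir.comp measurable_fst)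
  fun_prop

lemma ae_fst_ne_zero : ∀ᵐ p : V × S2 ∂muVS, p.1 ≠ 0 :=
  Measure.quasiMeasurePreserving_fst.ae (Measure.ae_ne volume (0 : V))

/-- The change of variables `v_* = v - z`. -/
lemma measurePreserving_sub_left_prod (v : V) :
    MeasurePreserving (fun p : V × S2 => (v - p.1, p.2)) muVS muVS :=
  (Measure.measurePreserving_sub_left volume v).prod (MeasurePreserving.id sphereMeasure)

lemma measurableEmbedding_sub_left_prod (v : V) :
    MeasurableEmbedding (fun p : V × S2 => (v - p.1, p.2)) :=
  ((Homeomorph.subLeft v).prodCongr (Homeomorph.refl S2)).measurableEmbedding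

/-- The difference `f_*' g' - f_* g` as a function of `z = v - v_*`. -/
noncomputable def collDiff (f g : V → ℂ) (v : V) (p : V × S2) : ℂ :=
  f (v - zp p.1 p.2) * g (v - zm p.1 p.2) - f (v - p.1) * g v

/-- The average of `f_*' g' - f_* g` over the half-turn about `z = v - v_*`. -/
noncomputable def symDiff (f g : V → ℂ) (v : V) (p : V × S2) : ℂ :=
  (1 / 2 : ℂ) * (collDiff f g v p + collDiff f g v (p.1, halfTurn (dir p.1) p.2))

lemma continuous_collDiff {f g : V → ℂ} (hf : Continuous f) (hg : Continuous g) :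
    Continuous fun q : V × (V × S2) => collDiff f g q.1 q.2 := by
  have h1 : Continuous fun q : V × (V × S2) => zm q.2.1 q.2.2 := continuous_zm.comp continuous_snd
  have h2 : Continuous fun q : V × (V × S2) => zp q.2.1 q.2.2 := continuous_zp.comp continuous_snd
  unfold collDiff
  fun_prop

lemma measurable_symDiff {f g : V → ℂ} (hf : Continuous f) (hg : Continuous g) :
    Measurable fun q : V × (V × S2) => symDiff f g q.1 q.2 := by
  have h1 := (continuous_collDiff hf hg).measurable
  have h2 : Measurable fun q : V × (V × S2) => (q.1, (q.2.1, halfTurn (dir q.2.1) q.2.2)) :=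
    measurable_fst.prodMk ((measurable_fst.comp measurable_snd).prodMk
      (measurable_halfTurn_dir.comp measurable_snd))
  have h3 := h1.comp h2
  simp only [Function.comp_def] at h3
  unfold symDiff
  exact (h1.add h3).const_mul _

lemma exists_collDiff_bound (f g : 𝓢(V, ℂ)) :
    ∃ C : ℝ, 0 ≤ C ∧ ∀ v p, ‖collDiff f g v p‖ ≤ C := by
  obtain ⟨A, hA, hf⟩ := exists_schwartz_bound f
  obtain ⟨B, hB, hg⟩ := exists_schwartz_bound g
  refine ⟨A * B + A * B, by positivity, fun v p => (norm_sub_le _ _).trans ?_⟩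
  rw [norm_mul, norm_mul]
  gcongr <;> first | exact hf _ | exact hg _

/-- Write x = v_* and let y, y' be z⁻ for σ and for its half-turn. The post-collisional products are
f(x+y) g(v-y) and f(x+y') g(v-y'). Their average minus f(x) g(v) splits into a second difference of
f, a second difference of g and products of two first differences. All are O(d²), because y and y'
are O(d) and y + y' is O(d²). The restriction |z| ≤ 1 is harmless since Φ_c vanishes beyond. -/
lemma exists_symDiff_bound (f g : 𝓢(V, ℂ)) :
    ∃ C : ℝ, 0 ≤ C ∧ ∀ (v : V) (p : V × S2), ‖p.1‖ ≤ 1 →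
      ‖symDiff f g v p‖ ≤ C * ‖(dir p.1 : V) - p.2‖ ^ 2 := by
  obtain ⟨A, hA, hf⟩ := exists_schwartz_bound f
  obtain ⟨B, hB, hg⟩ := exists_schwartz_bound g
  obtain ⟨A₁, hA₁, hf₁⟩ := exists_schwartz_lipschitz f
  obtain ⟨B₁, hB₁, hg₁⟩ := exists_schwartz_lipschitz g
  obtain ⟨A₂, hA₂, hf₂⟩ := exists_schwartz_second_difference f
  obtain ⟨B₂, hB₂, hg₂⟩ := exists_schwartz_second_difference g
  refine ⟨A₂ * B + A * B₂ + A₁ * B₁, by positivity, ?_⟩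
  rintro v ⟨z, σ⟩ hz
  simp only at hz ⊢
  set d := ‖(dir z : V) - σ‖
  set y := zm z σ with hy
  set y' := zm z (halfTurn (dir z) σ) with hy'
  have hp : zp z σ = z - y := by rw [hy, ← zp_add_zm z σ]; abel_nf; simp [zp_add_zm]
  have hp' : zp z (halfTurn (dir z) σ) = z - y' := by
    rw [eq_sub_iff_add_eq, hy', zp_add_zm]
  have hd0 : 0 ≤ d := norm_nonneg _
  have hyn : ‖y‖ ≤ d / 2 := by
    rw [hy, norm_zm]
    nlinarith
  have hyn' : ‖y'‖ ≤ d / 2 := by rw [hy', norm_zm_halfTurn]; exact hyn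
  have hyy : ‖y + y'‖ ≤ d ^ 2 / 2 := by
    rw [hy, hy', norm_zm_add_zm_halfTurn]
    nlinarith [sq_nonneg d]
  have hy2 : ‖y‖ ^ 2 ≤ d ^ 2 / 4 := by nlinarith [norm_nonneg y]
  have hy2' : ‖y'‖ ^ 2 ≤ d ^ 2 / 4 := by nlinarith [norm_nonneg y']
  have hsum : ‖y + y'‖ + ‖y‖ ^ 2 + ‖y'‖ ^ 2 ≤ d ^ 2 := by linarith
  have hneg : ‖-y + -y'‖ + ‖-y‖ ^ 2 + ‖-y'‖ ^ 2 ≤ d ^ 2 := by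
    rw [← neg_add, norm_neg, norm_neg, norm_neg]; exact hsum
  set x := v - z with hx
  have e1 : collDiff f g v (z, σ) = f (x + y) * g (v + -y) - f x * g v := by
    simp only [collDiff]
    rw [hp, ← hy, hx]
    congr 3; abel
  have e2 : collDiff f g v (z, halfTurn (dir z) σ) = f (x + y') * g (v + -y') - f x * g v := by
    simp only [collDiff]
    rw [hp', ← hy', hx]
    congr 3; abel
  have e3 : symDiff f g v (z, σ) = (1 / 2 : ℂ) * (
      (f (x + y) + f (x + y') - 2 * f x) * g v + f x * (g (v + -y) + g (v + -y') - 2 * g v) +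
      ((f (x + y) - f x) * (g (v + -y) - g v) + (f (x + y') - f x) * (g (v + -y') - g v))) := by
    simp only [symDiff]
    rw [e1, e2]
    ring
  have b1 : ‖(f (x + y) + f (x + y') - 2 * f x) * g v‖ ≤ A₂ * d ^ 2 * B := by
    rw [norm_mul]
    gcongr
    · exact (hf₂ x y y').trans (by gcongr)
    · exact hg v
  have b2 : ‖f x * (g (v + -y) + g (v + -y') - 2 * g v)‖ ≤ A * (B₂ * d ^ 2) := by
    rw [norm_mul]
    gcongr
    · exact hf x
    · exact (hg₂ v (-y) (-y')).trans (by gcongr)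
  have b3 : ∀ u : V, ‖u‖ ≤ d / 2 →
      ‖(f (x + u) - f x) * (g (v + -u) - g v)‖ ≤ A₁ * B₁ * d ^ 2 := by
    intro u hu
    rw [norm_mul]
    calc _ ≤ (A₁ * ‖x + u - x‖) * (B₁ * ‖v + -u - v‖) := by
          gcongr
          · exact hf₁ _ _
          · exact hg₁ _ _
      _ = A₁ * B₁ * ‖u‖ ^ 2 := by simp; ring
      _ ≤ A₁ * B₁ * d ^ 2 := by gcongr; linarith
  rw [e3, norm_mul]
  have h12 : ‖(1 / 2 : ℂ)‖ = 1 / 2 := by norm_num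
  rw [h12]
  have t1 := norm_add₃_le (a := (f (x + y) + f (x + y') - 2 * f x) * g v)
    (b := f x * (g (v + -y) + g (v + -y') - 2 * g v))
    (c := (f (x + y) - f x) * (g (v + -y) - g v) + (f (x + y') - f x) * (g (v + -y') - g v))
  have t2 := norm_add_le ((f (x + y) - f x) * (g (v + -y) - g v))
    ((f (x + y') - f x) * (g (v + -y') - g v))
  have t3 := b3 y hyn
  have t4 := b3 y' hyn'
  have : 0 ≤ A₂ * d ^ 2 * B := by positivity
  have : 0 ≤ A * (B₂ * d ^ 2) := by positivity
  nlinarith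

variable {ν γ : ℝ} {b φ₀ : ℝ → ℝ}

lemma devAngle_sub {z : V} (hz : z ≠ 0) (v : V) (σ : S2) :
    devAngle v (v - z) σ = Real.arccos (sdot (dir z) σ) := by
  rw [devAngle, sub_sub_cancel, InnerProductGeometry.angle, sdot, coe_dir_of_ne hz,
    inner_smul_left, norm_coe_sphere, mul_one, div_eq_inv_mul]
  simp

lemma integrandC_sub {z : V} (hz : z ≠ 0) (ε : ℝ) (f g : V → ℂ) (v : V) (σ : S2) :
    integrandC b φ₀ γ ε f g v (v - z, σ) =
      ((phiC φ₀ γ ‖z‖ * truncKernel b ε (sdot (dir z) σ) : ℝ) : ℂ) * collDiff f g v (z, σ) := by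
  simp only [integrandC, kernelC, devAngle_sub hz, cos_arccos_sdot, truncKernel, collDiff, post_eq,
    postStar_eq, sub_sub_cancel]
  split_ifs <;> simp

lemma measurable_truncated_kernel (hb : IsNonCutoffKernel ν b) (hφ : IsCutoff φ₀) (ε : ℝ) :
    Measurable fun p : V × S2 => phiC φ₀ γ ‖p.1‖ * truncKernel b ε (sdot (dir p.1) p.2) :=
  ((measurable_phiC hφ).comp (measurable_norm.comp measurable_fst)).mul
    ((measurable_truncKernel hb ε).comp measurable_sdot_dir)

lemma integrable_truncated_kernel (hb : IsNonCutoffKernel ν b) (hφ : IsCutoff φ₀) (hγ : -3 < γ)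
    {ε : ℝ} (hε : 0 < ε) : Integrable
      (fun p : V × S2 => phiC φ₀ γ ‖p.1‖ * truncKernel b ε (sdot (dir p.1) p.2)) muVS := by
  obtain ⟨M, hM0, hM⟩ := exists_truncKernel_le hb hε
  have h1 : Integrable (fun p : V × S2 => phiC φ₀ γ ‖p.1‖ * M) muVS :=
    (integrable_phiC hφ hγ).mul_prod (integrable_const M)
  refine h1.mono (measurable_truncated_kernel hb hφ ε).aestronglyMeasurable (ae_of_all _ fun p => ?_)
  rw [norm_mul, norm_mul, Real.norm_of_nonneg hM0,
    Real.norm_of_nonneg (truncKernel_nonneg hb _ _)]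
  gcongr
  exact hM _ _

lemma integrable_kernel_collDiff (hb : IsNonCutoffKernel ν b) (hφ : IsCutoff φ₀) (hγ : -3 < γ)
    {ε : ℝ} (hε : 0 < ε) (f g : 𝓢(V, ℂ)) (v : V) : Integrable (fun p : V × S2 =>
      ((phiC φ₀ γ ‖p.1‖ * truncKernel b ε (sdot (dir p.1) p.2) : ℝ) : ℂ) * collDiff f g v p)
      muVS := by
  obtain ⟨C, hC, h⟩ := exists_collDiff_bound f g
  refine (integrable_truncated_kernel hb hφ hγ hε).ofReal.mul_bdd (c := C) ?_
    (ae_of_all _ fun p => h v p)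
  exact ((continuous_collDiff f.continuous g.continuous).comp
    (Continuous.prodMk continuous_const continuous_id)).aestronglyMeasurable

lemma integrandC_comp_sub_left (ε : ℝ) (f g : V → ℂ) (v : V) :
    (integrandC b φ₀ γ ε f g v ∘ fun p : V × S2 => (v - p.1, p.2)) =ᵐ[muVS] fun p =>
      ((phiC φ₀ γ ‖p.1‖ * truncKernel b ε (sdot (dir p.1) p.2) : ℝ) : ℂ) * collDiff f g v p := by
  filter_upwards [ae_fst_ne_zero] with p hp
  exact integrandC_sub hp ε f g v p.2

lemma integrable_integrandC (hb : IsNonCutoffKernel ν b) (hφ : IsCutoff φ₀) (hγ : -3 < γ)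
    {ε : ℝ} (hε : 0 < ε) (f g : 𝓢(V, ℂ)) (v : V) :
    Integrable (integrandC b φ₀ γ ε f g v) ((volume : Measure V).prod sphereMeasure) := by
  rw [← (measurePreserving_sub_left_prod v).integrable_comp_emb
    (measurableEmbedding_sub_left_prod v)]
  exact (integrable_kernel_collDiff hb hφ hγ hε f g v).congr (integrandC_comp_sub_left ε f g v).symm

lemma collisionCTrunc_eq (ε : ℝ) (f g : V → ℂ) (v : V) :
    collisionCTrunc b φ₀ γ ε f g v = ∫ p : V × S2,
      ((phiC φ₀ γ ‖p.1‖ * truncKernel b ε (sdot (dir p.1) p.2) : ℝ) : ℂ) * collDiff f g v p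
      ∂muVS := by
  rw [collisionCTrunc, ← (measurePreserving_sub_left_prod v).integral_comp
    (measurableEmbedding_sub_left_prod v)]
  exact integral_congr_ae (integrandC_comp_sub_left ε f g v)

/-- The kernel depends on σ only through its angle with z, which the half-turn fixes; for ε > 0 both
integrals converge absolutely and may be averaged. -/
lemma collisionCTrunc_eq_symDiff (hb : IsNonCutoffKernel ν b) (hφ : IsCutoff φ₀) (hγ : -3 < γ)
    {ε : ℝ} (hε : 0 < ε) (f g : 𝓢(V, ℂ)) (v : V) :
    collisionCTrunc b φ₀ γ ε f g v = ∫ p : V × S2,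
      ((phiC φ₀ γ ‖p.1‖ * truncKernel b ε (sdot (dir p.1) p.2) : ℝ) : ℂ) * symDiff f g v p
      ∂muVS := by
  have hint := integrable_kernel_collDiff hb hφ hγ hε f g v
  have hmp : MeasurePreserving (fun p : V × S2 => (p.1, halfTurn (dir p.1) p.2)) muVS muVS :=
    measurePreserving_halfTurn_prod
  have h1 : ∫ p : V × S2,
      ((phiC φ₀ γ ‖p.1‖ * truncKernel b ε (sdot (dir p.1) p.2) : ℝ) : ℂ) * collDiff f g v p ∂muVS =
      ∫ p : V × S2, ((phiC φ₀ γ ‖p.1‖ * truncKernel b ε (sdot (dir p.1) p.2) : ℝ) : ℂ) *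
        collDiff f g v (p.1, halfTurn (dir p.1) p.2) ∂muVS := by
    rw [← integral_comp_measurePreserving hmp hint.aestronglyMeasurable]
    simp only [sdot_halfTurn]
  have hint2 : Integrable (fun p : V × S2 =>
      ((phiC φ₀ γ ‖p.1‖ * truncKernel b ε (sdot (dir p.1) p.2) : ℝ) : ℂ) *
        collDiff f g v (p.1, halfTurn (dir p.1) p.2)) muVS := by
    have := hmp.integrable_comp_of_integrable hint
    simpa only [Function.comp_def, sdot_halfTurn] using this
  rw [collisionCTrunc_eq]
  have h2 : ∀ p : V × S2,
      ((phiC φ₀ γ ‖p.1‖ * truncKernel b ε (sdot (dir p.1) p.2) : ℝ) : ℂ) * symDiff f g v p =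
      (1 / 2 : ℂ) * (((phiC φ₀ γ ‖p.1‖ * truncKernel b ε (sdot (dir p.1) p.2) : ℝ) : ℂ) *
        collDiff f g v p + ((phiC φ₀ γ ‖p.1‖ * truncKernel b ε (sdot (dir p.1) p.2) : ℝ) : ℂ) *
        collDiff f g v (p.1, halfTurn (dir p.1) p.2)) := fun p => by
    rw [symDiff]; ring
  simp_rw [h2]
  rw [integral_const_mul, integral_add hint hint2, ← h1]
  ring

variable {ν γ : ℝ} {b φ₀ : ℝ → ℝ}

lemma integrable_phiC_mul_rpow (hφ : IsCutoff φ₀) (hγ : -3 < γ) (hν₀ : 0 < ν) (hν₂ : ν < 2) :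
    Integrable (fun p : V × S2 => |phiC φ₀ γ ‖p.1‖| * ‖(dir p.1 : V) - p.2‖ ^ (-ν)) muVS := by
  obtain ⟨C, hC⟩ := exists_sphere_near_bound hν₀ hν₂
  have hm1 : Measurable fun p : V × S2 => |phiC φ₀ γ ‖p.1‖| :=
    ((measurable_phiC hφ).comp (measurable_norm.comp measurable_fst)).abs
  have hm2 : Measurable fun p : V × S2 => ‖(dir p.1 : V) - p.2‖ ^ (-ν) :=
    measurable_norm_dir_sub.pow_const _
  have hm3 : Measurable fun p : V × S2 =>
      |phiC φ₀ γ ‖p.1‖| * ‖(dir p.1 : V) - p.2‖ ^ (-ν) := hm1.mul hm2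
  refine ⟨hm3.aestronglyMeasurable, ?_⟩
  rw [hasFiniteIntegral_iff_ofReal (ae_of_all _ fun p => by positivity)]
  rw [lintegral_prod _ hm3.ennreal_ofReal.aemeasurable]
  have h1 : ∀ z : V, ∫⁻ σ, ENNReal.ofReal (|phiC φ₀ γ ‖z‖| * ‖(dir z : V) - σ‖ ^ (-ν)) ∂sphereMeasure
      ≤ ENNReal.ofReal |phiC φ₀ γ ‖z‖| * (C * ENNReal.ofReal (2 ^ (2 - ν))) := by
    intro z
    simp_rw [ENNReal.ofReal_mul (abs_nonneg _)]
    rw [lintegral_const_mul' _ _ ENNReal.ofReal_ne_top]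
    gcongr
    refine le_trans (le_of_eq ?_) (hC (dir z) 2 (by norm_num))
    rw [show {σ : S2 | ‖((dir z : S2) : V) - σ‖ ≤ 2} = Set.univ from
      Set.eq_univ_of_forall fun σ => norm_sub_sphere_le_two _ _, Measure.restrict_univ]
  refine (lintegral_mono h1).trans_lt ?_
  rw [lintegral_mul_const' _ _ (ENNReal.mul_ne_top ENNReal.coe_ne_top ENNReal.ofReal_ne_top)]
  refine ENNReal.mul_lt_top ?_ (ENNReal.mul_lt_top ENNReal.coe_lt_top ENNReal.ofReal_lt_top)
  have := (integrable_phiC hφ hγ).abs.2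
  rwa [hasFiniteIntegral_iff_ofReal (ae_of_all _ fun p => abs_nonneg _)] at this

/-- The quadratic gain turns d^(-2-ν) into d^(-ν), integrable on the sphere for ν < 2. The number
`t` stands for the kernel or any truncation of it, so that one function dominates all of them. -/
lemma exists_symmetrized_bound (hb : IsNonCutoffKernel ν b) (hφ : IsCutoff φ₀) (hν : 0 < ν)
    (f g : 𝓢(V, ℂ)) : ∃ C : ℝ, 0 ≤ C ∧ ∀ (v : V) (p : V × S2) (t : ℝ),
      0 ≤ t → t ≤ b (sdot (dir p.1) p.2) →
      ‖((phiC φ₀ γ ‖p.1‖ * t : ℝ) : ℂ) * symDiff f g v p‖ ≤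
        C * (|phiC φ₀ γ ‖p.1‖| * ‖(dir p.1 : V) - p.2‖ ^ (-ν)) := by
  obtain ⟨A, hA, hbA⟩ := hb.exists_bound hν
  obtain ⟨B, hB, hS⟩ := exists_symDiff_bound f g
  refine ⟨A * B, by positivity, fun v p t ht htb => ?_⟩
  rcases lt_or_ge 1 ‖p.1‖ with h | h
  · simp [phiC_eq_zero hφ h]
  rcases eq_or_ne (dir p.1) p.2 with he | he
  · have : symDiff f g v p = 0 := by
      have := hS v p h
      rw [he] at this
      simpa using this
    rw [this, mul_zero, norm_zero]
    positivity
  have hd : 0 < ‖(dir p.1 : V) - p.2‖ :=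
    norm_pos_iff.2 (sub_ne_zero.2 fun h' => he (Subtype.ext h'))
  rw [norm_mul, Complex.norm_real, norm_mul, Real.norm_eq_abs, Real.norm_of_nonneg ht]
  calc |phiC φ₀ γ ‖p.1‖| * t * ‖symDiff f g v p‖
      ≤ |phiC φ₀ γ ‖p.1‖| * (A * ‖(dir p.1 : V) - p.2‖ ^ (-2 - ν)) *
        (B * ‖(dir p.1 : V) - p.2‖ ^ 2) := by
        gcongr
        · exact htb.trans (hbA _ _ he)
        · exact hS v p h
    _ = A * B * (|phiC φ₀ γ ‖p.1‖| * (‖(dir p.1 : V) - p.2‖ ^ (-2 - ν) *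
        ‖(dir p.1 : V) - p.2‖ ^ (2 : ℝ))) := by norm_num; ring
    _ = _ := by
        rw [← Real.rpow_add hd]
        ring_nf

/-- The collision operator, written with the symmetrized difference. -/
noncomputable def collisionSym (b φ₀ : ℝ → ℝ) (γ : ℝ) (f g : V → ℂ) (v : V) : ℂ :=
  ∫ p : V × S2, ((phiC φ₀ γ ‖p.1‖ * b (sdot (dir p.1) p.2) : ℝ) : ℂ) * symDiff f g v p ∂muVS

lemma measurable_symmetrized (hφ : IsCutoff φ₀) {β : ℝ → ℝ} (hβ : Measurable β)
    (f g : 𝓢(V, ℂ)) : Measurable fun q : V × (V × S2) =>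
      ((phiC φ₀ γ ‖q.2.1‖ * β (sdot (dir q.2.1) q.2.2) : ℝ) : ℂ) * symDiff f g q.1 q.2 := by
  have h1 : Measurable fun p : V × S2 => phiC φ₀ γ ‖p.1‖ * β (sdot (dir p.1) p.2) :=
    ((measurable_phiC hφ).comp (measurable_norm.comp measurable_fst)).mul
      (hβ.comp measurable_sdot_dir)
  exact (Complex.measurable_ofReal.comp (h1.comp measurable_snd)).mul
    (measurable_symDiff f.continuous g.continuous)

lemma tendsto_collisionCTrunc_collisionSym (hb : IsNonCutoffKernel ν b) (hφ : IsCutoff φ₀)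
    (hγ : -3 < γ) (hν₀ : 0 < ν) (hν₂ : ν < 2) (f g : 𝓢(V, ℂ)) (v : V) :
    Tendsto (fun ε => collisionCTrunc b φ₀ γ ε f g v) (𝓝[>] 0) (𝓝 (collisionSym b φ₀ γ f g v)) := by
  obtain ⟨C, hC, h⟩ := exists_symmetrized_bound (γ := γ) hb hφ hν₀ f g
  have hev : (fun ε => collisionCTrunc b φ₀ γ ε f g v) =ᶠ[𝓝[>] 0] fun ε => ∫ p : V × S2,
      ((phiC φ₀ γ ‖p.1‖ * truncKernel b ε (sdot (dir p.1) p.2) : ℝ) : ℂ) * symDiff f g v p ∂muVS := by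
    filter_upwards [self_mem_nhdsWithin] with ε hε
    exact collisionCTrunc_eq_symDiff hb hφ hγ hε f g v
  refine Tendsto.congr' hev.symm ?_
  refine tendsto_integral_filter_of_dominated_convergence
    (fun p => C * (|phiC φ₀ γ ‖p.1‖| * ‖(dir p.1 : V) - p.2‖ ^ (-ν))) ?_ ?_ ?_ ?_
  · filter_upwards with ε
    exact ((measurable_symmetrized hφ (measurable_truncKernel hb ε) f g).comp
      (measurable_const.prodMk measurable_id)).aestronglyMeasurable
  · filter_upwards with ε
    exact ae_of_all _ fun p => h v p _ (truncKernel_nonneg hb _ _) (truncKernel_le hb _ _)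
  · exact (integrable_phiC_mul_rpow hφ hγ hν₀ hν₂).const_mul C
  · refine ae_of_all _ fun p => ?_
    -- On the axis the truncated kernels vanish and need not converge to b(1), but there the
    -- symmetrized difference is 0.
    rcases eq_or_ne (dir p.1) p.2 with he | he
    · have hS : ∀ t : ℝ, ((phiC φ₀ γ ‖p.1‖ * t : ℝ) : ℂ) * symDiff f g v p = 0 := by
        intro t
        rcases lt_or_ge 1 ‖p.1‖ with h1 | h1
        · simp [phiC_eq_zero hφ h1]
        · obtain ⟨B, hB, hS⟩ := exists_symDiff_bound f g
          have := hS v p h1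
          rw [he] at this
          simp only [sub_self, norm_zero, ne_eq, OfNat.ofNat_ne_zero, not_false_eq_true, zero_pow,
            mul_zero, norm_le_zero_iff] at this
          rw [this, mul_zero]
      simp only [hS]
      exact tendsto_const_nhds
    · refine tendsto_const_nhds.congr' ?_
      filter_upwards [eventually_truncKernel_eq (b := b) he] with ε hε
      rw [hε]

lemma tendsto_collisionCTrunc (hb : IsNonCutoffKernel ν b) (hφ : IsCutoff φ₀)
    (hγ : -3 < γ) (hν₀ : 0 < ν) (hν₂ : ν < 2) (f g : 𝓢(V, ℂ)) (v : V) :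
    Tendsto (fun ε => collisionCTrunc b φ₀ γ ε f g v) (𝓝[>] 0) (𝓝 (collisionC b φ₀ γ f g v)) :=
  tendsto_nhds_limUnder ⟨_, tendsto_collisionCTrunc_collisionSym hb hφ hγ hν₀ hν₂ f g v⟩

lemma collisionC_eq (hb : IsNonCutoffKernel ν b) (hφ : IsCutoff φ₀)
    (hγ : -3 < γ) (hν₀ : 0 < ν) (hν₂ : ν < 2) (f g : 𝓢(V, ℂ)) :
    collisionC b φ₀ γ f g = collisionSym b φ₀ γ f g := by
  ext1 v
  exact (tendsto_collisionCTrunc_collisionSym hb hφ hγ hν₀ hν₂ f g v).limUnder_eq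

lemma measurable_collisionCTrunc (hb : IsNonCutoffKernel ν b) (hφ : IsCutoff φ₀)
    (hγ : -3 < γ) {ε : ℝ} (hε : 0 < ε) (f g : 𝓢(V, ℂ)) :
    StronglyMeasurable (fun v => collisionCTrunc b φ₀ γ ε f g v) := by
  simp_rw [collisionCTrunc_eq_symDiff hb hφ hγ hε f g]
  exact StronglyMeasurable.integral_prod_right
    (measurable_symmetrized hφ (measurable_truncKernel hb ε) f g).stronglyMeasurable

lemma measurable_collisionC (hb : IsNonCutoffKernel ν b) (hφ : IsCutoff φ₀)
    (hγ : -3 < γ) (hν₀ : 0 < ν) (hν₂ : ν < 2) (f g : 𝓢(V, ℂ)) :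
    StronglyMeasurable (collisionC b φ₀ γ f g) := by
  rw [collisionC_eq hb hφ hγ hν₀ hν₂]
  exact StronglyMeasurable.integral_prod_right
    (measurable_symmetrized hφ hb.measurable f g).stronglyMeasurable

lemma exists_collisionCTrunc_bound (hb : IsNonCutoffKernel ν b) (hφ : IsCutoff φ₀)
    (hγ : -3 < γ) (hν₀ : 0 < ν) (hν₂ : ν < 2) (f g : 𝓢(V, ℂ)) :
    ∃ C : ℝ, (∀ ε > 0, ∀ v, ‖collisionCTrunc b φ₀ γ ε f g v‖ ≤ C) ∧
      ∀ v, ‖collisionC b φ₀ γ f g v‖ ≤ C := by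
  obtain ⟨C, hC, h⟩ := exists_symmetrized_bound (γ := γ) hb hφ hν₀ f g
  have hint := (integrable_phiC_mul_rpow hφ hγ hν₀ hν₂).const_mul C
  refine ⟨∫ p : V × S2, C * (|phiC φ₀ γ ‖p.1‖| * ‖(dir p.1 : V) - p.2‖ ^ (-ν)) ∂muVS,
    fun ε hε v => ?_, fun v => ?_⟩
  · rw [collisionCTrunc_eq_symDiff hb hφ hγ hε]
    exact norm_integral_le_of_norm_le hint (ae_of_all _ fun p =>
      h v p _ (truncKernel_nonneg hb _ _) (truncKernel_le hb _ _))
  · rw [collisionC_eq hb hφ hγ hν₀ hν₂, collisionSym]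
    exact norm_integral_le_of_norm_le hint (ae_of_all _ fun p => h v p _ (hb.nonneg _) le_rfl)

lemma integrable_collisionC_mul (hb : IsNonCutoffKernel ν b) (hφ : IsCutoff φ₀)
    (hγ : -3 < γ) (hν₀ : 0 < ν) (hν₂ : ν < 2) (f g h : 𝓢(V, ℂ)) :
    Integrable (fun v => collisionC b φ₀ γ f g v * (starRingEnd ℂ) (h v)) := by
  obtain ⟨C, -, hC⟩ := exists_collisionCTrunc_bound hb hφ hγ hν₀ hν₂ f g
  refine Integrable.bdd_mul (c := C) ?_
    (measurable_collisionC hb hφ hγ hν₀ hν₂ f g).aestronglyMeasurable (ae_of_all _ hC)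
  exact (Complex.conjCLE.toContinuousLinearMap).integrable_comp h.integrable

/-- This reduces the trilinear bound to truncated kernels, provided that the constants do not depend
on ε. Domination comes from the bound on the truncated collision integrals that is uniform in ε and
v. -/
lemma tendsto_pairing_trunc (hb : IsNonCutoffKernel ν b) (hφ : IsCutoff φ₀)
    (hγ : -3 < γ) (hν₀ : 0 < ν) (hν₂ : ν < 2) (f g h : 𝓢(V, ℂ)) :
    Tendsto (fun ε => ∫ v, collisionCTrunc b φ₀ γ ε f g v * (starRingEnd ℂ) (h v)) (𝓝[>] 0)
      (𝓝 (pairingC b φ₀ γ f g h)) := by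
  obtain ⟨C, hC, -⟩ := exists_collisionCTrunc_bound hb hφ hγ hν₀ hν₂ f g
  refine tendsto_integral_filter_of_dominated_convergence (fun v => C * ‖h v‖) ?_ ?_ ?_ ?_
  · filter_upwards [self_mem_nhdsWithin] with ε hε
    exact ((measurable_collisionCTrunc hb hφ hγ hε f g).mul
      (Complex.continuous_conj.comp h.continuous).stronglyMeasurable).aestronglyMeasurable
  · filter_upwards [self_mem_nhdsWithin] with ε hε
    refine ae_of_all _ fun v => ?_
    rw [norm_mul, RCLike.norm_conj]
    gcongr
    exact hC ε hε v
  · exact h.integrable.norm.const_mul C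
  · exact ae_of_all _ fun v =>
      (tendsto_collisionCTrunc hb hφ hγ hν₀ hν₂ f g v).mul_const _

/-! ### Fourier representation of the weak form. -/

/-- The character `exp (2 π i t)`. -/
noncomputable def chr (t : ℝ) : ℂ := Complex.exp ((2 * Real.pi * t : ℝ) * Complex.I)

@[fun_prop] lemma continuous_chr : Continuous chr := by unfold chr; fun_prop

@[simp] lemma norm_chr (t : ℝ) : ‖chr t‖ = 1 := Complex.norm_exp_ofReal_mul_I _

lemma chr_add (s t : ℝ) : chr (s + t) = chr s * chr t := by
  rw [chr, chr, chr, ← Complex.exp_add]; congr 1; push_cast; ring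

@[simp] lemma chr_zero : chr 0 = 1 := by simp [chr]

lemma conj_chr (t : ℝ) : (starRingEnd ℂ) (chr t) = chr (-t) := by
  rw [chr, chr, ← Complex.exp_conj, map_mul, Complex.conj_I, Complex.conj_ofReal]
  congr 1; push_cast; ring

lemma fourier_eq_integral_chr (f : V → ℂ) (ξ : V) :
    𝓕 f ξ = ∫ v, chr (-inner ℝ v ξ) * f v := by
  rw [Real.fourier_eq']
  refine integral_congr_ae (ae_of_all _ fun v => ?_)
  simp only [smul_eq_mul, chr]
  congr 3; push_cast; ring

lemma schwartz_eq_integral_chr (f : 𝓢(V, ℂ)) (x : V) :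
    f x = ∫ ξ, chr (inner ℝ ξ x) * 𝓕 f ξ := by
  have h : 𝓕⁻ (𝓕 f) x = f x := by rw [FourierTransform.fourierInv_fourier_eq]
  rw [← h, SchwartzMap.fourierInv_coe, Real.fourierInv_eq']
  rfl

section Bobylev

variable {f g h : 𝓢(V, ℂ)}

/-- The product `f̂(ξ_*) ĝ(ξ - ξ_*) conj ĥ(ξ)` at `(ξ, ξ_*)`. -/
noncomputable def tripleHat (f g h : 𝓢(V, ℂ)) (q : V × V) : ℂ :=
  𝓕 f q.2 * 𝓕 g (q.1 - q.2) * (starRingEnd ℂ) (𝓕 h q.1)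

lemma integrable_conj (h : 𝓢(V, ℂ)) : Integrable (fun v => (starRingEnd ℂ) (h v)) :=
  (Complex.conjCLE.toContinuousLinearMap).integrable_comp h.integrable

lemma integrable_tripleHat : Integrable (tripleHat f g h) (volume.prod volume) := by
  obtain ⟨C, hC, hg⟩ := exists_schwartz_bound (𝓕 g)
  have h1 : Integrable (fun q : V × V => (starRingEnd ℂ) (𝓕 h q.1) * 𝓕 f q.2) (volume.prod volume) :=
    (integrable_conj (𝓕 h)).mul_prod (𝓕 f).integrable
  have h2 := h1.mul_bdd (c := C) (g := fun q : V × V => 𝓕 g (q.1 - q.2))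
    ((𝓕 g).continuous.comp (continuous_fst.sub continuous_snd)).aestronglyMeasurable
    (ae_of_all _ fun q => hg _)
  refine h2.congr (ae_of_all _ fun q => ?_)
  simp only [tripleHat]
  ring

/-- A trilinear form of translates in terms of Fourier transforms. -/
lemma integral_translates_eq (f g h : 𝓢(V, ℂ)) (z y : V) :
    ∫ v, f (v - z) * g v * (starRingEnd ℂ) (h (v - y)) =
      ∫ q : V × V, tripleHat f g h q * (chr (-inner ℝ z q.2) * chr (inner ℝ y q.1))
        ∂(volume.prod volume) := by
  have hF : Integrable (fun q : V × V => (starRingEnd ℂ) (𝓕 h q.1) * 𝓕 f q.2) (volume.prod volume) :=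
    (integrable_conj (𝓕 h)).mul_prod (𝓕 f).integrable
  have hpt : ∀ v, f (v - z) * g v * (starRingEnd ℂ) (h (v - y)) =
      ∫ q : V × V, g v * ((starRingEnd ℂ) (𝓕 h q.1) * 𝓕 f q.2) *
        (chr (inner ℝ q.2 (v - z)) * chr (-inner ℝ q.1 (v - y))) ∂(volume.prod volume) := by
    intro v
    have h1 : (starRingEnd ℂ) (h (v - y)) =
        ∫ ξ, chr (-inner ℝ ξ (v - y)) * (starRingEnd ℂ) (𝓕 h ξ) := by
      rw [schwartz_eq_integral_chr h (v - y), ← integral_conj]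
      simp only [map_mul, conj_chr]
    rw [h1, schwartz_eq_integral_chr f (v - z)]
    have h2 := integral_prod_mul (μ := (volume : Measure V)) (ν := (volume : Measure V))
      (fun ξ => chr (-inner ℝ ξ (v - y)) * (starRingEnd ℂ) (𝓕 h ξ))
      (fun ξ => chr (inner ℝ ξ (v - z)) * 𝓕 f ξ)
    rw [mul_right_comm, mul_comm (∫ ξ, chr (inner ℝ ξ (v - z)) * 𝓕 f ξ), ← h2,
      ← integral_mul_const]
    congr 1; ext q; ring
  simp_rw [hpt]
  rw [integral_integral_swap]
  · congr 1
    ext q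
    have h3 : ∀ v, g v * ((starRingEnd ℂ) (𝓕 h q.1) * 𝓕 f q.2) *
        (chr (inner ℝ q.2 (v - z)) * chr (-inner ℝ q.1 (v - y))) =
        (𝓕 f q.2 * (starRingEnd ℂ) (𝓕 h q.1) * (chr (-inner ℝ z q.2) * chr (inner ℝ y q.1))) *
        (chr (-inner ℝ v (q.1 - q.2)) * g v) := by
      intro v
      have e : chr (inner ℝ q.2 (v - z)) * chr (-inner ℝ q.1 (v - y)) =
          chr (-inner ℝ z q.2) * chr (inner ℝ y q.1) * chr (-inner ℝ v (q.1 - q.2)) := by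
        rw [← chr_add, ← chr_add, ← chr_add]
        congr 1
        simp only [inner_sub_right, real_inner_comm q.2, real_inner_comm q.1]
        ring
      rw [e]; ring
    simp_rw [h3]
    rw [integral_const_mul, ← fourier_eq_integral_chr, ← SchwartzMap.fourier_coe]
    simp only [tripleHat]
    ring
  · have h4 := (g.integrable (μ := volume)).mul_prod hF
    refine h4.mul_bdd (c := 1) ?_ (ae_of_all _ fun q => by simp)
    exact Continuous.aestronglyMeasurable (by fun_prop)

end Bobylev

/-- The Fourier transform of the radial function `Φ(|z|)`. -/
noncomputable def radialHat (Φ : ℝ → ℝ) (ξ : V) : ℂ := ∫ z : V, chr (-inner ℝ z ξ) * (Φ ‖z‖ : ℂ)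

/-- The multiplier of the weak form of the collision operator. -/
noncomputable def collKernel (Φ β : ℝ → ℝ) (ξ ξs : V) : ℂ :=
  ∫ σ, (β (sdot (dir ξ) σ) : ℂ) * (radialHat Φ (ξs - zm ξ σ) - radialHat Φ ξs) ∂sphereMeasure

/-- The right side is symmetric in `z` and `ξ` except for the direction that is paired with σ.
Reflecting σ therefore trades z⁻·ξ for ξ⁻·z under the integral, which is the mechanism of Bobylev's
formula. -/
lemma inner_zm (z ξ : V) (σ : S2) : inner ℝ (zm z σ) ξ =
    ‖z‖ * ‖ξ‖ / 2 * (sdot (dir z) (dir ξ) - sdot (dir ξ) σ) := by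
  conv_lhs => rw [zm_eq, ← norm_smul_dir ξ]
  rw [inner_smul_left, inner_smul_right, inner_sub_left, sdot, sdot, real_inner_comm (σ : V)]
  simp only [conj_trivial]
  ring

section

variable {Φ β : ℝ → ℝ} {M : ℝ}

lemma integrable_radial_kernel (hΦ : Integrable fun z : V => Φ ‖z‖) (hβ : Measurable β)
    (hM : ∀ e σ : S2, |β (sdot e σ)| ≤ M) :
    Integrable (fun p : V × S2 => Φ ‖p.1‖ * β (sdot (dir p.1) p.2)) muVS := by
  have h1 : Integrable (fun p : V × S2 => Φ ‖p.1‖) muVS := hΦ.comp_fst sphereMeasure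
  exact h1.mul_bdd (c := M) (hβ.comp measurable_sdot_dir).aestronglyMeasurable
    (ae_of_all _ fun p => hM _ _)

lemma measurable_sdot_left (e : S2) : Measurable (sdot e) := by
  have : Continuous (sdot e) := by unfold sdot; fun_prop
  exact this.measurable

/-- The angular integral of the oscillating factor, with the roles of `z` and `ξ` exchanged. -/
lemma integral_sphere_exchange (β : ℝ → ℝ) (z ξ : V) :
    ∫ σ, (β (sdot (dir z) σ) : ℂ) * (chr (inner ℝ (zm z σ) ξ) - 1) ∂sphereMeasure =
    ∫ σ, (β (sdot (dir ξ) σ) : ℂ) * (chr (inner ℝ (zm ξ σ) z) - 1) ∂sphereMeasure := by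
  have h := integral_sdot_sdot_comm (fun s t => (β s : ℂ) *
    (chr (‖z‖ * ‖ξ‖ / 2 * (sdot (dir z) (dir ξ) - t)) - 1)) (dir z) (dir ξ)
  simp_rw [inner_zm]
  rw [h, sdot_comm (dir ξ) (dir z), mul_comm ‖ξ‖ ‖z‖]

/-- Once the angular kernel is attached to `ξ` instead of `z`, only Φ(|z|) and characters depend on
z, and the z-integral produces the transform of Φ at ξ_* - ξ⁻ and at ξ_*. -/
lemma integral_kernel_chr (hΦ : Integrable fun z : V => Φ ‖z‖) (hβ : Measurable β)
    (hM : ∀ e σ : S2, |β (sdot e σ)| ≤ M) (ξ ξs : V) :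
    ∫ p : V × S2, ((Φ ‖p.1‖ * β (sdot (dir p.1) p.2) : ℝ) : ℂ) *
      (chr (-inner ℝ p.1 ξs) * (chr (inner ℝ (zm p.1 p.2) ξ) - 1)) ∂muVS =
    collKernel Φ β ξ ξs := by
  have hk := (integrable_radial_kernel hΦ hβ hM).ofReal (𝕜 := ℂ)
  have hchr : ∀ t : ℝ, ‖chr t - 1‖ ≤ 2 := fun t =>
    (norm_sub_le _ _).trans (by simp; norm_num)
  have hint1 : Integrable (fun p : V × S2 => ((Φ ‖p.1‖ * β (sdot (dir p.1) p.2) : ℝ) : ℂ) *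
      (chr (-inner ℝ p.1 ξs) * (chr (inner ℝ (zm p.1 p.2) ξ) - 1))) muVS := by
    refine hk.mul_bdd (c := 2) ?_ (ae_of_all _ fun p => ?_)
    · have := continuous_zm
      exact Continuous.aestronglyMeasurable (by fun_prop)
    · rw [norm_mul, norm_chr, one_mul]; exact hchr _
  rw [integral_prod _ hint1]
  have h1 : ∀ z : V, ∫ σ, ((Φ ‖z‖ * β (sdot (dir z) σ) : ℝ) : ℂ) *
      (chr (-inner ℝ z ξs) * (chr (inner ℝ (zm z σ) ξ) - 1)) ∂sphereMeasure =
      ∫ σ, (Φ ‖z‖ : ℂ) * chr (-inner ℝ z ξs) * ((β (sdot (dir ξ) σ) : ℂ) *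
        (chr (inner ℝ (zm ξ σ) z) - 1)) ∂sphereMeasure := by
    intro z
    rw [integral_const_mul, ← integral_sphere_exchange, ← integral_const_mul]
    congr 1; ext σ; push_cast; ring
  simp_rw [h1]
  rw [integral_integral_swap]
  · rw [collKernel]
    congr 1
    ext σ
    have hint2 : ∀ η : V, Integrable fun z : V => chr (-inner ℝ z η) * (Φ ‖z‖ : ℂ) := fun η =>
      (hΦ.ofReal (𝕜 := ℂ)).bdd_mul (c := 1) (Continuous.aestronglyMeasurable (by fun_prop))
        (ae_of_all _ fun z => by simp)
    rw [radialHat, radialHat, ← integral_sub (hint2 _) (hint2 _), ← integral_const_mul]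
    congr 1
    ext z
    have : chr (-inner ℝ z (ξs - zm ξ σ)) = chr (-inner ℝ z ξs) * chr (inner ℝ (zm ξ σ) z) := by
      rw [← chr_add, inner_sub_right, real_inner_comm (zm ξ σ) z]
      congr 1; ring
    rw [this]
    ring
  · have h2 : Integrable (fun p : V × S2 => (Φ ‖p.1‖ : ℂ) * (β (sdot (dir ξ) p.2) : ℂ)) muVS := by
      refine (hΦ.ofReal (𝕜 := ℂ)).mul_prod (g := fun σ : S2 => (β (sdot (dir ξ) σ) : ℂ)) ?_
      refine Integrable.of_bound (C := M) ?_ (ae_of_all _ fun σ => ?_)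
      · exact (Complex.measurable_ofReal.comp
          (hβ.comp (measurable_sdot_left _))).aestronglyMeasurable
      · simpa using hM (dir ξ) σ
    have h3 := h2.mul_bdd (c := 2) (g := fun p : V × S2 => chr (-inner ℝ p.1 ξs) *
      (chr (inner ℝ (zm ξ p.2) p.1) - 1)) ?_ (ae_of_all _ fun p => ?_)
    · refine h3.congr (ae_of_all _ fun p => ?_)
      simp only [Function.uncurry]
      ring
    · have h4 : Continuous fun p : V × S2 => zm ξ p.2 :=
        continuous_zm.comp (Continuous.prodMk continuous_const continuous_snd)
      exact Continuous.aestronglyMeasurable (by fun_prop)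
    · rw [norm_mul, norm_chr, one_mul]; exact hchr _

/-- The displacements are left free so that one statement serves the gain term, the loss term and
the gain term after the change of variables. Integrability in v comes from `g`; the factors `f` and
`h` are merely bounded. -/
lemma integrable_kernel_mul_triple (hΦ : Integrable fun z : V => Φ ‖z‖) (hβ : Measurable β)
    (hM : ∀ e σ : S2, |β (sdot e σ)| ≤ M) (f g h : 𝓢(V, ℂ)) {y₁ y₂ y₃ : V × S2 → V}
    (hy₁ : Continuous y₁) (hy₂ : Continuous y₂) (hy₃ : Continuous y₃) :
    Integrable (fun q : V × (V × S2) => ((Φ ‖q.2.1‖ * β (sdot (dir q.2.1) q.2.2) : ℝ) : ℂ) *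
      (f (q.1 - y₁ q.2) * g (q.1 - y₂ q.2) * (starRingEnd ℂ) (h (q.1 - y₃ q.2))))
      ((volume : Measure V).prod muVS) := by
  obtain ⟨A, hA, hf⟩ := exists_schwartz_bound f
  obtain ⟨C, hC, hh⟩ := exists_schwartz_bound h
  have hk := (integrable_radial_kernel hΦ hβ hM).ofReal (𝕜 := ℂ)
  have hcf := f.continuous
  have hcg := g.continuous
  have hch := h.continuous
  have h1 : Integrable (fun q : (V × S2) × V =>
      ((Φ ‖q.1.1‖ * β (sdot (dir q.1.1) q.1.2) : ℝ) : ℂ) * g (q.2 - y₂ q.1))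
      (muVS.prod (volume : Measure V)) := by
    have h2 := hk.mul_prod (g.integrable (μ := volume))
    have hT : MeasurePreserving (fun q : (V × S2) × V => (q.1, q.2 - y₂ q.1))
        (muVS.prod (volume : Measure V)) (muVS.prod volume) := by
      refine (MeasurePreserving.id muVS).skew_product (f := id) (g := fun p v => v - y₂ p) ?_ ?_
      · exact (Continuous.measurable (by fun_prop))
      · exact ae_of_all _ fun p => (measurePreserving_sub_right volume (y₂ p)).map_eq
    exact hT.integrable_comp_of_integrable h2
  have h2 := h1.mul_bdd (c := A * C) (g := fun q : (V × S2) × V => f (q.2 - y₁ q.1) *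
    (starRingEnd ℂ) (h (q.2 - y₃ q.1))) ?_ (ae_of_all _ fun q => ?_)
  · have h3 := h2.swap
    refine h3.congr (ae_of_all _ fun q => ?_)
    simp only [Function.comp_apply, Prod.swap]
    ring
  · have := Complex.continuous_conj
    exact Continuous.aestronglyMeasurable (by fun_prop)
  · rw [norm_mul, RCLike.norm_conj]
    gcongr
    · exact hf _
    · exact hh _

/-- The weak form of the collision integral with a cutoff kernel in terms of Fourier transforms. -/
lemma integral_collDiff_eq (hΦ : Integrable fun z : V => Φ ‖z‖) (hβ : Measurable β)
    (hM : ∀ e σ : S2, |β (sdot e σ)| ≤ M) (f g h : 𝓢(V, ℂ)) :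
    ∫ v, (∫ p : V × S2, ((Φ ‖p.1‖ * β (sdot (dir p.1) p.2) : ℝ) : ℂ) * collDiff f g v p ∂muVS) *
      (starRingEnd ℂ) (h v) =
    ∫ q : V × V, tripleHat f g h q * collKernel Φ β q.1 q.2 ∂(volume.prod volume) := by
  set k : V × S2 → ℂ := fun p => ((Φ ‖p.1‖ * β (sdot (dir p.1) p.2) : ℝ) : ℂ) with hkdef
  have hk : Integrable k muVS := (integrable_radial_kernel hΦ hβ hM).ofReal
  have c0 : Continuous fun _ : V × S2 => (0 : V) := continuous_const
  have i1 := integrable_kernel_mul_triple hΦ hβ hM f g h continuous_zp continuous_zm c0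
  have i2 := integrable_kernel_mul_triple hΦ hβ hM f g h continuous_fst c0 c0
  have i3 := integrable_kernel_mul_triple hΦ hβ hM f g h continuous_fst c0 continuous_zm
  simp only [sub_zero] at i1 i2 i3
  set I : V × S2 → ℂ := fun p => ∫ v, f (v - p.1) * g v * (starRingEnd ℂ) (h (v - zm p.1 p.2))
  set I₀ : V × S2 → ℂ := fun p => ∫ v, f (v - p.1) * g v * (starRingEnd ℂ) (h v)
  have s1 : ∫ v, (∫ p : V × S2, k p * collDiff f g v p ∂muVS) * (starRingEnd ℂ) (h v) =
      (∫ v, ∫ p : V × S2, k p * (f (v - zp p.1 p.2) * g (v - zm p.1 p.2) *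
        (starRingEnd ℂ) (h v)) ∂muVS) -
      ∫ v, ∫ p : V × S2, k p * (f (v - p.1) * g v * (starRingEnd ℂ) (h v)) ∂muVS := by
    rw [← integral_integral_sub i1 i2]
    refine integral_congr_ae (ae_of_all _ fun v => ?_)
    simp only
    rw [← integral_mul_const]
    congr 1; ext p
    simp only [collDiff]; ring
  -- Translation by z⁻ followed by the exchange moves the collision onto h: the product f(v-z⁺)
  -- g(v-z⁻) h̄(v) becomes f(v-z) g(v) h̄(v-z⁻).
  have s2 : ∫ v, ∫ p : V × S2, k p * (f (v - zp p.1 p.2) * g (v - zm p.1 p.2) *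
        (starRingEnd ℂ) (h v)) ∂muVS = ∫ p, k p * I p ∂muVS := by
    rw [integral_integral_swap i1]
    have hI : ∀ p : V × S2, ∫ v, k p * (f (v - zp p.1 p.2) * g (v - zm p.1 p.2) *
        (starRingEnd ℂ) (h v)) = k p * I (exchange p) := by
      intro p
      rw [integral_const_mul]
      congr 1
      rw [← integral_add_right_eq_self _ (zm p.1 p.2)]
      congr 1; ext v
      rw [zm_exchange, exchange_fst, sub_neg_eq_add, add_sub_cancel_right,
        show v + zm p.1 p.2 - zp p.1 p.2 = v - (zp p.1 p.2 - zm p.1 p.2) by abel]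
    simp_rw [hI]
    have hkI : Integrable (fun p => k p * I p) muVS := by
      have := i3.integral_prod_right
      simpa only [integral_const_mul] using this
    rw [← integral_comp_measurePreserving measurePreserving_exchange hkI.aestronglyMeasurable]
    refine integral_congr_ae ?_
    filter_upwards [ae_fst_ne_zero] with p hp
    simp only [hkdef, norm_exchange_fst, sdot_exchange p hp]
  have s3 : ∫ v, ∫ p : V × S2, k p * (f (v - p.1) * g v * (starRingEnd ℂ) (h v)) ∂muVS =
      ∫ p, k p * I₀ p ∂muVS := by
    rw [integral_integral_swap i2]
    simp_rw [integral_const_mul]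
    rfl
  have hkI : Integrable (fun p => k p * I p) muVS := by
    have := i3.integral_prod_right
    simpa only [integral_const_mul] using this
  have hkI₀ : Integrable (fun p => k p * I₀ p) muVS := by
    have := i2.integral_prod_right
    simpa only [integral_const_mul] using this
  rw [s1, s2, s3, ← integral_sub hkI hkI₀]
  have hΩ : Integrable (tripleHat f g h) (volume.prod volume) := integrable_tripleHat
  have hΩ' : ∀ z y : V, Integrable (fun q : V × V => tripleHat f g h q *
      (chr (-inner ℝ z q.2) * chr (inner ℝ y q.1))) (volume.prod volume) := fun z y =>
    hΩ.mul_bdd (c := 1) (Continuous.aestronglyMeasurable (by fun_prop))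
      (ae_of_all _ fun q => by simp)
  have s4 : ∀ p : V × S2, k p * I p - k p * I₀ p = ∫ q : V × V, tripleHat f g h q *
      (k p * (chr (-inner ℝ p.1 q.2) * (chr (inner ℝ (zm p.1 p.2) q.1) - 1)))
        ∂(volume.prod volume) := by
    intro p
    have e1 : I p = _ := integral_translates_eq f g h p.1 (zm p.1 p.2)
    have e2 := integral_translates_eq f g h p.1 0
    simp only [sub_zero] at e2
    change I₀ p = _ at e2
    rw [e1, e2, ← mul_sub, ← integral_sub (hΩ' _ _) (hΩ' _ _), ← integral_const_mul]
    congr 1; ext q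
    simp only [inner_zero_left, chr_zero]
    ring
  simp_rw [s4]
  rw [integral_integral_swap]
  · congr 1; ext q
    rw [integral_const_mul, integral_kernel_chr hΦ hβ hM]
  · have h1 := hk.mul_prod hΩ
    have h2 := h1.mul_bdd (c := 2) (g := fun x : (V × S2) × (V × V) =>
      chr (-inner ℝ x.1.1 x.2.2) * (chr (inner ℝ (zm x.1.1 x.1.2) x.2.1) - 1)) ?_
      (ae_of_all _ fun x => ?_)
    · refine h2.congr (ae_of_all _ fun x => ?_)
      simp only [Function.uncurry]
      ring
    · have h4 : Continuous fun x : (V × S2) × (V × V) => zm x.1.1 x.1.2 :=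
        continuous_zm.comp continuous_fst
      exact Continuous.aestronglyMeasurable (by fun_prop)
    · rw [norm_mul, norm_chr, one_mul]
      exact (norm_sub_le _ _).trans (by simp; norm_num)

end

/-! ### Symbol bounds for the transform of the kinetic factor. -/

/-- Symbol-type bounds of order `-p` on a function and its symmetric second differences. -/
structure SymbolBound (Ψ : V → ℂ) (p A : ℝ) : Prop where
  bound : ∀ ξ, ‖Ψ ξ‖ ≤ A * (1 + ‖ξ‖) ^ (-p)
  second : ∀ ξ y y', ‖y‖ ≤ (1 + ‖ξ‖) / 2 → ‖y'‖ ≤ (1 + ‖ξ‖) / 2 →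
    ‖Ψ (ξ - y) + Ψ (ξ - y') - 2 * Ψ ξ‖ ≤ A * (1 + ‖ξ‖) ^ (-p) *
      (‖y + y'‖ / (1 + ‖ξ‖) + (‖y‖ ^ 2 + ‖y'‖ ^ 2) / (1 + ‖ξ‖) ^ 2)

lemma SymbolBound.zero (p : ℝ) : SymbolBound (fun _ => 0) p 0 := ⟨by simp, by simp⟩

lemma SymbolBound.add {Ψ₁ Ψ₂ : V → ℂ} {p A₁ A₂ : ℝ} (h₁ : SymbolBound Ψ₁ p A₁)
    (h₂ : SymbolBound Ψ₂ p A₂) : SymbolBound (fun ξ => Ψ₁ ξ + Ψ₂ ξ) p (A₁ + A₂) := by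
  refine ⟨fun ξ => ?_, fun ξ y y' hy hy' => ?_⟩
  · rw [add_mul]
    exact (norm_add_le _ _).trans (add_le_add (h₁.bound ξ) (h₂.bound ξ))
  · rw [add_mul, add_mul]
    refine le_trans ?_ (add_le_add (h₁.second ξ y y' hy hy') (h₂.second ξ y y' hy hy'))
    refine le_trans (le_of_eq ?_) (norm_add_le _ _)
    congr 1; ring

lemma SymbolBound.sum {Ψ : ℕ → V → ℂ} {p : ℝ} {A : ℕ → ℝ} (h : ∀ j, SymbolBound (Ψ j) p (A j))
    (J : ℕ) : SymbolBound (fun ξ => ∑ j ∈ Finset.range J, Ψ j ξ) p (∑ j ∈ Finset.range J, A j) := by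
  induction J with
  | zero => simpa using SymbolBound.zero p
  | succ J ih => simpa only [Finset.sum_range_succ] using ih.add (h J)

lemma SymbolBound.mono {Ψ : V → ℂ} {p A A' : ℝ} (h : SymbolBound Ψ p A) (hA : A ≤ A') :
    SymbolBound Ψ p A' := by
  refine ⟨fun ξ => (h.bound ξ).trans ?_, fun ξ y y' hy hy' => (h.second ξ y y' hy hy').trans ?_⟩ <;>
  gcongr

/-- The bounds concern values and differences, not derivatives, and therefore pass to pointwise
limits. -/
lemma SymbolBound.of_tendsto {Ψ : ℕ → V → ℂ} {Ψ' : V → ℂ} {p A : ℝ}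
    (h : ∀ j, SymbolBound (Ψ j) p A) (ht : ∀ ξ, Tendsto (fun j => Ψ j ξ) atTop (𝓝 (Ψ' ξ))) :
    SymbolBound Ψ' p A := by
  refine ⟨fun ξ => ?_, fun ξ y y' hy hy' => ?_⟩
  · exact le_of_tendsto (ht ξ).norm (Eventually.of_forall fun j => (h j).bound ξ)
  · exact le_of_tendsto (((ht _).add (ht _)).sub ((ht ξ).const_mul 2)).norm
      (Eventually.of_forall fun j => (h j).second ξ y y' hy hy')

/-- Dilates of a Schwartz function satisfy symbol bounds of every order. -/
lemma exists_symbolBound_dilate (χ : 𝓢(V, ℂ)) (P : ℝ) {p : ℝ} (hp : 0 ≤ p) :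
    ∃ C : ℝ, 0 ≤ C ∧ ∀ ρ : ℝ, 0 < ρ → ρ ≤ 1 →
      SymbolBound (fun ξ => ((ρ ^ P : ℝ) : ℂ) * χ (ρ • ξ)) p (C * ρ ^ (P - p)) := by
  obtain ⟨C₀, hC₀, h₀⟩ := exists_schwartz_decay χ p
  set χ₁ := SchwartzMap.fderivCLM ℝ V ℂ χ with hχ₁
  obtain ⟨C₁, hC₁, h₁⟩ := exists_schwartz_decay χ₁ (p + 1)
  obtain ⟨C₂, hC₂, h₂⟩ := exists_schwartz_decay (SchwartzMap.fderivCLM ℝ V _ χ₁) (p + 2)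
  refine ⟨C₀ + C₁ + C₂ * 2 ^ (p + 2), by positivity, fun ρ hρ hρ1 => ⟨fun ξ => ?_, ?_⟩⟩
  · have hx : 0 < 1 + ‖ξ‖ := by positivity
    -- This is where ρ ≤ 1 enters.
    have h3 : ρ * (1 + ‖ξ‖) ≤ 1 + ‖ρ • ξ‖ := by
      rw [norm_smul, Real.norm_of_nonneg hρ.le]; linarith
    rw [norm_mul, Complex.norm_real, Real.norm_of_nonneg (by positivity)]
    calc ρ ^ P * ‖χ (ρ • ξ)‖ ≤ ρ ^ P * (C₀ * (ρ * (1 + ‖ξ‖)) ^ (-p)) := by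
          gcongr
          refine (h₀ _).trans ?_
          gcongr _ * ?_
          exact Real.rpow_le_rpow_of_nonpos (by positivity) h3 (by linarith)
      _ = C₀ * ρ ^ (P - p) * (1 + ‖ξ‖) ^ (-p) := by
          rw [Real.mul_rpow hρ.le hx.le, sub_eq_add_neg, Real.rpow_add hρ]; ring
      _ ≤ _ := by
          gcongr
          have : 0 ≤ C₂ * 2 ^ (p + 2) := by positivity
          linarith
  · intro ξ y y' hy hy'
    have hx : 0 < 1 + ‖ξ‖ := by positivity
    have hρx : 0 < ρ * (1 + ‖ξ‖) := by positivity
    -- Displacements of at most (1+|ξ|)/2 keep the dilated points in a ball on which 1+|u| is still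
    -- at least ρ(1+|ξ|)/2, so the decay of the second derivative is not lost.
    set s := Metric.closedBall (ρ • ξ) (ρ * (1 + ‖ξ‖) / 2) with hs
    have hmem : ∀ u : V, ‖u‖ ≤ (1 + ‖ξ‖) / 2 → ρ • ξ + -(ρ • u) ∈ s := by
      intro u hu
      rw [hs, mem_closedBall_iff_norm, add_sub_cancel_left, norm_neg, norm_smul,
        Real.norm_of_nonneg hρ.le]
      nlinarith
    have hlow : ∀ u ∈ s, ρ * (1 + ‖ξ‖) / 2 ≤ 1 + ‖u‖ := by
      intro u hu
      rw [hs, mem_closedBall_iff_norm] at hu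
      have h3 : ‖ρ • ξ‖ - ‖u‖ ≤ ‖u - ρ • ξ‖ := by
        rw [norm_sub_rev]; exact norm_sub_norm_le _ _
      rw [norm_smul, Real.norm_of_nonneg hρ.le] at h3
      linarith
    have hC1 : ‖fderiv ℝ χ (ρ • ξ)‖ ≤ C₁ * (ρ * (1 + ‖ξ‖)) ^ (-(p + 1)) := by
      refine (h₁ _).trans ?_
      gcongr _ * ?_
      refine Real.rpow_le_rpow_of_nonpos (by positivity) ?_ (by linarith)
      rw [norm_smul, Real.norm_of_nonneg hρ.le]; linarith
    have hC2 : ∀ u ∈ s, ‖fderiv ℝ χ u - fderiv ℝ χ (ρ • ξ)‖ ≤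
        C₂ * (ρ * (1 + ‖ξ‖) / 2) ^ (-(p + 2)) * ‖u - ρ • ξ‖ := by
      intro u hu
      refine Convex.norm_image_sub_le_of_norm_fderiv_le (𝕜 := ℝ) (f := χ₁) (s := s)
        (fun w _ => χ₁.differentiableAt) (fun w hw => ?_) (convex_closedBall _ _)
        (Metric.mem_closedBall_self (by positivity)) hu
      refine (h₂ w).trans ?_
      gcongr _ * ?_
      exact Real.rpow_le_rpow_of_nonpos (by positivity) (hlow w hw) (by linarith)
    have key := norm_second_difference_le (y := -(ρ • y)) (y' := -(ρ • y')) (convex_closedBall _ _)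
      (Metric.mem_closedBall_self (by positivity)) (hmem y hy) (hmem y' hy') χ.differentiable hC1
      (by positivity) hC2
    have e1 : ((ρ ^ P : ℝ) : ℂ) * χ (ρ • (ξ - y)) + ((ρ ^ P : ℝ) : ℂ) * χ (ρ • (ξ - y')) -
        2 * (((ρ ^ P : ℝ) : ℂ) * χ (ρ • ξ)) = ((ρ ^ P : ℝ) : ℂ) *
        (χ (ρ • ξ + -(ρ • y)) + χ (ρ • ξ + -(ρ • y')) - 2 * χ (ρ • ξ)) := by
      rw [smul_sub, smul_sub, sub_eq_add_neg (ρ • ξ), sub_eq_add_neg (ρ • ξ)]; ring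
    rw [e1, norm_mul, Complex.norm_real, Real.norm_of_nonneg (by positivity)]
    have e2 : ‖-(ρ • y) + -(ρ • y')‖ = ρ * ‖y + y'‖ := by
      rw [← neg_add, norm_neg, ← smul_add, norm_smul, Real.norm_of_nonneg hρ.le]
    have e3 : ∀ u : V, ‖-(ρ • u)‖ ^ 2 = ρ ^ 2 * ‖u‖ ^ 2 := fun u => by
      rw [norm_neg, norm_smul, Real.norm_of_nonneg hρ.le, mul_pow]
    rw [e2, e3, e3] at key
    have r1 : (ρ * (1 + ‖ξ‖)) ^ (-(p + 1)) = ρ ^ (-p) * (1 + ‖ξ‖) ^ (-p) / (ρ * (1 + ‖ξ‖)) := by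
      rw [← Real.mul_rpow hρ.le hx.le, neg_add, ← sub_eq_add_neg, Real.rpow_sub hρx, Real.rpow_one]
    have r2 : (ρ * (1 + ‖ξ‖) / 2) ^ (-(p + 2)) =
        2 ^ (p + 2) * (ρ ^ (-p) * (1 + ‖ξ‖) ^ (-p)) / (ρ * (1 + ‖ξ‖)) ^ 2 := by
      rw [Real.div_rpow hρx.le (by norm_num), Real.rpow_neg (by norm_num : (0 : ℝ) ≤ 2),
        ← Real.mul_rpow hρ.le hx.le, neg_add, ← sub_eq_add_neg, Real.rpow_sub hρx, div_inv_eq_mul]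
      norm_num
      ring
    rw [r1, r2] at key
    set N := (1 + ‖ξ‖) ^ (-p) with hN
    have hN0 : 0 < N := by positivity
    have hPp : ρ ^ (P - p) = ρ ^ P * ρ ^ (-p) := by rw [sub_eq_add_neg, Real.rpow_add hρ]
    set a := ‖y + y'‖ / (1 + ‖ξ‖) with ha
    set c := (‖y‖ ^ 2 + ‖y'‖ ^ 2) / (1 + ‖ξ‖) ^ 2 with hc
    have ha0 : 0 ≤ a := by positivity
    have hc0 : 0 ≤ c := by positivity
    calc _ ≤ ρ ^ P * (C₁ * (ρ ^ (-p) * N / (ρ * (1 + ‖ξ‖))) * (ρ * ‖y + y'‖) +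
          C₂ * (2 ^ (p + 2) * (ρ ^ (-p) * N) / (ρ * (1 + ‖ξ‖)) ^ 2) *
            (ρ ^ 2 * ‖y‖ ^ 2 + ρ ^ 2 * ‖y'‖ ^ 2)) := by gcongr
      _ = ρ ^ (P - p) * N * (C₁ * a + C₂ * 2 ^ (p + 2) * c) := by
          rw [hPp, ha, hc]
          field_simp
      _ ≤ ρ ^ (P - p) * N * ((C₀ + C₁ + C₂ * 2 ^ (p + 2)) * a +
          (C₀ + C₁ + C₂ * 2 ^ (p + 2)) * c) := by
          have : 0 ≤ C₂ * 2 ^ (p + 2) := by positivity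
          gcongr <;> linarith
      _ = _ := by ring

variable {γ : ℝ} {φ₀ : ℝ → ℝ}

lemma continuous_radialHat {Φ : ℝ → ℝ} (hΦ : Integrable fun z : V => Φ ‖z‖) :
    Continuous (radialHat Φ) := by
  refine continuous_of_dominated (bound := fun z => ‖Φ ‖z‖‖) (fun ξ => ?_) (fun ξ => ?_) hΦ.norm ?_
  · exact (Continuous.aestronglyMeasurable (by fun_prop)).mul hΦ.ofReal.aestronglyMeasurable
  · exact ae_of_all _ fun z => by simp
  · exact ae_of_all _ fun z => by fun_prop

/-- The dyadic piece `|z|^γ (φ₀(|z|) - φ₀(2 |z|))` of the kinetic factor. -/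
noncomputable def dyadicPiece (φ₀ : ℝ → ℝ) (γ : ℝ) (z : V) : ℂ :=
  ((‖z‖ ^ γ * (φ₀ ‖z‖ - φ₀ (2 * ‖z‖)) : ℝ) : ℂ)

/-- Near the origin φ₀(r) and φ₀(2r) both equal 1 and the piece vanishes, so the singularities of
|z|^γ and of |z| are not felt. -/
lemma contDiff_dyadicPiece (hφ : IsCutoff φ₀) :
    ContDiff ℝ ((⊤ : ℕ∞) : WithTop ℕ∞) (dyadicPiece φ₀ γ) := by
  rw [contDiff_iff_contDiffAt]
  intro z
  rcases eq_or_ne z 0 with rfl | hz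
  · have hev : dyadicPiece φ₀ γ =ᶠ[𝓝 0] fun _ => (0 : ℂ) := by
      filter_upwards [Metric.ball_mem_nhds (0 : V) (by norm_num : (0 : ℝ) < 1 / 4)] with z hz
      rw [mem_ball_zero_iff] at hz
      have h0 := norm_nonneg z
      rw [dyadicPiece, hφ.eq_one ‖z‖ (by rw [abs_of_nonneg h0]; linarith),
        hφ.eq_one (2 * ‖z‖) (by rw [abs_of_nonneg (by positivity)]; linarith)]
      simp
    exact contDiffAt_const.congr_of_eventuallyEq hev
  · have h1 : ContDiffAt ℝ ((⊤ : ℕ∞) : WithTop ℕ∞) (fun z : V => ‖z‖) z := contDiffAt_norm ℝ hz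
    have h2 : ContDiffAt ℝ ((⊤ : ℕ∞) : WithTop ℕ∞)
        (fun z : V => ‖z‖ ^ γ * (φ₀ ‖z‖ - φ₀ (2 * ‖z‖))) z := by
      refine (h1.rpow_const_of_ne (norm_ne_zero_iff.2 hz)).mul ?_
      exact (hφ.smooth.contDiffAt.comp z h1).sub
        (hφ.smooth.contDiffAt.comp z (contDiffAt_const.mul h1))
    exact Complex.ofRealCLM.contDiff.contDiffAt.comp z h2

lemma dyadicPiece_eq_zero (hφ : IsCutoff φ₀) {z : V} (hz : 1 < ‖z‖) : dyadicPiece φ₀ γ z = 0 := by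
  rw [dyadicPiece, hφ.eq_zero hz, hφ.eq_zero (by linarith)]
  simp

lemma hasCompactSupport_dyadicPiece (hφ : IsCutoff φ₀) :
    HasCompactSupport (dyadicPiece φ₀ γ) := by
  refine HasCompactSupport.of_support_subset_isCompact (isCompact_closedBall (0 : V) 1) ?_
  intro z hz
  rw [mem_closedBall_zero_iff]
  by_contra h
  exact hz (dyadicPiece_eq_zero hφ (not_le.1 h))

/-- Scaling z by 2^j: the exponent γ comes from the homogeneity of |z|^γ and 3 from the Jacobian. -/
lemma integral_chr_dyadicPiece_smul (γ : ℝ) (φ₀ : ℝ → ℝ) (j : ℕ) (ξ : V) :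
    ∫ z : V, chr (-inner ℝ z ξ) *
      ((‖z‖ ^ γ * (φ₀ (2 ^ j * ‖z‖) - φ₀ (2 ^ (j + 1) * ‖z‖)) : ℝ) : ℂ) =
    (((((1 / 2) ^ j : ℝ)) ^ (γ + 3) : ℝ) : ℂ) * 𝓕 (dyadicPiece φ₀ γ) (((1 / 2) ^ j : ℝ) • ξ) := by
  set R : ℝ := 2 ^ j with hR
  have hR0 : 0 < R := by positivity
  have hρ : ((1 / 2) ^ j : ℝ) = R⁻¹ := by rw [one_div, inv_pow]
  have h1 : ∀ z : V, chr (-inner ℝ z ξ) *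
      ((‖z‖ ^ γ * (φ₀ (R * ‖z‖) - φ₀ (2 ^ (j + 1) * ‖z‖)) : ℝ) : ℂ) =
      ((R ^ (-γ) : ℝ) : ℂ) * (fun w => chr (-inner ℝ w (R⁻¹ • ξ)) * dyadicPiece φ₀ γ w) (R • z) := by
    intro z
    simp only [dyadicPiece, norm_smul, Real.norm_of_nonneg hR0.le, inner_smul_left,
      inner_smul_right, conj_trivial]
    rw [inv_mul_cancel_left₀ hR0.ne', Real.mul_rpow hR0.le (norm_nonneg z), Real.rpow_neg hR0.le,
      show (2 : ℝ) ^ (j + 1) * ‖z‖ = 2 * (R * ‖z‖) by rw [hR]; ring]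
    have : (R ^ γ : ℝ) ≠ 0 := by positivity
    push_cast
    have h' : ((R ^ γ : ℝ) : ℂ) ≠ 0 := by exact_mod_cast this
    field_simp
  simp_rw [h1]
  rw [integral_const_mul, Measure.integral_comp_smul volume
    (fun w => chr (-inner ℝ w (R⁻¹ • ξ)) * dyadicPiece φ₀ γ w) R, ← fourier_eq_integral_chr, hρ]
  have hfin : Module.finrank ℝ V = 3 := by simp
  rw [hfin, abs_of_pos (by positivity), Real.inv_rpow hR0.le, ← Real.rpow_neg hR0.le, neg_add,
    Real.rpow_add hR0, Complex.real_smul]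
  have : R ^ (-3 : ℝ) = (R ^ 3)⁻¹ := by
    rw [Real.rpow_neg hR0.le]; norm_num
  rw [this]
  push_cast
  ring

/-- Off the origin φ₀(|z|) telescopes into the differences φ₀(2^j|z|) - φ₀(2^(j+1)|z|). The
transform is thus a sum of terms 2^(-j(γ+3)) ψ̂(2^(-j)ξ) with one fixed smooth compactly supported
ψ. The constant of the j-th term at order -p is a multiple of 2^(-j(γ+3-p)), summable as p < γ+3. -/
lemma exists_symbolBound_phiC (hφ : IsCutoff φ₀) {p : ℝ} (hp0 : 0 ≤ p) (hp : p < γ + 3) :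
    ∃ A : ℝ, 0 ≤ A ∧ SymbolBound (radialHat (phiC φ₀ γ)) p A := by
  have hγ : -3 < γ := by linarith
  set ψ : 𝓢(V, ℂ) :=
    (hasCompactSupport_dyadicPiece (γ := γ) hφ).toSchwartzMap (contDiff_dyadicPiece hφ)
  have hψ : (ψ : V → ℂ) = dyadicPiece φ₀ γ := rfl
  obtain ⟨C, hC, h⟩ := exists_symbolBound_dilate (𝓕 ψ) (γ + 3) hp0
  set r : ℝ := (1 / 2) ^ (γ + 3 - p) with hr
  have hr0 : 0 ≤ r := by positivity
  have hr1 : r < 1 := Real.rpow_lt_one (by norm_num) (by norm_num) (by linarith)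
  have hpow : ∀ j : ℕ, (((1 / 2) ^ j : ℝ)) ^ (γ + 3 - p) = r ^ j := fun j => by
    rw [hr, ← Real.rpow_natCast, ← Real.rpow_natCast, ← Real.rpow_mul (by norm_num),
      ← Real.rpow_mul (by norm_num), mul_comm]
  refine ⟨C * (1 - r)⁻¹, mul_nonneg hC (inv_nonneg.2 (by linarith)), ?_⟩
  have hJ : ∀ J : ℕ, SymbolBound (fun ξ => ∑ j ∈ Finset.range J,
      (((((1 / 2) ^ j : ℝ)) ^ (γ + 3) : ℝ) : ℂ) * 𝓕 ψ (((1 / 2) ^ j : ℝ) • ξ)) p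
      (C * (1 - r)⁻¹) := by
    intro J
    have h1 := SymbolBound.sum (fun j : ℕ => h ((1 / 2) ^ j) (by positivity)
      (pow_le_one₀ (by norm_num) (by norm_num))) J
    refine h1.mono ?_
    simp_rw [hpow, ← Finset.mul_sum]
    gcongr
    rw [← tsum_geometric_of_lt_one hr0 hr1]
    exact (summable_geometric_of_lt_one hr0 hr1).sum_le_tsum _ (fun j _ => by positivity)
  refine SymbolBound.of_tendsto hJ fun ξ => ?_
  obtain ⟨M, hM0, hM⟩ := hφ.exists_bound
  have hmφ := hφ.smooth.continuous.measurable
  set G : ℕ → V → ℂ := fun J z =>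
    chr (-inner ℝ z ξ) * ((‖z‖ ^ γ * (φ₀ ‖z‖ - φ₀ (2 ^ J * ‖z‖)) : ℝ) : ℂ) with hG
  have hzero : ∀ (J : ℕ) (z : V), 1 < ‖z‖ → φ₀ (2 ^ J * ‖z‖) = 0 := fun J z hz => by
    refine hφ.eq_zero (lt_of_lt_of_le hz ?_)
    have : (1 : ℝ) ≤ 2 ^ J := one_le_pow₀ (by norm_num)
    nlinarith
  have hIbd : Integrable fun z : V => ‖z‖ ^ γ * (Set.Iic (1 : ℝ)).indicator (fun _ => 2 * M) ‖z‖ := by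
    refine integrable_rpow_norm_mul hγ (measurable_const.indicator measurableSet_Iic)
      (M := 2 * M) (fun t => ?_) (fun t ht => ?_)
    · by_cases ht : t ∈ Set.Iic (1 : ℝ)
      · rw [Set.indicator_of_mem ht, abs_of_nonneg (by positivity)]
      · rw [Set.indicator_of_notMem ht, abs_zero]; positivity
    · exact Set.indicator_of_notMem (by simpa using ht) _
  have hmeas : ∀ {F : ℝ → ℝ}, Measurable F →
      AEStronglyMeasurable (fun z : V => chr (-inner ℝ z ξ) * ((‖z‖ ^ γ * F ‖z‖ : ℝ) : ℂ)) volume := by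
    intro F hF
    have : Measurable fun z : V => ‖z‖ ^ γ * F ‖z‖ := by fun_prop
    exact (Continuous.aestronglyMeasurable (by fun_prop)).mul
      (Complex.measurable_ofReal.comp this).aestronglyMeasurable
  have hdom : ∀ (F : ℝ → ℝ), (∀ t, |F t| ≤ 2 * M) → (∀ t, 1 < t → F t = 0) → ∀ z : V,
      ‖chr (-inner ℝ z ξ) * ((‖z‖ ^ γ * F ‖z‖ : ℝ) : ℂ)‖ ≤
        ‖z‖ ^ γ * (Set.Iic (1 : ℝ)).indicator (fun _ => 2 * M) ‖z‖ := by
    intro F hF hF0 z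
    rw [norm_mul, norm_chr, one_mul, Complex.norm_real, norm_mul,
      Real.norm_of_nonneg (by positivity)]
    gcongr
    by_cases hz : ‖z‖ ∈ Set.Iic (1 : ℝ)
    · rw [Set.indicator_of_mem hz]; exact hF _
    · rw [Set.indicator_of_notMem hz, hF0 _ (not_le.1 hz), norm_zero]
  have hdiff : ∀ s t : ℝ, |φ₀ s - φ₀ t| ≤ 2 * M := fun s t => by
    refine (abs_sub _ _).trans ?_
    have := hM s
    have := hM t
    linarith
  have hlim : Tendsto (fun J => ∫ z, G J z) atTop (𝓝 (radialHat (phiC φ₀ γ) ξ)) := by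
    refine tendsto_integral_of_dominated_convergence _ (fun J => ?_) hIbd (fun J => ?_) ?_
    · exact hmeas (F := fun t => φ₀ t - φ₀ (2 ^ J * t)) (by fun_prop)
    · refine ae_of_all _ fun z => hdom (fun t => φ₀ t - φ₀ (2 ^ J * t)) (fun t => hdiff _ _) ?_ z
      intro t ht
      have : (1 : ℝ) ≤ 2 ^ J := one_le_pow₀ (by norm_num)
      rw [hφ.eq_zero ht, hφ.eq_zero (by nlinarith), sub_zero]
    · filter_upwards [Measure.ae_ne volume (0 : V)] with z hz
      have hz0 : 0 < ‖z‖ := norm_pos_iff.2 hz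
      refine tendsto_const_nhds.congr' ?_
      have : Tendsto (fun J : ℕ => (2 : ℝ) ^ J * ‖z‖) atTop atTop :=
        (tendsto_pow_atTop_atTop_of_one_lt (by norm_num)).atTop_mul_const hz0
      filter_upwards [this.eventually_gt_atTop 1] with J hJ
      simp only [hG, phiC]
      rw [hφ.eq_zero hJ, sub_zero]
  refine hlim.congr fun J => ?_
  have hint : ∀ j : ℕ, Integrable fun z : V => chr (-inner ℝ z ξ) *
      ((‖z‖ ^ γ * (φ₀ (2 ^ j * ‖z‖) - φ₀ (2 ^ (j + 1) * ‖z‖)) : ℝ) : ℂ) := fun j => by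
    refine hIbd.mono' (hmeas (F := fun t => φ₀ (2 ^ j * t) - φ₀ (2 ^ (j + 1) * t)) (by fun_prop)) ?_
    refine ae_of_all _ fun z =>
      hdom (fun t => φ₀ (2 ^ j * t) - φ₀ (2 ^ (j + 1) * t)) (fun t => hdiff _ _) ?_ z
    intro t ht
    have h1 : (1 : ℝ) ≤ 2 ^ j := one_le_pow₀ (by norm_num)
    have h2 : (1 : ℝ) ≤ 2 ^ (j + 1) := one_le_pow₀ (by norm_num)
    rw [hφ.eq_zero (by nlinarith), hφ.eq_zero (by nlinarith), sub_zero]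
  calc ∫ z, G J z = ∫ z : V, ∑ j ∈ Finset.range J, chr (-inner ℝ z ξ) *
        ((‖z‖ ^ γ * (φ₀ (2 ^ j * ‖z‖) - φ₀ (2 ^ (j + 1) * ‖z‖)) : ℝ) : ℂ) := by
        congr 1; ext z
        rw [← Finset.mul_sum, ← Complex.ofReal_sum, ← Finset.mul_sum,
          Finset.sum_range_sub' (fun j => φ₀ (2 ^ j * ‖z‖))]
        simp [hG]
    _ = _ := by
        rw [integral_finsetSum _ fun j _ => hint j]
        refine Finset.sum_congr rfl fun j _ => ?_
        rw [integral_chr_dyadicPiece_smul, SchwartzMap.fourier_coe, hψ]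

/-! ### Pointwise bound on the multiplier. -/

/-- The growth function `r` for `r ≤ 1`, `r ^ ν` for `r > 1`. -/
noncomputable def kap (ν r : ℝ) : ℝ := if r ≤ 1 then r else r ^ ν

lemma kap_nonneg {ν r : ℝ} (hr : 0 ≤ r) : 0 ≤ kap ν r := by
  unfold kap; split_ifs <;> positivity

lemma kap_mono {ν r s : ℝ} (hν : 0 ≤ ν) (hr : 0 ≤ r) (hrs : r ≤ s) : kap ν r ≤ kap ν s := by
  unfold kap
  split_ifs with h1 h2 h2
  · exact hrs
  · exact h1.trans (Real.one_le_rpow (not_le.1 h2).le hν)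
  · exact absurd (hrs.trans h2) h1
  · exact Real.rpow_le_rpow hr hrs hν

/-- Bounds on a cutoff angular kernel of order `ν`. -/
structure AngularBound (ν B : ℝ) (β : ℝ → ℝ) : Prop where
  measurable : Measurable β
  nonneg : ∀ t, 0 ≤ β t
  eq_zero : ∀ t < 0, β t = 0
  bounded : ∃ M : ℝ, ∀ e σ : S2, β (sdot e σ) ≤ M
  bound : ∀ e σ : S2, β (sdot e σ) ≤ B * ‖(e : V) - σ‖ ^ (-2 - ν)

/-- The part of the multiplier in which the argument of `Ψ` may be small. -/
noncomputable def resonantPart (β : ℝ → ℝ) (p : ℝ) (ξ ξs : V) : ℝ≥0∞ :=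
  open Classical in
  if 1 + ‖ξ‖ ≤ 10 * (1 + ‖ξ - ξs‖) then
    ∫⁻ σ in {σ : S2 | 1 + ‖ξs‖ < ‖ξ‖ * ‖(dir ξ : V) - σ‖},
      ENNReal.ofReal (β (sdot (dir ξ) σ) * (1 + ‖ξs - zm ξ σ‖) ^ (-p)) ∂sphereMeasure
  else 0

lemma measurable_norm_sub_left (e : S2) : Measurable fun σ : S2 => ‖(e : V) - σ‖ := by fun_prop

lemma continuous_zm_right (ξ : V) : Continuous fun σ : S2 => zm ξ σ := by unfold zm; fun_prop

section Estimate

variable {ν B : ℝ} {β : ℝ → ℝ}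

lemma AngularBound.integrable (hβ : AngularBound ν B β) (e : S2) :
    Integrable (fun σ => (β (sdot e σ) : ℂ)) sphereMeasure := by
  obtain ⟨M, hM⟩ := hβ.bounded
  refine Integrable.of_bound (C := M) ?_ (ae_of_all _ fun σ => ?_)
  · exact (Complex.measurable_ofReal.comp
      (hβ.measurable.comp (measurable_sdot_left _))).aestronglyMeasurable
  · rw [Complex.norm_real, Real.norm_of_nonneg (hβ.nonneg _)]
    exact hM e σ

/-- Contribution of the small deviations, where the cancellation of the second difference
is used. -/
lemma exists_near_bound (hν₀ : 0 < ν) (hν₂ : ν < 2) (B : ℝ) (hB : 0 ≤ B) (p A : ℝ) (hA : 0 ≤ A) :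
    ∃ C : ℝ, 0 ≤ C ∧ ∀ (Ψ : V → ℂ), Continuous Ψ → SymbolBound Ψ p A → ∀ β : ℝ → ℝ,
      AngularBound ν B β → ∀ ξ ξs : V,
      ‖∫ σ in {σ : S2 | ‖ξ‖ * ‖(dir ξ : V) - σ‖ ≤ 1 + ‖ξs‖},
        (β (sdot (dir ξ) σ) : ℂ) * (Ψ (ξs - zm ξ σ) - Ψ ξs) ∂sphereMeasure‖ₑ ≤
      ENNReal.ofReal (C * ((1 + ‖ξs‖) ^ (-p) * kap ν (‖ξ‖ / (1 + ‖ξs‖)))) := by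
  obtain ⟨C, hC⟩ := exists_sphere_near_bound hν₀ hν₂
  refine ⟨A * B * C * 8, by positivity, fun Ψ hΨ hS β hβ ξ ξs => ?_⟩
  set X := 1 + ‖ξs‖ with hX
  have hX0 : 0 < X := by positivity
  set S := {σ : S2 | ‖ξ‖ * ‖(dir ξ : V) - σ‖ ≤ X} with hSdef
  have hSm : MeasurableSet S :=
    measurableSet_le (measurable_const.mul (measurable_norm_sub_left _)) measurable_const
  set T : S2 → S2 := halfTurn (dir ξ)
  have hT : MeasurePreserving T sphereMeasure sphereMeasure := measurePreserving_halfTurn _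
  set F : S2 → ℂ := fun σ => (β (sdot (dir ξ) σ) : ℂ) * (Ψ (ξs - zm ξ σ) - Ψ ξs) with hF
  have hFint : Integrable F sphereMeasure := by
    have hcont : Continuous fun σ : S2 => Ψ (ξs - zm ξ σ) - Ψ ξs :=
      (hΨ.comp (continuous_const.sub (continuous_zm_right ξ))).sub continuous_const
    obtain ⟨N, hN⟩ := (isCompact_univ (X := S2)).exists_bound_of_continuousOn hcont.continuousOn
    exact (hβ.integrable (dir ξ)).mul_bdd (c := N) hcont.aestronglyMeasurable
      (ae_of_all _ fun σ => hN σ (Set.mem_univ _))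
  have hSint : Integrable (S.indicator F) sphereMeasure := hFint.indicator hSm
  have hST : ∀ σ, S.indicator F (T σ) = S.indicator (fun σ => F (T σ)) σ := by
    intro σ
    have hiff : T σ ∈ S ↔ σ ∈ S := by
      simp only [hSdef, Set.mem_ofPred_eq, T, norm_sub_halfTurn]
    by_cases h : σ ∈ S
    · rw [Set.indicator_of_mem h, Set.indicator_of_mem (hiff.2 h)]
    · rw [Set.indicator_of_notMem h, Set.indicator_of_notMem (fun h' => h (hiff.1 h'))]
  -- The region `S` is invariant under the half-turn about ξ, so `F` may be averaged over it, and
  -- second differences of Ψ appear.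
  have hsym : ∫ σ in S, F σ ∂sphereMeasure =
      ∫ σ, S.indicator (fun σ => (1 / 2 : ℂ) * (F σ + F (T σ))) σ ∂sphereMeasure := by
    have h1 : ∫ σ, S.indicator F (T σ) ∂sphereMeasure = ∫ σ, S.indicator F σ ∂sphereMeasure :=
      integral_comp_measurePreserving hT hSint.aestronglyMeasurable
    have h2 : Integrable (fun σ => S.indicator F (T σ)) sphereMeasure :=
      hT.integrable_comp_of_integrable hSint
    rw [← integral_indicator hSm]
    have h3 : ∫ σ, (1 / 2 : ℂ) * (S.indicator F σ + S.indicator F (T σ)) ∂sphereMeasure =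
        ∫ σ, S.indicator F σ ∂sphereMeasure := by
      rw [integral_const_mul, integral_add hSint h2, h1]; ring
    rw [← h3]
    congr 1; ext σ
    rw [hST]
    by_cases h : σ ∈ S
    · simp only [Set.indicator_of_mem h]
    · simp only [Set.indicator_of_notMem h]; simp
  rw [hsym]
  set ρ := ‖ξ‖ / X with hρ
  have hρ0 : 0 ≤ ρ := by positivity
  have hpt : ∀ σ, ‖S.indicator (fun σ => (1 / 2 : ℂ) * (F σ + F (T σ))) σ‖ₑ ≤
      ENNReal.ofReal (A * B * X ^ (-p) * (ρ + ρ ^ 2)) *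
        S.indicator (fun σ => ENNReal.ofReal (‖(dir ξ : V) - σ‖ ^ (-ν))) σ := by
    intro σ
    by_cases h : σ ∈ S
    swap
    · simp only [Set.indicator_of_notMem h]; simp
    simp only [Set.indicator_of_mem h]
    rw [← ENNReal.ofReal_mul (by positivity), ← ofReal_norm]
    refine ENNReal.ofReal_le_ofReal ?_
    set d := ‖(dir ξ : V) - σ‖ with hd
    have hd0 : 0 ≤ d := norm_nonneg _
    have hσS : ‖ξ‖ * d ≤ X := h
    have hy : ‖zm ξ σ‖ ≤ X / 2 := by rw [norm_zm, ← hd]; linarith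
    have hy' : ‖zm ξ (T σ)‖ ≤ X / 2 := by rw [norm_zm_halfTurn]; exact hy
    have e1 : (1 / 2 : ℂ) * (F σ + F (T σ)) = (1 / 2 : ℂ) * (β (sdot (dir ξ) σ) : ℂ) *
        (Ψ (ξs - zm ξ σ) + Ψ (ξs - zm ξ (T σ)) - 2 * Ψ ξs) := by
      simp only [hF, T, sdot_halfTurn]; ring
    rw [e1, norm_mul, norm_mul, Complex.norm_real, Real.norm_of_nonneg (hβ.nonneg _)]
    have h12 : ‖(1 / 2 : ℂ)‖ = 1 / 2 := by norm_num
    have h2 := hS.second ξs _ _ hy hy'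
    rw [norm_zm_add_zm_halfTurn, norm_zm_halfTurn, norm_zm, ← hd, ← hX] at h2
    have e2 : ‖ξ‖ / 2 * d ^ 2 / X + ((‖ξ‖ / 2 * d) ^ 2 + (‖ξ‖ / 2 * d) ^ 2) / X ^ 2 =
        (ρ + ρ ^ 2) / 2 * d ^ 2 := by
      rw [hρ]; field_simp; ring
    rw [e2] at h2
    rcases hd0.eq_or_lt with h0 | hdpos
    · rw [← h0] at h2
      simp only [ne_eq, OfNat.ofNat_ne_zero, not_false_eq_true, zero_pow, mul_zero] at h2
      rw [le_antisymm h2 (norm_nonneg _), mul_zero]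
      positivity
    have hdd : d ^ (-2 - ν) * d ^ 2 = d ^ (-ν) := by
      rw [← Real.rpow_natCast d 2, ← Real.rpow_add hdpos]
      congr 1; push_cast; ring
    calc ‖(1 / 2 : ℂ)‖ * β (sdot (dir ξ) σ) * ‖Ψ (ξs - zm ξ σ) + Ψ (ξs - zm ξ (T σ)) - 2 * Ψ ξs‖
        ≤ 1 * (B * d ^ (-2 - ν)) * (A * X ^ (-p) * ((ρ + ρ ^ 2) / 2 * d ^ 2)) := by
          rw [h12]
          gcongr
          · exact hβ.nonneg _
          · norm_num
          · exact hβ.bound _ _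
      _ = A * B * X ^ (-p) * (ρ + ρ ^ 2) * (d ^ (-2 - ν) * d ^ 2) / 2 := by ring
      _ ≤ A * B * X ^ (-p) * (ρ + ρ ^ 2) * d ^ (-ν) := by
          rw [hdd]
          exact half_le_self (by positivity)
  -- The factor ρ + ρ² comes from the second difference. The integral of d^(-ν) over d ≤ min(2, 1/ρ)
  -- is O(1) for ρ ≤ 1 and O(ρ^(ν-2)) for ρ > 1.
  have hnear : ENNReal.ofReal (ρ + ρ ^ 2) *
      ∫⁻ σ in S, ENNReal.ofReal (‖(dir ξ : V) - σ‖ ^ (-ν)) ∂sphereMeasure ≤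
      C * ENNReal.ofReal (8 * kap ν ρ) := by
    rcases le_or_gt ρ 1 with hle | hgt
    · have h1 : ∫⁻ σ in S, ENNReal.ofReal (‖(dir ξ : V) - σ‖ ^ (-ν)) ∂sphereMeasure ≤
          C * ENNReal.ofReal (2 ^ (2 - ν)) := by
        refine le_trans (lintegral_mono_set ?_) (hC (dir ξ) 2 (by norm_num))
        exact fun σ _ => norm_sub_sphere_le_two _ _
      refine (mul_le_mul_right h1 _).trans ?_
      rw [mul_left_comm, ← ENNReal.ofReal_mul (by positivity)]
      refine mul_le_mul_right (ENNReal.ofReal_le_ofReal ?_) _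
      rw [kap, if_pos hle]
      have h2 : (2 : ℝ) ^ (2 - ν) ≤ 2 ^ (2 : ℝ) :=
        Real.rpow_le_rpow_of_exponent_le (by norm_num) (by linarith)
      have h3 : (2 : ℝ) ^ (2 : ℝ) = 4 := by norm_num
      rw [h3] at h2
      have h4 : ρ + ρ ^ 2 ≤ 2 * ρ := by nlinarith
      calc (ρ + ρ ^ 2) * 2 ^ (2 - ν) ≤ (2 * ρ) * 4 := by gcongr
        _ = 8 * ρ := by ring
    · have hρpos : 0 < ρ := by linarith
      have hξ : 0 < ‖ξ‖ := by
        by_contra h0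
        have : ‖ξ‖ = 0 := le_antisymm (not_lt.1 h0) (norm_nonneg _)
        rw [hρ, this, zero_div] at hρpos
        exact lt_irrefl _ hρpos
      have h1 : ∫⁻ σ in S, ENNReal.ofReal (‖(dir ξ : V) - σ‖ ^ (-ν)) ∂sphereMeasure ≤
          C * ENNReal.ofReal ((ρ⁻¹) ^ (2 - ν)) := by
        refine le_trans (lintegral_mono_set ?_) (hC (dir ξ) ρ⁻¹ (by positivity))
        intro σ (hσ : ‖ξ‖ * ‖(dir ξ : V) - σ‖ ≤ X)
        simp only [Set.mem_ofPred_eq]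
        rw [hρ, inv_div, le_div_iff₀ hξ, mul_comm]
        exact hσ
      refine (mul_le_mul_right h1 _).trans ?_
      rw [mul_left_comm, ← ENNReal.ofReal_mul (by positivity)]
      refine mul_le_mul_right (ENNReal.ofReal_le_ofReal ?_) _
      rw [kap, if_neg (not_le.2 hgt), Real.inv_rpow hρ0, ← Real.rpow_neg hρ0]
      have h4 : ρ + ρ ^ 2 ≤ 8 * ρ ^ (2 : ℝ) := by norm_num; nlinarith
      calc (ρ + ρ ^ 2) * ρ ^ (-(2 - ν)) ≤ (8 * ρ ^ (2 : ℝ)) * ρ ^ (-(2 - ν)) := by gcongr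
        _ = 8 * ρ ^ ν := by
          rw [mul_assoc, ← Real.rpow_add hρpos]; congr 2; ring
  calc _ ≤ ∫⁻ σ, ‖S.indicator (fun σ => (1 / 2 : ℂ) * (F σ + F (T σ))) σ‖ₑ ∂sphereMeasure :=
        enorm_integral_le_lintegral_enorm _
    _ ≤ ∫⁻ σ, ENNReal.ofReal (A * B * X ^ (-p) * (ρ + ρ ^ 2)) *
        S.indicator (fun σ => ENNReal.ofReal (‖(dir ξ : V) - σ‖ ^ (-ν))) σ ∂sphereMeasure :=
        lintegral_mono hpt
    _ = ENNReal.ofReal (A * B * X ^ (-p)) * (ENNReal.ofReal (ρ + ρ ^ 2) *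
        ∫⁻ σ in S, ENNReal.ofReal (‖(dir ξ : V) - σ‖ ^ (-ν)) ∂sphereMeasure) := by
        rw [lintegral_const_mul' _ _ ENNReal.ofReal_ne_top, lintegral_indicator hSm,
          ENNReal.ofReal_mul (by positivity), mul_assoc]
    _ ≤ ENNReal.ofReal (A * B * X ^ (-p)) * (C * ENNReal.ofReal (8 * kap ν ρ)) := by gcongr
    _ = _ := by
        rw [← ENNReal.ofReal_coe_nnreal, ← ENNReal.ofReal_mul (by positivity),
          ← ENNReal.ofReal_mul (by positivity)]
        congr 1; ring

/-- The total mass of the kernel over the large deviations. -/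
lemma exists_far_mass_bound (hν₀ : 0 < ν) (B : ℝ) (hB : 0 ≤ B) :
    ∃ C : ℝ, 0 ≤ C ∧ ∀ β : ℝ → ℝ, AngularBound ν B β → ∀ (ξ : V) (X : ℝ), 0 < X →
      ∫⁻ σ in {σ : S2 | X < ‖ξ‖ * ‖(dir ξ : V) - σ‖}, ENNReal.ofReal (β (sdot (dir ξ) σ))
        ∂sphereMeasure ≤ ENNReal.ofReal (C * kap ν (‖ξ‖ / X)) := by
  obtain ⟨C, hC⟩ := exists_sphere_far_bound hν₀
  refine ⟨2 * B * C, by positivity, fun β hβ ξ X hX => ?_⟩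
  set ρ := ‖ξ‖ / X with hρ
  have hρ0 : 0 ≤ ρ := by positivity
  -- As d ≤ 2, the region is empty for ρ < 1/2. For ρ ≥ 1/2 the natural bound ρ^ν is at most twice
  -- κ(ρ).
  rcases lt_or_ge ρ (1 / 2) with h | h
  · have hempty : {σ : S2 | X < ‖ξ‖ * ‖(dir ξ : V) - σ‖} = ∅ := by
      refine Set.eq_empty_of_forall_notMem fun σ (hσ : X < ‖ξ‖ * ‖(dir ξ : V) - σ‖) => ?_
      rw [hρ, div_lt_iff₀ hX] at h
      have := norm_sub_sphere_le_two (dir ξ) σ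
      nlinarith [norm_nonneg ξ]
    rw [hempty, Measure.restrict_empty, lintegral_zero_measure]
    exact zero_le
  have hρpos : 0 < ρ := by linarith
  have hξ : 0 < ‖ξ‖ := by
    by_contra h0
    have : ‖ξ‖ = 0 := le_antisymm (not_lt.1 h0) (norm_nonneg _)
    rw [hρ, this, zero_div] at hρpos
    exact lt_irrefl _ hρpos
  calc _ ≤ ∫⁻ σ in {σ : S2 | X < ‖ξ‖ * ‖(dir ξ : V) - σ‖},
        ENNReal.ofReal B * ENNReal.ofReal (‖(dir ξ : V) - σ‖ ^ (-2 - ν)) ∂sphereMeasure := by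
        refine lintegral_mono fun σ => ?_
        rw [← ENNReal.ofReal_mul hB]
        exact ENNReal.ofReal_le_ofReal (hβ.bound _ _)
    _ ≤ ∫⁻ σ in {σ : S2 | ρ⁻¹ ≤ ‖(dir ξ : V) - σ‖},
        ENNReal.ofReal B * ENNReal.ofReal (‖(dir ξ : V) - σ‖ ^ (-2 - ν)) ∂sphereMeasure := by
        refine lintegral_mono_set fun σ (hσ : X < ‖ξ‖ * ‖(dir ξ : V) - σ‖) => ?_
        simp only [Set.mem_ofPred_eq]
        rw [hρ, inv_div, div_le_iff₀ hξ, mul_comm]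
        exact hσ.le
    _ ≤ ENNReal.ofReal B * (C * ENNReal.ofReal (ρ⁻¹ ^ (-ν))) := by
        rw [lintegral_const_mul' _ _ ENNReal.ofReal_ne_top]
        gcongr
        exact hC _ _ (by positivity)
    _ ≤ _ := by
        rw [← ENNReal.ofReal_coe_nnreal, ← ENNReal.ofReal_mul (by positivity),
          ← ENNReal.ofReal_mul (by positivity)]
        refine ENNReal.ofReal_le_ofReal ?_
        have h1 : ρ⁻¹ ^ (-ν) ≤ 2 * kap ν ρ := by
          rw [Real.inv_rpow hρ0, Real.rpow_neg hρ0, inv_inv, kap]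
          split_ifs with h2
          · have := Real.rpow_le_one hρ0 h2 hν₀.le
            linarith
          · have : 0 ≤ ρ ^ ν := by positivity
            linarith
        calc B * (C * ρ⁻¹ ^ (-ν)) ≤ B * (C * (2 * kap ν ρ)) := by gcongr
          _ = _ := by ring

/-- One has ξ_* - ξ⁻ = ξ⁺ - (ξ - ξ_*), and |ξ⁺| ≥ |ξ|/√2 in the forward hemisphere; a comparatively
small ξ - ξ_* cannot bring this vector near 0. Resonance thus forces |ξ| to be dominated by 1 + |ξ -
ξ_*|. -/
lemma half_le_norm_sub_zm {ξ ξs : V} {σ : S2} (hσ : 0 ≤ sdot (dir ξ) σ)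
    (h : 10 * (1 + ‖ξ - ξs‖) < 1 + ‖ξ‖) : (1 + ‖ξs‖) / 2 ≤ 1 + ‖ξs - zm ξ σ‖ := by
  have h1 : (1.4 : ℝ) ≤ ‖(dir ξ : V) + σ‖ := by
    have := norm_add_sq_sphere (dir ξ) σ
    nlinarith [norm_nonneg ((dir ξ : V) + σ)]
  have h2 : 0.7 * ‖ξ‖ ≤ ‖zp ξ σ‖ := by
    rw [norm_zp]
    nlinarith [norm_nonneg ξ]
  have h3 : ξs - zm ξ σ = zp ξ σ - (ξ - ξs) := by
    rw [show zp ξ σ = ξ - zm ξ σ from eq_sub_of_add_eq (zp_add_zm ξ σ)]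
    abel
  have h4 : ‖zp ξ σ‖ - ‖ξ - ξs‖ ≤ ‖ξs - zm ξ σ‖ := by rw [h3]; exact norm_sub_norm_le _ _
  have h5 : ‖ξs‖ ≤ ‖ξ‖ + ‖ξ - ξs‖ := by
    have := norm_sub_le ξ (ξ - ξs)
    rwa [sub_sub_cancel] at this
  have := norm_nonneg (ξ - ξs)
  linarith

/-- The pointwise bound on the multiplier. -/
lemma exists_multiplier_bound (hν₀ : 0 < ν) (hν₂ : ν < 2) (B : ℝ) (hB : 0 ≤ B) (p A : ℝ)
    (hp : 0 ≤ p) (hA : 0 ≤ A) :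
    ∃ C : ℝ, 0 ≤ C ∧ ∀ (Ψ : V → ℂ), Continuous Ψ → SymbolBound Ψ p A → ∀ β : ℝ → ℝ,
      AngularBound ν B β → ∀ ξ ξs : V,
      ‖∫ σ, (β (sdot (dir ξ) σ) : ℂ) * (Ψ (ξs - zm ξ σ) - Ψ ξs) ∂sphereMeasure‖ₑ ≤
      ENNReal.ofReal (C * ((1 + ‖ξs‖) ^ (-p) * kap ν ((1 + ‖ξ‖) / (1 + ‖ξs‖)))) +
        ENNReal.ofReal A * resonantPart β p ξ ξs := by
  obtain ⟨C₁, hC₁, h₁⟩ := exists_near_bound hν₀ hν₂ B hB p A hA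
  obtain ⟨C₂, hC₂, h₂⟩ := exists_far_mass_bound hν₀ B hB
  -- The summands come from the near deviations, from Ψ(ξ_*) at far deviations, and from Ψ(ξ_* - ξ⁻)
  -- at far deviations away from resonance.
  refine ⟨C₁ + A * C₂ + A * (2 ^ p * C₂), by positivity, fun Ψ hΨ hS β hβ ξ ξs => ?_⟩
  set X := 1 + ‖ξs‖ with hX
  have hX0 : 0 < X := by positivity
  have hkap : kap ν (‖ξ‖ / X) ≤ kap ν ((1 + ‖ξ‖) / X) := by
    refine kap_mono hν₀.le (by positivity) ?_
    gcongr
    linarith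
  have hkap0 : 0 ≤ kap ν (‖ξ‖ / X) := kap_nonneg (by positivity)
  set F : S2 → ℂ := fun σ => (β (sdot (dir ξ) σ) : ℂ) * (Ψ (ξs - zm ξ σ) - Ψ ξs) with hF
  set S := {σ : S2 | ‖ξ‖ * ‖(dir ξ : V) - σ‖ ≤ X} with hSdef
  set S' := {σ : S2 | X < ‖ξ‖ * ‖(dir ξ : V) - σ‖} with hS'def
  have hSm : MeasurableSet S :=
    measurableSet_le (measurable_const.mul (measurable_norm_sub_left _)) measurable_const
  have hcompl : Sᶜ = S' := by ext σ; simp [hSdef, hS'def]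
  have hFint : Integrable F sphereMeasure := by
    have hcont : Continuous fun σ : S2 => Ψ (ξs - zm ξ σ) - Ψ ξs :=
      (hΨ.comp (continuous_const.sub (continuous_zm_right ξ))).sub continuous_const
    obtain ⟨N, hN⟩ := (isCompact_univ (X := S2)).exists_bound_of_continuousOn hcont.continuousOn
    exact (hβ.integrable (dir ξ)).mul_bdd (c := N) hcont.aestronglyMeasurable
      (ae_of_all _ fun σ => hN σ (Set.mem_univ _))
  have hmass := h₂ β hβ ξ X hX0
  have hfar1 : ∫⁻ σ in S', ENNReal.ofReal (β (sdot (dir ξ) σ) * (A * X ^ (-p))) ∂sphereMeasure ≤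
      ENNReal.ofReal (A * C₂ * (X ^ (-p) * kap ν (‖ξ‖ / X))) := by
    simp_rw [ENNReal.ofReal_mul (hβ.nonneg _)]
    rw [lintegral_mul_const' _ _ ENNReal.ofReal_ne_top]
    refine (mul_le_mul_left hmass _).trans_eq ?_
    rw [← ENNReal.ofReal_mul (by positivity)]
    congr 1; ring
  have hfar2 : ∫⁻ σ in S', ENNReal.ofReal (β (sdot (dir ξ) σ) * (1 + ‖ξs - zm ξ σ‖) ^ (-p))
      ∂sphereMeasure ≤ ENNReal.ofReal (2 ^ p * C₂ * (X ^ (-p) * kap ν (‖ξ‖ / X))) +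
        resonantPart β p ξ ξs := by
    unfold resonantPart
    split_ifs with hif
    · exact le_add_self
    rw [add_zero]
    have hpt : ∀ σ, ENNReal.ofReal (β (sdot (dir ξ) σ) * (1 + ‖ξs - zm ξ σ‖) ^ (-p)) ≤
        ENNReal.ofReal (β (sdot (dir ξ) σ)) * ENNReal.ofReal (2 ^ p * X ^ (-p)) := by
      intro σ
      rcases lt_or_ge (sdot (dir ξ) σ) 0 with hneg | hpos
      · rw [hβ.eq_zero _ hneg]; simp
      rw [← ENNReal.ofReal_mul (hβ.nonneg _)]
      refine ENNReal.ofReal_le_ofReal (mul_le_mul_of_nonneg_left ?_ (hβ.nonneg _))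
      have h3 := half_le_norm_sub_zm hpos (not_le.1 hif)
      refine (Real.rpow_le_rpow_of_nonpos (by positivity) h3 (by linarith)).trans_eq ?_
      rw [← hX, Real.div_rpow hX0.le (by norm_num), Real.rpow_neg (by norm_num : (0 : ℝ) ≤ 2),
        div_inv_eq_mul, mul_comm]
    refine (lintegral_mono hpt).trans ?_
    rw [lintegral_mul_const' _ _ ENNReal.ofReal_ne_top]
    refine (mul_le_mul_left hmass _).trans_eq ?_
    rw [← ENNReal.ofReal_mul (by positivity)]
    congr 1; ring
  have hfar : ‖∫ σ in S', F σ ∂sphereMeasure‖ₑ ≤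
      ENNReal.ofReal (A * C₂ * (X ^ (-p) * kap ν (‖ξ‖ / X))) + ENNReal.ofReal A *
      (ENNReal.ofReal (2 ^ p * C₂ * (X ^ (-p) * kap ν (‖ξ‖ / X))) + resonantPart β p ξ ξs) := by
    have hm : Measurable fun σ : S2 => ENNReal.ofReal (β (sdot (dir ξ) σ) * (A * X ^ (-p))) :=
      ((hβ.measurable.comp (measurable_sdot_left _)).mul_const _).ennreal_ofReal
    calc ‖∫ σ in S', F σ ∂sphereMeasure‖ₑ ≤ ∫⁻ σ in S', ‖F σ‖ₑ ∂sphereMeasure :=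
          enorm_integral_le_lintegral_enorm _
      _ ≤ ∫⁻ σ in S', (ENNReal.ofReal (β (sdot (dir ξ) σ) * (A * X ^ (-p))) + ENNReal.ofReal A *
          ENNReal.ofReal (β (sdot (dir ξ) σ) * (1 + ‖ξs - zm ξ σ‖) ^ (-p))) ∂sphereMeasure := by
          refine lintegral_mono fun σ => ?_
          rw [← ENNReal.ofReal_mul hA, ← ENNReal.ofReal_add
            (mul_nonneg (hβ.nonneg _) (by positivity))
            (mul_nonneg hA (mul_nonneg (hβ.nonneg _) (by positivity))), ← ofReal_norm]
          refine ENNReal.ofReal_le_ofReal ?_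
          simp only [hF]
          rw [norm_mul, Complex.norm_real, Real.norm_of_nonneg (hβ.nonneg _)]
          have h4 : ‖Ψ (ξs - zm ξ σ) - Ψ ξs‖ ≤
              A * (1 + ‖ξs - zm ξ σ‖) ^ (-p) + A * X ^ (-p) :=
            (norm_sub_le _ _).trans (add_le_add (hS.bound _) (hS.bound _))
          refine (mul_le_mul_of_nonneg_left h4 (hβ.nonneg _)).trans_eq ?_
          ring
      _ ≤ _ := by
          rw [lintegral_add_left hm, lintegral_const_mul' _ _ ENNReal.ofReal_ne_top]
          gcongr
  have hsplit : ∫ σ, F σ ∂sphereMeasure =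
      (∫ σ in S, F σ ∂sphereMeasure) + ∫ σ in S', F σ ∂sphereMeasure := by
    rw [← hcompl, integral_add_compl hSm hFint]
  have hX' : 0 ≤ X ^ (-p) * kap ν (‖ξ‖ / X) := by positivity
  calc ‖∫ σ, F σ ∂sphereMeasure‖ₑ ≤ ‖∫ σ in S, F σ ∂sphereMeasure‖ₑ +
        ‖∫ σ in S', F σ ∂sphereMeasure‖ₑ := by rw [hsplit]; exact enorm_add_le _ _
    _ ≤ ENNReal.ofReal (C₁ * (X ^ (-p) * kap ν (‖ξ‖ / X))) +
      (ENNReal.ofReal (A * C₂ * (X ^ (-p) * kap ν (‖ξ‖ / X))) + ENNReal.ofReal A *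
      (ENNReal.ofReal (2 ^ p * C₂ * (X ^ (-p) * kap ν (‖ξ‖ / X))) + resonantPart β p ξ ξs)) :=
        add_le_add (h₁ Ψ hΨ hS β hβ ξ ξs) hfar
    _ = ENNReal.ofReal ((C₁ + A * C₂ + A * (2 ^ p * C₂)) * (X ^ (-p) * kap ν (‖ξ‖ / X))) +
        ENNReal.ofReal A * resonantPart β p ξ ξs := by
        rw [mul_add, ← ENNReal.ofReal_mul hA, ← add_assoc, ← add_assoc,
          ← ENNReal.ofReal_add (by positivity) (by positivity),
          ← ENNReal.ofReal_add (by positivity) (by positivity)]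
        congr 2; ring
    _ ≤ _ := by gcongr

end Estimate

/-! ### Trilinear estimate for the non-resonant part. -/

/-- Elementary inequality between the three weights attached to a convolution triangle. -/
lemma weight_le {a b s ν X Y Z : ℝ} (hX : 1 ≤ X) (hY : 1 ≤ Y) (hZ : 1 ≤ Z) (ha : 0 ≤ a)
    (hb : 0 ≤ b) (hab : a + b = ν) (hν₂ : ν < 2) (hs : s ≤ b) (hsν : s - ν < -(3 / 2))
    (hXYZ : X ≤ Y + Z) (hYXZ : Y ≤ X + Z) :
    X ^ s * kap ν (Y / X) * Z ^ (-a) * Y ^ (-b) ≤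
      8 * (X ^ (s - ν) + Y ^ (s - ν) + Z ^ (s - ν)) := by
  have hX0 : 0 < X := by linarith
  have hY0 : 0 < Y := by linarith
  have hZ0 : 0 < Z := by linarith
  have pX : 0 ≤ X ^ (s - ν) := by positivity
  have pY : 0 ≤ Y ^ (s - ν) := by positivity
  have pZ : 0 ≤ Z ^ (s - ν) := by positivity
  have four : ∀ t : ℝ, t ≤ 2 → (2 : ℝ) ^ t ≤ 4 := fun t ht => by
    have := Real.rpow_le_rpow_of_exponent_le (by norm_num : (1 : ℝ) ≤ 2) ht
    norm_num at this; exact this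
  have halfpow : ∀ {U W t : ℝ}, 0 < U → 0 < W → 0 ≤ t → t ≤ 2 → U / 2 ≤ W →
      W ^ (-t) ≤ 4 * U ^ (-t) := fun {U W t} hU hW h0 h2 h => by
    calc W ^ (-t) ≤ (U / 2) ^ (-t) :=
          Real.rpow_le_rpow_of_nonpos (by positivity) h (by linarith)
      _ = 2 ^ t * U ^ (-t) := by
          rw [Real.div_rpow hU.le (by norm_num), Real.rpow_neg (by norm_num : (0 : ℝ) ≤ 2),
            div_inv_eq_mul, mul_comm]
      _ ≤ _ := by gcongr; exact four t h2
  -- If Z is small, s ≤ b allows the larger X to be replaced by Z.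
  have small : Z ≤ X → X ^ (s - b) * Z ^ (-a) ≤ Z ^ (s - ν) := fun h => by
    calc X ^ (s - b) * Z ^ (-a) ≤ Z ^ (s - b) * Z ^ (-a) := by
          gcongr ?_ * _
          exact Real.rpow_le_rpow_of_nonpos hZ0 h (by linarith)
      _ = _ := by rw [← Real.rpow_add hZ0]; congr 1; linarith
  unfold kap
  -- The roles are X = 1+|ξ_*|, Y = 1+|ξ|, Z = 1+|ξ-ξ_*|. The cases are the possible orderings up to
  -- factors of 2; in each of them the product collapses to the power s - ν of one variable.
  rcases lt_or_ge X Y with hXY | hXY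
  · have h1 : ¬ Y / X ≤ 1 := by rw [not_le, one_lt_div hX0]; exact hXY
    rw [if_neg h1]
    have e1 : X ^ s * (Y / X) ^ ν * Z ^ (-a) * Y ^ (-b) = X ^ (s - ν) * Y ^ a * Z ^ (-a) := by
      rw [Real.div_rpow hY0.le hX0.le, Real.rpow_sub hX0, show a = ν + -b by linarith,
        Real.rpow_add hY0]
      ring
    rw [e1]
    rcases le_or_gt (Y / 2) Z with h | h
    · have h2 := halfpow hY0 hZ0 ha (by linarith) h
      calc X ^ (s - ν) * Y ^ a * Z ^ (-a) ≤ X ^ (s - ν) * Y ^ a * (4 * Y ^ (-a)) := by gcongr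
        _ = 4 * X ^ (s - ν) * (Y ^ a * Y ^ (-a)) := by ring
        _ = 4 * X ^ (s - ν) := by rw [← Real.rpow_add hY0]; simp
        _ ≤ _ := by linarith
    · have h3 : Y ≤ 2 * X := by linarith
      calc X ^ (s - ν) * Y ^ a * Z ^ (-a) ≤ X ^ (s - ν) * (4 * X ^ a) * Z ^ (-a) := by
            gcongr
            calc Y ^ a ≤ (2 * X) ^ a := by gcongr
              _ = 2 ^ a * X ^ a := Real.mul_rpow (by norm_num) hX0.le
              _ ≤ _ := by gcongr; exact four a (by linarith)
        _ = 4 * ((X ^ (s - ν) * X ^ a) * Z ^ (-a)) := by ring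
        _ = 4 * (X ^ (s - b) * Z ^ (-a)) := by
            rw [← Real.rpow_add hX0]; congr 3; linarith
        _ ≤ 4 * Z ^ (s - ν) := by gcongr; exact small (by linarith)
        _ ≤ _ := by linarith
  · have h1 : Y / X ≤ 1 := by rw [div_le_one hX0]; exact hXY
    rw [if_pos h1]
    have e1 : X ^ s * (Y / X) * Z ^ (-a) * Y ^ (-b) = X ^ (s - 1) * Y ^ (1 - b) * Z ^ (-a) := by
      rw [Real.rpow_sub hX0, sub_eq_add_neg 1 b, Real.rpow_add hY0, Real.rpow_one, Real.rpow_one]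
      ring
    rw [e1]
    rcases le_or_gt (X / 2) Z with h | h
    · have h2 := halfpow hX0 hZ0 ha (by linarith) h
      have h3 : X ^ (s - 1) * Y ^ (1 - b) * Z ^ (-a) ≤ 4 * (X ^ (s - 1 - a) * Y ^ (1 - b)) := by
        calc X ^ (s - 1) * Y ^ (1 - b) * Z ^ (-a) ≤ X ^ (s - 1) * Y ^ (1 - b) * (4 * X ^ (-a)) := by
              gcongr
          _ = 4 * ((X ^ (s - 1) * X ^ (-a)) * Y ^ (1 - b)) := by ring
          _ = _ := by rw [← Real.rpow_add hX0, sub_eq_add_neg (s - 1) a]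
      refine h3.trans ?_
      rcases le_or_gt b 1 with hb1 | hb1
      · calc 4 * (X ^ (s - 1 - a) * Y ^ (1 - b)) ≤ 4 * (X ^ (s - 1 - a) * X ^ (1 - b)) := by
              gcongr
          _ = 4 * X ^ (s - ν) := by rw [← Real.rpow_add hX0]; congr 2; linarith
          _ ≤ _ := by linarith
      · calc 4 * (X ^ (s - 1 - a) * Y ^ (1 - b)) ≤ 4 * (Y ^ (s - 1 - a) * Y ^ (1 - b)) := by
              gcongr ?_ * (?_ * _)
              exact Real.rpow_le_rpow_of_nonpos hY0 hXY (by linarith)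
          _ = 4 * Y ^ (s - ν) := by rw [← Real.rpow_add hY0]; congr 2; linarith
          _ ≤ _ := by linarith
    · have h3 : Y ^ (1 - b) ≤ 4 * X ^ (1 - b) := by
        rcases le_or_gt b 1 with hb1 | hb1
        · calc Y ^ (1 - b) ≤ X ^ (1 - b) := by gcongr
            _ ≤ _ := by have : 0 ≤ X ^ (1 - b) := by positivity
                        linarith
        · have := halfpow (U := X) (W := Y) (t := b - 1) hX0 hY0 (by linarith) (by linarith)
            (by linarith)
          rwa [neg_sub] at this
      calc X ^ (s - 1) * Y ^ (1 - b) * Z ^ (-a) ≤ X ^ (s - 1) * (4 * X ^ (1 - b)) * Z ^ (-a) := by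
            gcongr
        _ = 4 * ((X ^ (s - 1) * X ^ (1 - b)) * Z ^ (-a)) := by ring
        _ = 4 * (X ^ (s - b) * Z ^ (-a)) := by
            rw [← Real.rpow_add hX0]; congr 3; linarith
        _ ≤ 4 * Z ^ (s - ν) := by gcongr; exact small (by linarith)
        _ ≤ _ := by linarith

/-- The `L²` norm of a nonnegative function. -/
noncomputable def nrm {α : Type*} [MeasurableSpace α] (μ : Measure α) (F : α → ℝ≥0∞) : ℝ≥0∞ :=
  (∫⁻ x, F x ^ (2 : ℝ) ∂μ) ^ (1 / 2 : ℝ)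

lemma lintegral_mul_le_nrm {α : Type*} [MeasurableSpace α] (μ : Measure α) {F G : α → ℝ≥0∞}
    (hF : AEMeasurable F μ) (hG : AEMeasurable G μ) :
    ∫⁻ x, F x * G x ∂μ ≤ nrm μ F * nrm μ G :=
  ENNReal.lintegral_mul_le_Lp_mul_Lq μ Real.HolderConjugate.two_two hF hG

section CauchySchwarz

variable {w F G H : V → ℝ≥0∞}

/-- Cauchy–Schwarz with the weighted variable fixed, where the weight is a constant, and then once
more in the weighted variable. The next two lemmas differ only in the variable that carries the
weight. -/
lemma lintegral_triple_fst_le (hw : Measurable w) (hF : Measurable F) (hG : Measurable G)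
    (hH : Measurable H) :
    ∫⁻ q : V × V, w q.2 * (F q.2 * G (q.1 - q.2) * H q.1) ∂(volume.prod volume) ≤
      nrm volume w * (nrm volume F * nrm volume G * nrm volume H) := by
  rw [lintegral_prod_symm _ (by fun_prop)]
  have h1 : ∀ y : V, ∫⁻ x, w y * (F y * G (x - y) * H x) ≤
      (w y * F y) * (nrm volume G * nrm volume H) := fun y => by
    calc ∫⁻ x, w y * (F y * G (x - y) * H x) = (w y * F y) * ∫⁻ x, G (x - y) * H x := by
          rw [← lintegral_const_mul _ (by fun_prop)]
          simp only [mul_assoc]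
      _ ≤ (w y * F y) * (nrm volume (fun x => G (x - y)) * nrm volume H) := by
          gcongr
          exact lintegral_mul_le_nrm _ (by fun_prop) (by fun_prop)
      _ = _ := by
          have : nrm volume (fun x => G (x - y)) = nrm volume G := by
            unfold nrm
            rw [lintegral_sub_right_eq_self (fun x => G x ^ (2 : ℝ)) y]
          rw [this]
  refine (lintegral_mono h1).trans ?_
  rw [lintegral_mul_const _ (by fun_prop)]
  refine (mul_le_mul_left (lintegral_mul_le_nrm _ hw.aemeasurable hF.aemeasurable) _).trans_eq ?_
  ring

lemma lintegral_triple_snd_le (hw : Measurable w) (hF : Measurable F) (hG : Measurable G)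
    (hH : Measurable H) :
    ∫⁻ q : V × V, w q.1 * (F q.2 * G (q.1 - q.2) * H q.1) ∂(volume.prod volume) ≤
      nrm volume w * (nrm volume F * nrm volume G * nrm volume H) := by
  rw [lintegral_prod _ (by fun_prop)]
  have h1 : ∀ x : V, ∫⁻ y, w x * (F y * G (x - y) * H x) ≤
      (w x * H x) * (nrm volume F * nrm volume G) := fun x => by
    calc ∫⁻ y, w x * (F y * G (x - y) * H x) = (w x * H x) * ∫⁻ y, F y * G (x - y) := by
          rw [← lintegral_const_mul _ (by fun_prop)]
          congr 1; ext y; ring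
      _ ≤ (w x * H x) * (nrm volume F * nrm volume (fun y => G (x - y))) := by
          gcongr
          exact lintegral_mul_le_nrm _ (by fun_prop) (by fun_prop)
      _ = _ := by
          have : nrm volume (fun y => G (x - y)) = nrm volume G := by
            unfold nrm
            rw [lintegral_sub_left_eq_self (fun x => G x ^ (2 : ℝ)) x]
          rw [this]
  refine (lintegral_mono h1).trans ?_
  rw [lintegral_mul_const _ (by fun_prop)]
  refine (mul_le_mul_left (lintegral_mul_le_nrm _ hw.aemeasurable hH.aemeasurable) _).trans_eq ?_
  ring

lemma lintegral_triple_sub_le (hw : Measurable w) (hF : Measurable F) (hG : Measurable G)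
    (hH : Measurable H) :
    ∫⁻ q : V × V, w (q.1 - q.2) * (F q.2 * G (q.1 - q.2) * H q.1) ∂(volume.prod volume) ≤
      nrm volume w * (nrm volume F * nrm volume G * nrm volume H) := by
  rw [lintegral_prod_symm _ (by fun_prop)]
  have h0 : ∀ y : V, ∫⁻ x, w (x - y) * (F y * G (x - y) * H x) =
      ∫⁻ x, w x * (F y * G x * H (x + y)) := fun y => by
    have := lintegral_sub_right_eq_self (μ := volume) (fun x => w x * (F y * G x * H (x + y))) y
    simpa only [sub_add_cancel] using this
  simp only [h0]
  rw [lintegral_lintegral_swap (by fun_prop)]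
  have h1 : ∀ x : V, ∫⁻ y, w x * (F y * G x * H (x + y)) ≤
      (w x * G x) * (nrm volume F * nrm volume H) := fun x => by
    calc ∫⁻ y, w x * (F y * G x * H (x + y)) = (w x * G x) * ∫⁻ y, F y * H (x + y) := by
          rw [← lintegral_const_mul _ (by fun_prop)]
          congr 1; ext y; ring
      _ ≤ (w x * G x) * (nrm volume F * nrm volume (fun y => H (x + y))) := by
          gcongr
          exact lintegral_mul_le_nrm _ (by fun_prop) (by fun_prop)
      _ = _ := by
          have : nrm volume (fun y => H (x + y)) = nrm volume H := by
            unfold nrm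
            rw [lintegral_add_left_eq_self (fun x => H x ^ (2 : ℝ)) x]
          rw [this]
  refine (lintegral_mono h1).trans ?_
  rw [lintegral_mul_const _ (by fun_prop)]
  refine (mul_le_mul_left (lintegral_mul_le_nrm _ hw.aemeasurable hG.aemeasurable) _).trans_eq ?_
  ring

end CauchySchwarz

/-- In dimension three, -3/2 is the threshold for square integrability at infinity. -/
lemma nrm_weight_lt_top {e : ℝ} (he : e < -(3 / 2)) :
    nrm volume (fun x : V => ENNReal.ofReal ((1 + ‖x‖) ^ e)) < ∞ := by
  unfold nrm
  refine ENNReal.rpow_lt_top_of_nonneg (by norm_num) (ne_of_lt ?_)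
  have h := finite_integral_one_add_norm (E := V) (μ := volume) (r := -(2 * e))
    (by simp; linarith)
  refine lt_of_eq_of_lt (lintegral_congr fun x => ?_) h
  rw [ENNReal.ofReal_rpow_of_nonneg (by positivity) (by norm_num), ← Real.rpow_mul (by positivity)]
  congr 2; ring

/-- The trilinear estimate for the non-resonant part of the multiplier. -/
lemma exists_nonresonant_bound {a b s ν : ℝ} (ha : 0 ≤ a) (hb : 0 ≤ b) (hab : a + b = ν)
    (hν₂ : ν < 2) (hs : s ≤ b) (hsν : s - ν < -(3 / 2)) :
    ∃ C : ℝ≥0, ∀ F G H : V → ℝ≥0∞, Measurable F → Measurable G → Measurable H →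
      ∫⁻ q : V × V, ENNReal.ofReal ((1 + ‖q.2‖) ^ s * kap ν ((1 + ‖q.1‖) / (1 + ‖q.2‖)) *
        (1 + ‖q.1 - q.2‖) ^ (-a) * (1 + ‖q.1‖) ^ (-b)) * (F q.2 * G (q.1 - q.2) * H q.1)
        ∂(volume.prod volume) ≤ C * (nrm volume F * nrm volume G * nrm volume H) := by
  set w : V → ℝ≥0∞ := fun x => ENNReal.ofReal ((1 + ‖x‖) ^ (s - ν)) with hw
  have hwm : Measurable w := by fun_prop
  have hwt : nrm volume w < ∞ := nrm_weight_lt_top hsν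
  lift nrm volume w to ℝ≥0 using hwt.ne with N hN
  refine ⟨8 * (N + N + N), fun F G H hF hG hH => ?_⟩
  calc _ ≤ ∫⁻ q : V × V, 8 * (w q.2 * (F q.2 * G (q.1 - q.2) * H q.1) +
        w q.1 * (F q.2 * G (q.1 - q.2) * H q.1) +
        w (q.1 - q.2) * (F q.2 * G (q.1 - q.2) * H q.1)) ∂(volume.prod volume) := by
        refine lintegral_mono fun q => ?_
        rw [← add_mul, ← add_mul, ← mul_assoc (8 : ℝ≥0∞)]
        refine mul_le_mul_left ?_ _
        rw [hw]
        simp only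
        rw [← ENNReal.ofReal_add (by positivity) (by positivity),
          ← ENNReal.ofReal_add (by positivity) (by positivity),
          show (8 : ℝ≥0∞) = ENNReal.ofReal 8 by simp, ← ENNReal.ofReal_mul (by norm_num)]
        refine ENNReal.ofReal_le_ofReal (weight_le ?_ ?_ ?_ ha hb hab hν₂ hs hsν ?_ ?_)
        · linarith [norm_nonneg q.2]
        · linarith [norm_nonneg q.1]
        · linarith [norm_nonneg (q.1 - q.2)]
        · have := norm_sub_le q.1 (q.1 - q.2)
          rw [sub_sub_cancel] at this
          linarith
        · have := norm_add_le q.2 (q.1 - q.2)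
          rw [add_sub_cancel] at this
          linarith
    _ ≤ 8 * (nrm volume w * (nrm volume F * nrm volume G * nrm volume H) +
        nrm volume w * (nrm volume F * nrm volume G * nrm volume H) +
        nrm volume w * (nrm volume F * nrm volume G * nrm volume H)) := by
        rw [lintegral_const_mul _ (by fun_prop), lintegral_add_left (by fun_prop),
          lintegral_add_left (by fun_prop)]
        gcongr
        · exact lintegral_triple_fst_le hwm hF hG hH
        · exact lintegral_triple_snd_le hwm hF hG hH
        · exact lintegral_triple_sub_le hwm hF hG hH
    _ = _ := by rw [← hN]; push_cast; ring

/-! ### The change of variables ξ ↦ ξ⁺. -/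

lemma hasFDerivAt_norm_dir {x : V} (hx : x ≠ 0) :
    HasFDerivAt (fun y : V => ‖y‖) (innerSL ℝ (dir x : V)) x := by
  have h1 := (hasStrictFDerivAt_norm_sq x).hasFDerivAt.sqrt (by positivity)
  simp only [Real.sqrt_sq (norm_nonneg _)] at h1
  have h2 : (1 / (2 * ‖x‖)) • (2 : ℕ) • innerSL ℝ x = innerSL ℝ (dir x : V) := by
    have hx0 : ‖x‖ ≠ 0 := norm_ne_zero_iff.2 hx
    ext v
    simp [coe_dir_of_ne hx]
    field_simp
  rw [← h2]
  exact h1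

/-- The derivative of `ξ ↦ ξ⁺`. -/
noncomputable def zpDeriv (σ : S2) (x : V) : V →L[ℝ] V :=
  (1 / 2 : ℝ) • (ContinuousLinearMap.id ℝ V + (innerSL ℝ (dir x : V)).smulRight (σ : V))

lemma hasFDerivAt_zp {x : V} (hx : x ≠ 0) (σ : S2) :
    HasFDerivAt (fun y => zp y σ) (zpDeriv σ x) x :=
  ((hasFDerivAt_id x).add ((hasFDerivAt_norm_dir hx).smul_const (σ : V))).const_smul (1 / 2 : ℝ)

/-- The derivative is half of a rank-one perturbation of the identity. Its determinant is at least
1/8 on the forward half-space. -/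
lemma det_zpDeriv (σ : S2) (x : V) : (zpDeriv σ x).det = (1 + sdot (dir x) σ) / 8 := by
  have h : ((zpDeriv σ x : V →L[ℝ] V) : V →ₗ[ℝ] V) =
      (1 / 2 : ℝ) • LinearMap.transvection (innerₗ V (dir x : V)) (σ : V) := by
    ext v
    simp [zpDeriv, LinearMap.transvection.apply]
  rw [ContinuousLinearMap.det, h, LinearMap.det_smul, LinearMap.transvection.det]
  simp [sdot]
  ring

/-- The half space on which `ξ ↦ ξ⁺` is used as a change of variables. -/
def forwardSet (σ : S2) : Set V := {x | x ≠ 0 ∧ 0 ≤ sdot (dir x) σ}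

lemma measurableSet_forwardSet (σ : S2) : MeasurableSet (forwardSet σ) := by
  have h : Measurable fun x : V => sdot (dir x) σ := by
    have := measurable_sdot_dir.comp (measurable_prodMk_right (y := σ) (α := V))
    simpa only [Function.comp_def] using this
  exact (measurableSet_singleton (0 : V)).compl.inter (measurableSet_le measurable_const h)

/-- Two points with the same image satisfy y = x + tσ with t = |x| - |y|. Comparing |y|² with |x +
tσ|² gives t (x·σ + |x|) = 0, and the second factor is positive on the forward half-space. -/
lemma injOn_zp (σ : S2) : Set.InjOn (fun x => zp x σ) (forwardSet σ) := by
  intro x hx y hy hxy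
  have hpos : 0 ≤ inner ℝ x (σ : V) := by
    have h1 : inner ℝ x (σ : V) = ‖x‖ * sdot (dir x) σ := by
      rw [sdot, ← real_inner_smul_left, norm_smul_dir]
    rw [h1]
    exact mul_nonneg (norm_nonneg _) hx.2
  have hxy' : (1 / 2 : ℝ) • (x + ‖x‖ • (σ : V)) = (1 / 2 : ℝ) • (y + ‖y‖ • (σ : V)) := hxy
  have h2 := smul_right_injective V (by norm_num : (1 / 2 : ℝ) ≠ 0) hxy'
  set t := ‖x‖ - ‖y‖ with ht
  have h3 : y = x + t • (σ : V) := by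
    rw [ht, sub_smul, add_sub, h2]; abel
  have h4 : ‖y‖ ^ 2 = ‖x‖ ^ 2 + 2 * (t * inner ℝ x (σ : V)) + t ^ 2 := by
    rw [h3, norm_add_sq_real, real_inner_smul_right, norm_smul, norm_coe_sphere, mul_one,
      Real.norm_eq_abs, sq_abs]
  have h5 : ‖y‖ = ‖x‖ - t := by rw [ht]; ring
  have hx0 : 0 < ‖x‖ := norm_pos_iff.2 hx.1
  have h6 : t * (inner ℝ x (σ : V) + ‖x‖) = 0 := by rw [h5] at h4; linarith
  have h7 : t = 0 := (mul_eq_zero.1 h6).resolve_right (by positivity)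
  rw [h3, h7, zero_smul, add_zero]

/-- The change of variables `ξ ↦ ξ⁺`. -/
lemma setLIntegral_comp_zp_le (σ : S2) (Θ : V → ℝ≥0∞) :
    ∫⁻ x in forwardSet σ, Θ (zp x σ) ≤ 8 * ∫⁻ y, Θ y := by
  have h := lintegral_image_eq_lintegral_abs_det_fderiv_mul (μ := (volume : Measure V))
    (measurableSet_forwardSet σ) (f := fun x => zp x σ) (f' := zpDeriv σ)
    (fun x hx => (hasFDerivAt_zp hx.1 σ).hasFDerivWithinAt) (injOn_zp σ) Θ
  calc ∫⁻ x in forwardSet σ, Θ (zp x σ)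
      ≤ ∫⁻ x in forwardSet σ, 8 * (ENNReal.ofReal |(zpDeriv σ x).det| * Θ (zp x σ)) := by
        refine setLIntegral_mono' (measurableSet_forwardSet σ) fun x hx => ?_
        rw [← mul_assoc, show (8 : ℝ≥0∞) = ENNReal.ofReal 8 by simp,
          ← ENNReal.ofReal_mul (by norm_num)]
        refine le_mul_of_one_le_left zero_le ?_
        rw [ENNReal.one_le_ofReal, det_zpDeriv, abs_of_nonneg (by linarith [hx.2])]
        linarith [hx.2]
    _ = 8 * ∫⁻ x in forwardSet σ, ENNReal.ofReal |(zpDeriv σ x).det| * Θ (zp x σ) :=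
        lintegral_const_mul' _ _ (by norm_num)
    _ ≤ _ := by
        rw [← h]
        gcongr
        exact Measure.restrict_le_self

/-- Half-angle comparison. -/
lemma norm_dir_zp {x : V} {σ : S2} (hx : x ∈ forwardSet σ) :
    ‖(dir (zp x σ) : V) - σ‖ ≤ ‖(dir x : V) - σ‖ ∧
      ‖(dir x : V) - σ‖ ≤ 2 * ‖(dir (zp x σ) : V) - σ‖ ∧
      ‖zp x σ‖ ≤ ‖x‖ ∧ ‖x‖ ≤ 2 * ‖zp x σ‖ := by
  -- If θ is the angle between x and σ, then n = 2 cos(θ/2): the vector x⁺ has length |x| cos(θ/2)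
  -- and makes the angle θ/2 with σ.
  set n := ‖(dir x : V) + σ‖ with hn
  have hn0 : 0 ≤ n := norm_nonneg _
  have hn2 : n ^ 2 = 2 + 2 * sdot (dir x) σ := norm_add_sq_sphere _ _
  have ht0 := hx.2
  have ht1 := sdot_le_one (dir x) σ
  have hn1 : 1 ≤ n := by nlinarith
  have hnle : n ≤ 2 := by nlinarith
  have hx0 : 0 < ‖x‖ := norm_pos_iff.2 hx.1
  have hz : ‖zp x σ‖ = ‖x‖ / 2 * n := norm_zp x σ
  have hzne : zp x σ ≠ 0 := by
    rw [← norm_ne_zero_iff, hz]; positivity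
  have hsd : sdot (dir (zp x σ)) σ = n / 2 := by
    rw [sdot, coe_dir_of_ne hzne, hz, zp_eq, smul_smul, real_inner_smul_left, inner_add_left,
      real_inner_self_eq_norm_sq, norm_coe_sphere]
    change _ * (sdot (dir x) σ + 1 ^ 2) = _
    rw [show sdot (dir x) σ = n ^ 2 / 2 - 1 by linarith]
    field_simp
    ring
  have hd : ‖(dir x : V) - σ‖ ^ 2 = (2 - n) * (2 + n) := by
    rw [norm_sub_sq_sphere]; nlinarith
  have hd' : ‖(dir (zp x σ) : V) - σ‖ ^ 2 = 2 - n := by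
    rw [norm_sub_sq_sphere, hsd]; ring
  refine ⟨?_, ?_, ?_, ?_⟩
  · refine (sq_le_sq₀ (norm_nonneg _) (norm_nonneg _)).1 ?_
    rw [hd, hd']; nlinarith
  · refine (sq_le_sq₀ (norm_nonneg _) (by positivity)).1 ?_
    rw [mul_pow, hd, hd']; nlinarith
  · rw [hz]; nlinarith
  · rw [hz]; nlinarith

/-! ### Trilinear estimate for the resonant part. -/

open Classical in
/-- The angular singularity, away from the deviations smaller than `δ / (1 + |ξ|)`. -/
noncomputable def farKernel (ν δ : ℝ) (ξ : V) (σ : S2) : ℝ≥0∞ :=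
  if δ ≤ (1 + ‖ξ‖) * ‖(dir ξ : V) - σ‖ then ENNReal.ofReal (‖(dir ξ : V) - σ‖ ^ (-2 - ν)) else 0

lemma farKernel_of_le {ν δ : ℝ} {ξ : V} {σ : S2} (h : δ ≤ (1 + ‖ξ‖) * ‖(dir ξ : V) - σ‖) :
    farKernel ν δ ξ σ = ENNReal.ofReal (‖(dir ξ : V) - σ‖ ^ (-2 - ν)) := if_pos h

lemma farKernel_of_not_le {ν δ : ℝ} {ξ : V} {σ : S2}
    (h : ¬ δ ≤ (1 + ‖ξ‖) * ‖(dir ξ : V) - σ‖) : farKernel ν δ ξ σ = 0 := if_neg h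

lemma measurable_farKernel (ν δ : ℝ) : Measurable fun p : V × S2 => farKernel ν δ p.1 p.2 := by
  have h := measurable_norm_dir_sub
  exact Measurable.ite (measurableSet_le measurable_const (by fun_prop)) (by fun_prop)
    measurable_const

attribute [irreducible] farKernel

lemma exists_farKernel_bound {ν : ℝ} (hν : 0 < ν) : ∃ C : ℝ≥0, ∀ δ : ℝ, 0 < δ → ∀ ξ : V,
    ∫⁻ σ, farKernel ν δ ξ σ ∂sphereMeasure ≤
      C * ENNReal.ofReal (δ ^ (-ν)) * ENNReal.ofReal ((1 + ‖ξ‖) ^ ν) := by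
  obtain ⟨C, hC⟩ := exists_sphere_far_bound hν
  refine ⟨C, fun δ hδ ξ => ?_⟩
  have hY : 0 < 1 + ‖ξ‖ := by positivity
  set S := {σ : S2 | δ / (1 + ‖ξ‖) ≤ ‖(dir ξ : V) - σ‖} with hS
  have hm : MeasurableSet S := measurableSet_le measurable_const (measurable_norm_sub_left _)
  have hiff : ∀ σ, σ ∈ S ↔ δ ≤ (1 + ‖ξ‖) * ‖(dir ξ : V) - σ‖ := fun σ => div_le_iff₀' hY
  calc ∫⁻ σ, farKernel ν δ ξ σ ∂sphereMeasure
      = ∫⁻ σ, S.indicator (fun σ => ENNReal.ofReal (‖(dir ξ : V) - σ‖ ^ (-2 - ν))) σ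
        ∂sphereMeasure := by
        refine lintegral_congr fun σ => ?_
        by_cases h : σ ∈ S
        · rw [farKernel_of_le ((hiff σ).1 h), Set.indicator_of_mem h]
        · rw [farKernel_of_not_le (fun h' => h ((hiff σ).2 h')), Set.indicator_of_notMem h]
    _ ≤ C * ENNReal.ofReal ((δ / (1 + ‖ξ‖)) ^ (-ν)) := by
        rw [lintegral_indicator hm]
        exact hC _ _ (by positivity)
    _ = _ := by
        rw [mul_assoc, ← ENNReal.ofReal_mul (by positivity), Real.div_rpow hδ.le hY.le,
          Real.rpow_neg hY.le, div_inv_eq_mul]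

open Classical in
/-- The weighted angular kernel on the forward directions. -/
noncomputable def fwdKernel (ν δ : ℝ) (ξ : V) (σ : S2) : ℝ≥0∞ :=
  if ξ ≠ 0 ∧ 0 ≤ sdot (dir ξ) σ then ENNReal.ofReal ((1 + ‖ξ‖) ^ (-ν)) * farKernel ν δ ξ σ else 0

lemma measurable_fwdKernel (ν δ : ℝ) : Measurable fun p : V × S2 => fwdKernel ν δ p.1 p.2 := by
  have h := measurable_farKernel ν δ
  exact Measurable.ite ((measurable_fst (measurableSet_singleton (0 : V)).compl).inter
    (measurableSet_le measurable_const measurable_sdot_dir)) (by fun_prop) measurable_const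

lemma fwdKernel_of_mem {ν δ : ℝ} {ξ : V} {σ : S2} (h : ξ ∈ forwardSet σ) :
    fwdKernel ν δ ξ σ = ENNReal.ofReal ((1 + ‖ξ‖) ^ (-ν)) * farKernel ν δ ξ σ := if_pos h

lemma fwdKernel_of_notMem {ν δ : ℝ} {ξ : V} {σ : S2} (h : ξ ∉ forwardSet σ) :
    fwdKernel ν δ ξ σ = 0 := if_neg h

lemma fwdKernel_le (ν δ : ℝ) (ξ : V) (σ : S2) :
    fwdKernel ν δ ξ σ ≤ ENNReal.ofReal ((1 + ‖ξ‖) ^ (-ν)) * farKernel ν δ ξ σ := by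
  unfold fwdKernel
  split_ifs
  · exact le_rfl
  · exact zero_le

attribute [irreducible] fwdKernel

lemma ofReal_rpow_neg_mul_rpow (ν : ℝ) (ξ : V) :
    ENNReal.ofReal ((1 + ‖ξ‖) ^ (-ν)) * ENNReal.ofReal ((1 + ‖ξ‖) ^ ν) = 1 := by
  rw [← ENNReal.ofReal_mul (by positivity), ← Real.rpow_add (by positivity)]
  simp

/-- The factor (1+|ξ|)^(-ν), eventually supplied by the Sobolev weights, exactly compensates the
angular mass, so the bound is uniform in ξ. -/
lemma exists_fwdKernel_bound {ν : ℝ} (hν : 0 < ν) : ∃ C : ℝ≥0, ∀ δ : ℝ, 0 < δ → ∀ ξ : V,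
    ∫⁻ σ, fwdKernel ν δ ξ σ ∂sphereMeasure ≤ C * ENNReal.ofReal (δ ^ (-ν)) := by
  obtain ⟨C, hC⟩ := exists_farKernel_bound hν
  refine ⟨C, fun δ hδ ξ => ?_⟩
  calc ∫⁻ σ, fwdKernel ν δ ξ σ ∂sphereMeasure
      ≤ ∫⁻ σ, ENNReal.ofReal ((1 + ‖ξ‖) ^ (-ν)) * farKernel ν δ ξ σ ∂sphereMeasure :=
        lintegral_mono fun σ => fwdKernel_le ν δ ξ σ
    _ ≤ ENNReal.ofReal ((1 + ‖ξ‖) ^ (-ν)) *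
        (C * ENNReal.ofReal (δ ^ (-ν)) * ENNReal.ofReal ((1 + ‖ξ‖) ^ ν)) := by
        rw [lintegral_const_mul' _ _ ENNReal.ofReal_ne_top]
        gcongr
        exact hC δ hδ ξ
    _ = C * ENNReal.ofReal (δ ^ (-ν)) *
        (ENNReal.ofReal ((1 + ‖ξ‖) ^ (-ν)) * ENNReal.ofReal ((1 + ‖ξ‖) ^ ν)) := by ring
    _ = _ := by rw [ofReal_rpow_neg_mul_rpow, mul_one]

/-- Integration of the kernel in `ξ` and `σ` after the change of variables `ξ ↦ ξ⁺`. -/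
lemma exists_fwdKernel_zp_bound {ν : ℝ} (hν : 0 < ν) : ∃ C : ℝ≥0, ∀ δ : ℝ, 0 < δ →
    ∀ Θ : V → ℝ≥0∞, Measurable Θ →
    ∫⁻ σ, (∫⁻ ξ, fwdKernel ν δ ξ σ * Θ (zp ξ σ)) ∂sphereMeasure ≤
      C * ENNReal.ofReal (δ ^ (-ν)) * ∫⁻ η, Θ η := by
  obtain ⟨C, hC⟩ := exists_farKernel_bound hν
  refine ⟨8 * (C * Real.toNNReal (4 ^ ν)), fun δ hδ Θ hΘ => ?_⟩
  -- Passing from ξ to ξ⁺ shrinks both the length and the deviation by a factor of at most 2, so the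
  -- threshold δ drops to δ/4. With η = ξ⁺ as variable the σ-integral can be done first at fixed η.
  set Θ' : S2 → V → ℝ≥0∞ := fun σ η =>
    ENNReal.ofReal ((1 + ‖η‖) ^ (-ν)) * farKernel ν (δ / 4) η σ * Θ η with hΘ'
  have hfar := measurable_farKernel ν (δ / 4)
  have hfar' : Measurable fun p : S2 × V => farKernel ν (δ / 4) p.2 p.1 :=
    hfar.comp measurable_swap
  have hpt : ∀ σ : S2, ∀ ξ ∈ forwardSet σ,
      ENNReal.ofReal ((1 + ‖ξ‖) ^ (-ν)) * farKernel ν δ ξ σ * Θ (zp ξ σ) ≤ Θ' σ (zp ξ σ) := by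
    intro σ ξ hξ
    obtain ⟨h1, h2, h3, h4⟩ := norm_dir_zp hξ
    refine mul_le_mul_left (mul_le_mul ?_ ?_ zero_le zero_le) _
    · refine ENNReal.ofReal_le_ofReal (Real.rpow_le_rpow_of_nonpos (by positivity) ?_ (by linarith))
      linarith
    · by_cases h : δ ≤ (1 + ‖ξ‖) * ‖(dir ξ : V) - σ‖
      swap
      · rw [farKernel_of_not_le h]; exact zero_le
      have h5 : δ / 4 ≤ (1 + ‖zp ξ σ‖) * ‖(dir (zp ξ σ) : V) - σ‖ := by
        have : (1 + ‖ξ‖) * ‖(dir ξ : V) - σ‖ ≤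
            (2 * (1 + ‖zp ξ σ‖)) * (2 * ‖(dir (zp ξ σ) : V) - σ‖) := by
          gcongr
          linarith
        linarith
      rw [farKernel_of_le h, farKernel_of_le h5]
      refine ENNReal.ofReal_le_ofReal (Real.rpow_le_rpow_of_nonpos ?_ h1 (by linarith))
      by_contra hneg
      have h6 : ‖(dir (zp ξ σ) : V) - σ‖ = 0 := le_antisymm (not_lt.1 hneg) (norm_nonneg _)
      rw [h6, mul_zero] at h5
      linarith
  calc ∫⁻ σ, (∫⁻ ξ, fwdKernel ν δ ξ σ * Θ (zp ξ σ)) ∂sphereMeasure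
      ≤ ∫⁻ σ, 8 * (∫⁻ η, Θ' σ η) ∂sphereMeasure := by
        refine lintegral_mono fun σ => ?_
        refine le_trans ?_ (setLIntegral_comp_zp_le σ (Θ' σ))
        rw [← lintegral_indicator (measurableSet_forwardSet σ)]
        refine lintegral_mono fun ξ => ?_
        by_cases h : ξ ∈ forwardSet σ
        · rw [fwdKernel_of_mem h, Set.indicator_of_mem h]
          exact hpt σ ξ h
        · rw [fwdKernel_of_notMem h, Set.indicator_of_notMem h, zero_mul]
    _ = 8 * ∫⁻ η, ∫⁻ σ, Θ' σ η ∂sphereMeasure := by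
        rw [lintegral_const_mul' _ _ (by norm_num), lintegral_lintegral_swap]
        simp only [hΘ', Function.uncurry_def]
        fun_prop
    _ ≤ 8 * ∫⁻ η, (C * ENNReal.ofReal ((δ / 4) ^ (-ν))) * Θ η := by
        gcongr with η
        calc ∫⁻ σ, Θ' σ η ∂sphereMeasure = (ENNReal.ofReal ((1 + ‖η‖) ^ (-ν)) *
              ∫⁻ σ, farKernel ν (δ / 4) η σ ∂sphereMeasure) * Θ η := by
              have h1 : Measurable fun σ => farKernel ν (δ / 4) η σ :=
                hfar.comp (measurable_const.prodMk measurable_id)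
              simp only [hΘ']
              rw [lintegral_mul_const _ (by fun_prop), lintegral_const_mul _ h1]
          _ ≤ (ENNReal.ofReal ((1 + ‖η‖) ^ (-ν)) * (C * ENNReal.ofReal ((δ / 4) ^ (-ν)) *
              ENNReal.ofReal ((1 + ‖η‖) ^ ν))) * Θ η := by
              gcongr
              exact hC _ (by positivity) η
          _ = C * ENNReal.ofReal ((δ / 4) ^ (-ν)) * (ENNReal.ofReal ((1 + ‖η‖) ^ (-ν)) *
              ENNReal.ofReal ((1 + ‖η‖) ^ ν)) * Θ η := by ring
          _ = _ := by rw [ofReal_rpow_neg_mul_rpow, mul_one]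
    _ = _ := by
        rw [lintegral_const_mul _ hΘ, Real.div_rpow hδ.le (by norm_num),
          Real.rpow_neg (by norm_num : (0 : ℝ) ≤ 4), div_inv_eq_mul,
          ENNReal.ofReal_mul (by positivity)]
        push_cast
        simp only [ENNReal.ofReal]
        ring

lemma lintegral_weight_mul_le {α : Type*} [MeasurableSpace α] (μ : Measure α)
    {W A B : α → ℝ≥0∞} (hW : Measurable W) (hA : Measurable A) (hB : Measurable B) :
    ∫⁻ x, W x * (A x * B x) ∂μ ≤ (∫⁻ x, W x * A x ^ (2 : ℝ) ∂μ) ^ (1 / 2 : ℝ) *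
      (∫⁻ x, W x * B x ^ (2 : ℝ) ∂μ) ^ (1 / 2 : ℝ) := by
  have hsq : ∀ x, (W x ^ (1 / 2 : ℝ)) ^ (2 : ℝ) = W x := fun x => by
    rw [← ENNReal.rpow_mul]; norm_num
  have hmul : ∀ x, W x ^ (1 / 2 : ℝ) * W x ^ (1 / 2 : ℝ) = W x := fun x => by
    rw [← ENNReal.rpow_add_of_nonneg _ _ (by norm_num) (by norm_num)]; norm_num
  have h := lintegral_mul_le_nrm μ (F := fun x => W x ^ (1 / 2 : ℝ) * A x)
    (G := fun x => W x ^ (1 / 2 : ℝ) * B x) (by fun_prop) (by fun_prop)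
  simp only [nrm, ENNReal.mul_rpow_of_nonneg _ _ (by norm_num : (0 : ℝ) ≤ 2), hsq] at h
  refine le_of_eq_of_le (lintegral_congr fun x => ?_) h
  rw [mul_mul_mul_comm, hmul]

/-- The indicator of the shell around `ξ⁻`. -/
noncomputable def shellInd (U : ℝ) (ξ : V) (σ : S2) (ξs : V) : ℝ≥0∞ :=
  {p : V × S2 × V | ‖p.2.2 - zm p.1 p.2.1‖ < U}.indicator 1 (ξ, σ, ξs)

lemma shellInd_eq (U : ℝ) (ξ : V) (σ : S2) (ξs : V) :
    shellInd U ξ σ ξs = (Metric.ball (zm ξ σ) U).indicator 1 ξs := by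
  unfold shellInd
  by_cases h : ‖ξs - zm ξ σ‖ < U
  · rw [Set.indicator_of_mem (by exact h), Set.indicator_of_mem (by rwa [mem_ball_iff_norm])]
    rfl
  · rw [Set.indicator_of_notMem (by exact h),
      Set.indicator_of_notMem (by rwa [mem_ball_iff_norm])]

/-- Because ξ = ξ⁺ + ξ⁻, the shell condition at fixed ζ = ξ - ξ_* constrains ξ⁺ alone. This is the
reason for taking ξ⁺ as a variable. -/
lemma shellInd_sub (U : ℝ) (ξ : V) (σ : S2) (ζ : V) :
    shellInd U ξ σ (ξ - ζ) = (Metric.ball ζ U).indicator 1 (zp ξ σ) := by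
  rw [shellInd_eq]
  have hiff : ξ - ζ ∈ Metric.ball (zm ξ σ) U ↔ zp ξ σ ∈ Metric.ball ζ U := by
    rw [mem_ball_iff_norm, mem_ball_iff_norm,
      show zp ξ σ = ξ - zm ξ σ from eq_sub_of_add_eq (zp_add_zm ξ σ), sub_right_comm]
  by_cases h : zp ξ σ ∈ Metric.ball ζ U
  · rw [Set.indicator_of_mem h, Set.indicator_of_mem (hiff.2 h)]; rfl
  · rw [Set.indicator_of_notMem h, Set.indicator_of_notMem (fun h' => h (hiff.1 h'))]

lemma measurable_shellInd (U : ℝ) :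
    Measurable fun p : V × S2 × V => shellInd U p.1 p.2.1 p.2.2 := by
  refine measurable_one.indicator (measurableSet_lt ?_ measurable_const)
  have h1 : Continuous fun p : V × S2 × V => zm p.1 p.2.1 := by unfold zm; fun_prop
  exact (continuous_snd.snd.sub h1).norm.measurable

attribute [irreducible] shellInd

lemma lintegral_prod_prod {f : V × S2 × V → ℝ≥0∞} (hf : Measurable f) :
    ∫⁻ p, f p ∂(volume.prod (sphereMeasure.prod volume)) =
      ∫⁻ x, ∫⁻ σ, (∫⁻ y, f (x, σ, y)) ∂sphereMeasure := by
  rw [lintegral_prod _ hf.aemeasurable]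
  exact lintegral_congr fun x => lintegral_prod _ (hf.comp measurable_prodMk_left).aemeasurable

lemma lintegral_prod_prod_symm {f : V × S2 × V → ℝ≥0∞} (hf : Measurable f) :
    ∫⁻ p, f p ∂(volume.prod (sphereMeasure.prod volume)) =
      ∫⁻ y, ∫⁻ σ, (∫⁻ x, f (x, σ, y)) ∂sphereMeasure := by
  rw [lintegral_prod_symm' _ hf, lintegral_prod_symm' _ hf.lintegral_prod_left']

/-- The contribution of one shell to the resonant part. -/
lemma exists_shell_bound {ν : ℝ} (hν : 0 < ν) : ∃ C : ℝ≥0, ∀ δ U : ℝ, 0 < δ → 0 < U →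
    ∀ (F G H : V → ℝ≥0∞) (N : ℝ≥0∞), Measurable F → Measurable G → Measurable H →
    (∀ c : V, ∫⁻ x in Metric.ball c U, F x ^ (2 : ℝ) ≤ N) →
    ∫⁻ p : V × S2 × V, fwdKernel ν δ p.1 p.2.1 * shellInd U p.1 p.2.1 p.2.2 *
      ((F p.2.2 * H p.1) * G (p.1 - p.2.2)) ∂(volume.prod (sphereMeasure.prod volume)) ≤
    C * ENNReal.ofReal (δ ^ (-ν)) * ENNReal.ofReal (U ^ (3 / 2 : ℝ)) * N ^ (1 / 2 : ℝ) *
      nrm volume G * nrm volume H := by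
  obtain ⟨C₁, hC₁⟩ := exists_fwdKernel_bound hν
  obtain ⟨C₂, hC₂⟩ := exists_fwdKernel_zp_bound hν
  have hvol : volume (Metric.ball (0 : V) 1) ≠ ∞ := measure_ball_lt_top.ne
  refine ⟨C₁ ^ (1 / 2 : ℝ) * C₂ ^ (1 / 2 : ℝ) * (volume (Metric.ball (0 : V) 1)).toNNReal ^ (1 / 2 : ℝ),
    fun δ U hδ hU F G H N hF hG hH hN => ?_⟩
  have hk : Measurable fun p : V × S2 × V => fwdKernel ν δ p.1 p.2.1 :=
    (measurable_fwdKernel ν δ).comp (measurable_fst.prodMk measurable_snd.fst)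
  have hs := measurable_shellInd U
  set μ := (volume : Measure V).prod (sphereMeasure.prod (volume : Measure V))
  set D := ENNReal.ofReal (δ ^ (-ν)) with hD
  -- Factor with f and h: at fixed ξ and σ the shell is a ball in ξ_*, which costs `N`; the
  -- σ-integral then costs the mass of the kernel.
  have hfirst : ∫⁻ p : V × S2 × V, fwdKernel ν δ p.1 p.2.1 * shellInd U p.1 p.2.1 p.2.2 *
      (F p.2.2 * H p.1) ^ (2 : ℝ) ∂μ ≤ C₁ * D * N * ∫⁻ x, H x ^ (2 : ℝ) := by
    rw [lintegral_prod_prod (by fun_prop)]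
    calc _ ≤ ∫⁻ x, C₁ * D * N * H x ^ (2 : ℝ) := by
          refine lintegral_mono fun x => ?_
          have hkx : Measurable fun σ : S2 => fwdKernel ν δ x σ :=
            (measurable_fwdKernel ν δ).comp (measurable_const.prodMk measurable_id)
          calc _ ≤ ∫⁻ σ, fwdKernel ν δ x σ * (N * H x ^ (2 : ℝ)) ∂sphereMeasure := by
                refine lintegral_mono fun σ => ?_
                calc ∫⁻ y, fwdKernel ν δ x σ * shellInd U x σ y * (F y * H x) ^ (2 : ℝ)
                    = ∫⁻ y, fwdKernel ν δ x σ * H x ^ (2 : ℝ) *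
                      (Metric.ball (zm x σ) U).indicator (fun y => F y ^ (2 : ℝ)) y := by
                      refine lintegral_congr fun y => ?_
                      rw [shellInd_eq, ENNReal.mul_rpow_of_nonneg _ _ (by norm_num)]
                      by_cases h : y ∈ Metric.ball (zm x σ) U
                      · rw [Set.indicator_of_mem h, Set.indicator_of_mem h, Pi.one_apply]; ring
                      · rw [Set.indicator_of_notMem h, Set.indicator_of_notMem h]; ring
                  _ = fwdKernel ν δ x σ * H x ^ (2 : ℝ) *
                      ∫⁻ y in Metric.ball (zm x σ) U, F y ^ (2 : ℝ) := by
                      rw [lintegral_const_mul _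
                        (Measurable.indicator (by fun_prop) measurableSet_ball),
                        lintegral_indicator measurableSet_ball]
                  _ ≤ fwdKernel ν δ x σ * H x ^ (2 : ℝ) * N := by gcongr; exact hN _
                  _ = _ := by ring
            _ ≤ (C₁ * D) * (N * H x ^ (2 : ℝ)) := by
                rw [lintegral_mul_const _ hkx]
                gcongr
                exact hC₁ δ hδ x
            _ = _ := by ring
      _ = _ := lintegral_const_mul _ (by fun_prop)
  -- Factor with g: at fixed ζ = ξ - ξ_* the shell is a ball in ξ⁺, which costs its volume; the
  -- square root of this volume is the origin of U^(3/2).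
  have hsecond : ∫⁻ p : V × S2 × V, fwdKernel ν δ p.1 p.2.1 * shellInd U p.1 p.2.1 p.2.2 *
      G (p.1 - p.2.2) ^ (2 : ℝ) ∂μ ≤
      C₂ * D * volume (Metric.ball (0 : V) U) * ∫⁻ x, G x ^ (2 : ℝ) := by
    have hz : Measurable fun p : V × S2 × V =>
        (Metric.ball p.2.2 U).indicator (1 : V → ℝ≥0∞) (zp p.1 p.2.1) := by
      have h1 : Measurable fun p : V × S2 × V => (p.1, p.2.1, p.1 - p.2.2) := by fun_prop
      have h2 := hs.comp h1
      simp only [Function.comp_def, shellInd_sub] at h2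
      exact h2
    have hstep : ∫⁻ p : V × S2 × V, fwdKernel ν δ p.1 p.2.1 * shellInd U p.1 p.2.1 p.2.2 *
        G (p.1 - p.2.2) ^ (2 : ℝ) ∂μ = ∫⁻ p : V × S2 × V, fwdKernel ν δ p.1 p.2.1 *
        (Metric.ball p.2.2 U).indicator (1 : V → ℝ≥0∞) (zp p.1 p.2.1) * G p.2.2 ^ (2 : ℝ) ∂μ := by
      rw [lintegral_prod_prod (by fun_prop), lintegral_prod_prod (by fun_prop)]
      refine lintegral_congr fun x => lintegral_congr fun σ => ?_
      have h1 := lintegral_sub_left_eq_self (μ := (volume : Measure V)) (fun ζ =>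
        fwdKernel ν δ x σ * shellInd U x σ ζ * G (x - ζ) ^ (2 : ℝ)) x
      rw [← h1]
      simp only [shellInd_sub, sub_sub_cancel]
    have hm : Measurable fun p : V × S2 × V => fwdKernel ν δ p.1 p.2.1 *
        (Metric.ball p.2.2 U).indicator (1 : V → ℝ≥0∞) (zp p.1 p.2.1) * G p.2.2 ^ (2 : ℝ) := by
      fun_prop
    rw [hstep, lintegral_prod_prod_symm hm]
    calc _ ≤ ∫⁻ ζ, (C₂ * D * volume (Metric.ball (0 : V) U)) * G ζ ^ (2 : ℝ) := by
          refine lintegral_mono fun ζ => ?_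
          have hball : Measurable ((Metric.ball ζ U).indicator (1 : V → ℝ≥0∞)) :=
            measurable_one.indicator measurableSet_ball
          have h1 := hC₂ δ hδ _ hball
          rw [lintegral_indicator_one measurableSet_ball,
            Measure.addHaar_ball_center] at h1
          refine le_trans (le_of_eq ?_) (mul_le_mul_left h1 (G ζ ^ (2 : ℝ)))
          have hkz : Measurable fun p : S2 × V => fwdKernel ν δ p.2 p.1 *
              (Metric.ball ζ U).indicator (1 : V → ℝ≥0∞) (zp p.2 p.1) :=
            ((measurable_fwdKernel ν δ).comp measurable_swap).mul
              (hball.comp (continuous_zp.measurable.comp measurable_swap))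
          rw [← lintegral_mul_const _ hkz.lintegral_prod_right']
          refine lintegral_congr fun σ => ?_
          have hkσ : Measurable fun y : V => fwdKernel ν δ y σ *
              (Metric.ball ζ U).indicator (1 : V → ℝ≥0∞) (zp y σ) :=
            hkz.comp (measurable_const.prodMk measurable_id)
          exact lintegral_mul_const (μ := (volume : Measure V)) (G ζ ^ (2 : ℝ)) hkσ
      _ = _ := lintegral_const_mul _ (by fun_prop)
  refine (lintegral_weight_mul_le μ (by fun_prop) (by fun_prop) (by fun_prop)).trans ?_
  have hhalf : (0 : ℝ) ≤ 1 / 2 := by norm_num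
  have hDD : D ^ (1 / 2 : ℝ) * D ^ (1 / 2 : ℝ) = D := by
    rw [← ENNReal.rpow_add_of_nonneg _ _ hhalf hhalf]; norm_num
  have hUvol : volume (Metric.ball (0 : V) U) ^ (1 / 2 : ℝ) =
      ENNReal.ofReal (U ^ (3 / 2 : ℝ)) * volume (Metric.ball (0 : V) 1) ^ (1 / 2 : ℝ) := by
    rw [Measure.addHaar_ball _ _ hU.le, ENNReal.mul_rpow_of_nonneg _ _ hhalf,
      ENNReal.ofReal_rpow_of_nonneg (by positivity) hhalf]
    congr 2
    rw [finrank_euclideanSpace_fin, ← Real.rpow_natCast, ← Real.rpow_mul hU.le]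
    norm_num
  calc _ ≤ (C₁ * D * N * ∫⁻ x, H x ^ (2 : ℝ)) ^ (1 / 2 : ℝ) *
        (C₂ * D * volume (Metric.ball (0 : V) U) * ∫⁻ x, G x ^ (2 : ℝ)) ^ (1 / 2 : ℝ) := by
        gcongr
    _ = (C₁ : ℝ≥0∞) ^ (1 / 2 : ℝ) * C₂ ^ (1 / 2 : ℝ) * volume (Metric.ball (0 : V) 1) ^ (1 / 2 : ℝ) *
        (D ^ (1 / 2 : ℝ) * D ^ (1 / 2 : ℝ)) * ENNReal.ofReal (U ^ (3 / 2 : ℝ)) *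
        N ^ (1 / 2 : ℝ) * nrm volume G * nrm volume H := by
        simp only [ENNReal.mul_rpow_of_nonneg _ _ hhalf, hUvol, nrm]
        ring
    _ = _ := by
        rw [hDD]
        push_cast
        rw [ENNReal.coe_rpow_of_nonneg _ hhalf, ENNReal.coe_rpow_of_nonneg _ hhalf,
          ENNReal.coe_rpow_of_nonneg _ hhalf, ENNReal.coe_toNNReal hvol]

lemma lintegral_prod_lintegral {f : V × S2 × V → ℝ≥0∞} (hf : Measurable f) :
    ∫⁻ q : V × V, ∫⁻ σ, f (q.1, σ, q.2) ∂sphereMeasure ∂(volume.prod volume) =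
      ∫⁻ p, f p ∂(volume.prod (sphereMeasure.prod volume)) := by
  rw [lintegral_prod_prod hf]
  have h1 : Measurable fun p : (V × V) × S2 => f (p.1.1, p.2, p.1.2) :=
    hf.comp (by fun_prop)
  rw [lintegral_prod _ h1.lintegral_prod_right'.aemeasurable]
  refine lintegral_congr fun x => ?_
  have h2 : Measurable fun p : V × S2 => f (x, p.2, p.1) := hf.comp (by fun_prop)
  exact lintegral_lintegral_swap h2.aemeasurable

/-- Dyadic decomposition of the integrand of the resonant part. -/
lemma resonant_integrand_le {ν B p a b : ℝ} {β : ℝ → ℝ} (hB : 0 ≤ B) (hp : 0 ≤ p) (ha : 0 ≤ a)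
    (hab : a + b = ν) (ha₂ : a ≤ 2) (hβ : AngularBound ν B β) {ξ ξs : V} {σ : S2}
    (hYZ : 1 + ‖ξ‖ ≤ 10 * (1 + ‖ξ - ξs‖)) (hσ : 1 + ‖ξs‖ < ‖ξ‖ * ‖(dir ξ : V) - σ‖) :
    ENNReal.ofReal (β (sdot (dir ξ) σ) * (1 + ‖ξs - zm ξ σ‖) ^ (-p)) *
      ENNReal.ofReal ((1 + ‖ξ - ξs‖) ^ (-a) * (1 + ‖ξ‖) ^ (-b)) ≤
    ∑' j : ℕ, ENNReal.ofReal (100 * B * (2 ^ j) ^ (-p)) *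
      (fwdKernel ν (2 ^ j / 2) ξ σ * shellInd (2 ^ (j + 1)) ξ σ ξs) := by
  rcases lt_or_ge (sdot (dir ξ) σ) 0 with hneg | hpos
  · rw [hβ.eq_zero _ hneg, zero_mul, ENNReal.ofReal_zero, zero_mul]; exact zero_le
  set u := ‖ξs - zm ξ σ‖ with hu
  have hu0 : 0 ≤ u := norm_nonneg _
  set d := ‖(dir ξ : V) - σ‖ with hd
  have hd0 : 0 ≤ d := norm_nonneg _
  have hξ : ξ ≠ 0 := by
    rintro rfl
    rw [norm_zero, zero_mul] at hσ
    linarith [norm_nonneg ξs]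
  obtain ⟨j, hj1, hj2⟩ := exists_nat_pow_near (by linarith : (1 : ℝ) ≤ 1 + u)
    (by norm_num : (1 : ℝ) < 2)
  refine le_trans ?_ (ENNReal.le_tsum j)
  -- From 1+|ξ_*| < |ξ|d one gets 1+|ξ_*-ξ⁻| ≤ (3/2)|ξ|d, so the j-th shell meets only deviations d
  -- ≳ 2^j/(1+|ξ|).
  have hfar : (2 : ℝ) ^ j / 2 ≤ (1 + ‖ξ‖) * d := by
    have h1 : u ≤ ‖ξs‖ + ‖ξ‖ / 2 * d := by
      rw [hu, hd, ← norm_zm]; exact norm_sub_le _ _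
    linarith
  have hshell : shellInd (2 ^ (j + 1)) ξ σ ξs = 1 := by
    rw [shellInd_eq, Set.indicator_of_mem]
    · rfl
    · rw [mem_ball_iff_norm]; linarith
  rw [hshell, mul_one, fwdKernel_of_mem ⟨hξ, hpos⟩, farKernel_of_le hfar,
    ← ENNReal.ofReal_mul (mul_nonneg (hβ.nonneg _) (by positivity)),
    ← ENNReal.ofReal_mul (by positivity), ← ENNReal.ofReal_mul (by positivity)]
  refine ENNReal.ofReal_le_ofReal ?_
  have hY : 0 < 1 + ‖ξ‖ := by positivity
  -- In the resonant region both Sobolev weights become powers of 1+|ξ|; the constant is 10², as a ≤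
  -- 2.
  have hw : (1 + ‖ξ - ξs‖) ^ (-a) * (1 + ‖ξ‖) ^ (-b) ≤ 100 * (1 + ‖ξ‖) ^ (-ν) := by
    have h1 : (1 + ‖ξ - ξs‖) ^ (-a) ≤ ((1 + ‖ξ‖) / 10) ^ (-a) :=
      Real.rpow_le_rpow_of_nonpos (by positivity) (by linarith) (by linarith)
    have h2 : (10 : ℝ) ^ a ≤ 100 := by
      have := Real.rpow_le_rpow_of_exponent_le (by norm_num : (1 : ℝ) ≤ 10) ha₂
      norm_num at this; exact this
    rw [Real.div_rpow hY.le (by norm_num), Real.rpow_neg (by norm_num : (0 : ℝ) ≤ 10),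
      div_inv_eq_mul] at h1
    calc (1 + ‖ξ - ξs‖) ^ (-a) * (1 + ‖ξ‖) ^ (-b)
        ≤ ((1 + ‖ξ‖) ^ (-a) * 100) * (1 + ‖ξ‖) ^ (-b) := by
          gcongr
          exact h1.trans (by gcongr)
      _ = 100 * ((1 + ‖ξ‖) ^ (-a) * (1 + ‖ξ‖) ^ (-b)) := by ring
      _ = _ := by rw [← Real.rpow_add hY]; congr 2; linarith
  have hup : (1 + u) ^ (-p) ≤ (2 ^ j) ^ (-p) :=
    Real.rpow_le_rpow_of_nonpos (by positivity) hj1 (by linarith)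
  calc β (sdot (dir ξ) σ) * (1 + u) ^ (-p) * ((1 + ‖ξ - ξs‖) ^ (-a) * (1 + ‖ξ‖) ^ (-b))
      ≤ (B * d ^ (-2 - ν)) * (2 ^ j) ^ (-p) * (100 * (1 + ‖ξ‖) ^ (-ν)) := by
        have := hβ.bound (dir ξ) σ
        have := hβ.nonneg (sdot (dir ξ) σ)
        gcongr
    _ = _ := by ring

/-- The trilinear estimate for the resonant part of the multiplier. -/
lemma exists_resonant_bound {ν B p κ₀ a b : ℝ} (hν₀ : 0 < ν) (hν₂ : ν < 2) (hB : 0 ≤ B)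
    (hp : 0 ≤ p) (ha : 0 ≤ a) (hb : 0 ≤ b) (hab : a + b = ν) (hκ : κ₀ + 3 / 2 < p + ν) :
    ∃ C : ℝ≥0, ∀ β : ℝ → ℝ, AngularBound ν B β → ∀ (F G H : V → ℝ≥0∞) (N : ℝ≥0∞),
      Measurable F → Measurable G → Measurable H →
      (∀ (c : V) (U : ℝ), 1 ≤ U →
        ∫⁻ x in Metric.ball c U, F x ^ (2 : ℝ) ≤ (N * ENNReal.ofReal (U ^ κ₀)) ^ (2 : ℝ)) →
      ∫⁻ q : V × V, resonantPart β p q.1 q.2 *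
        ENNReal.ofReal ((1 + ‖q.1 - q.2‖) ^ (-a) * (1 + ‖q.1‖) ^ (-b)) *
        (F q.2 * G (q.1 - q.2) * H q.1) ∂(volume.prod volume) ≤
      C * (N * nrm volume G * nrm volume H) := by
  obtain ⟨C, hC⟩ := exists_shell_bound hν₀
  set K : ℝ := 100 * B * 2 ^ ν * 2 ^ (κ₀ + 3 / 2) with hK
  -- Per shell the symbol gains 2^(-jp) and the kernel mass 2^(-jν), while the volume costs 2^(3j/2)
  -- and the local norm of `F` costs 2^(jκ₀).
  set r : ℝ := 2 ^ (κ₀ + 3 / 2 - p - ν) with hr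
  have hr0 : 0 < r := by positivity
  have hr1 : r < 1 := Real.rpow_lt_one_of_one_lt_of_neg (by norm_num) (by linarith)
  refine ⟨C * Real.toNNReal (K * (1 - r)⁻¹), fun β hβ F G H N hF hG hH hN => ?_⟩
  set T : ℕ → V × S2 × V → ℝ≥0∞ := fun j p => fwdKernel ν (2 ^ j / 2) p.1 p.2.1 *
    shellInd (2 ^ (j + 1)) p.1 p.2.1 p.2.2 * ((F p.2.2 * H p.1) * G (p.1 - p.2.2)) with hT
  have hTm : ∀ j, Measurable (T j) := fun j => by
    have h1 : Measurable fun p : V × S2 × V => fwdKernel ν (2 ^ j / 2) p.1 p.2.1 :=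
      (measurable_fwdKernel ν _).comp (measurable_fst.prodMk measurable_snd.fst)
    have h2 := measurable_shellInd (2 ^ (j + 1))
    simp only [hT]
    fun_prop
  set c : ℕ → ℝ≥0∞ := fun j => ENNReal.ofReal (100 * B * (2 ^ j) ^ (-p)) with hc
  have hpt : ∀ q : V × V, resonantPart β p q.1 q.2 *
      ENNReal.ofReal ((1 + ‖q.1 - q.2‖) ^ (-a) * (1 + ‖q.1‖) ^ (-b)) *
      (F q.2 * G (q.1 - q.2) * H q.1) ≤
      ∫⁻ σ, ∑' j, c j * T j (q.1, σ, q.2) ∂sphereMeasure := by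
    rintro ⟨ξ, ξs⟩
    unfold resonantPart
    split_ifs with hYZ
    swap
    · rw [zero_mul, zero_mul]; exact zero_le
    simp only
    have hmS : MeasurableSet {σ : S2 | 1 + ‖ξs‖ < ‖ξ‖ * ‖(dir ξ : V) - σ‖} :=
      measurableSet_lt measurable_const (measurable_const.mul (measurable_norm_sub_left _))
    have hm1 : Measurable fun σ : S2 =>
        ENNReal.ofReal (β (sdot (dir ξ) σ) * (1 + ‖ξs - zm ξ σ‖) ^ (-p)) := by
      have h1 : Measurable fun σ : S2 => β (sdot (dir ξ) σ) :=
        hβ.measurable.comp (measurable_sdot_left (dir ξ))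
      have h2 : Measurable fun σ : S2 => (1 + ‖ξs - zm ξ σ‖) ^ (-p) := by
        have := (continuous_zm_right ξ).measurable
        fun_prop
      exact (h1.mul h2).ennreal_ofReal
    rw [mul_assoc, ← lintegral_mul_const _ hm1]
    refine le_trans ?_ (setLIntegral_le_lintegral
      {σ : S2 | 1 + ‖ξs‖ < ‖ξ‖ * ‖(dir ξ : V) - σ‖} _)
    refine setLIntegral_mono' hmS fun σ hσ => ?_
    have h3 := resonant_integrand_le hB hp ha hab (by linarith) hβ hYZ hσ
    rw [← mul_assoc]
    refine (mul_le_mul_left h3 _).trans_eq ?_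
    rw [← ENNReal.tsum_mul_right]
    refine tsum_congr fun j => ?_
    simp only [hT, hc]
    ring
  have hTint : ∀ j, c j * ∫⁻ p, T j p ∂(volume.prod (sphereMeasure.prod volume)) ≤
      ENNReal.ofReal (K * r ^ j) * (C * (N * nrm volume G * nrm volume H)) := by
    intro j
    have h2j : (0 : ℝ) < 2 ^ j := by positivity
    have h2j' : (0 : ℝ) < 2 ^ (j + 1) := by positivity
    have h1 := hC (2 ^ j / 2) (2 ^ (j + 1)) (by positivity) h2j' F G H _ hF hG hH
      (fun x => hN x _ (one_le_pow₀ (by norm_num)))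
    refine (mul_le_mul_right h1 _).trans_eq ?_
    rw [← ENNReal.rpow_mul, show (2 : ℝ) * (1 / 2) = 1 by norm_num, ENNReal.rpow_one]
    have hreal : K * r ^ j = 100 * B * (2 ^ j) ^ (-p) * ((2 ^ j / 2) ^ (-ν) *
        ((2 ^ (j + 1)) ^ (3 / 2 : ℝ) * (2 ^ (j + 1)) ^ κ₀)) := by
      have e1 : ((2 : ℝ) ^ j / 2) ^ (-ν) = (2 ^ j) ^ (-ν) * 2 ^ ν := by
        rw [Real.div_rpow h2j.le (by norm_num), Real.rpow_neg (by norm_num : (0 : ℝ) ≤ 2),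
          div_inv_eq_mul]
      have e2 : ((2 : ℝ) ^ (j + 1)) ^ (3 / 2 : ℝ) * (2 ^ (j + 1)) ^ κ₀ =
          (2 ^ j) ^ (κ₀ + 3 / 2) * 2 ^ (κ₀ + 3 / 2) := by
        rw [← Real.rpow_add h2j', pow_succ, Real.mul_rpow h2j.le (by norm_num), add_comm]
      have e3 : r ^ j = (2 ^ j) ^ (-p) * (2 ^ j) ^ (-ν) * (2 ^ j) ^ (κ₀ + 3 / 2) := by
        rw [← Real.rpow_add h2j, ← Real.rpow_add h2j, hr, ← Real.rpow_natCast,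
          ← Real.rpow_natCast, ← Real.rpow_mul (by norm_num), ← Real.rpow_mul (by norm_num)]
        congr 1; ring
      rw [e1, e2, e3, hK]; ring
    rw [hreal, ENNReal.ofReal_mul (p := 100 * B * (2 ^ j) ^ (-p)) (by positivity),
      ENNReal.ofReal_mul (p := (2 ^ j / 2) ^ (-ν)) (by positivity),
      ENNReal.ofReal_mul (p := (2 ^ (j + 1)) ^ (3 / 2 : ℝ)) (by positivity)]
    simp only [hc]
    ring
  have hsum : Measurable fun p => ∑' j, c j * T j p :=
    Measurable.tsum fun j => (hTm j).const_mul _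
  calc _ ≤ ∫⁻ q : V × V, ∫⁻ σ, ∑' j, c j * T j (q.1, σ, q.2) ∂sphereMeasure
        ∂(volume.prod volume) := lintegral_mono hpt
    _ = ∫⁻ p, ∑' j, c j * T j p ∂(volume.prod (sphereMeasure.prod volume)) :=
        lintegral_prod_lintegral hsum
    _ = ∑' j, c j * ∫⁻ p, T j p ∂(volume.prod (sphereMeasure.prod volume)) := by
        rw [lintegral_tsum fun j => ((hTm j).const_mul _).aemeasurable]
        exact tsum_congr fun j => lintegral_const_mul _ (hTm j)
    _ ≤ ∑' j : ℕ, ENNReal.ofReal (K * r ^ j) * (C * (N * nrm volume G * nrm volume H)) :=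
        ENNReal.tsum_le_tsum hTint
    _ = _ := by
        rw [ENNReal.tsum_mul_right, tsum_ofReal_geometric (by positivity) hr0.le hr1,
          ENNReal.ofReal, ENNReal.coe_mul]
        ring

/-! ### Local L² bounds for Fourier transforms of L^q functions. -/

/-- The Gaussian of width `U`. -/
noncomputable def gauss (U : ℝ) (x : V) : ℝ := Real.exp (-(Real.pi / U ^ 2) * ‖x‖ ^ 2)

lemma gauss_pos (U : ℝ) (x : V) : 0 < gauss U x := Real.exp_pos _

lemma continuous_gauss (U : ℝ) : Continuous (gauss U) := by unfold gauss; fun_prop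

lemma integral_gauss {U : ℝ} (hU : 0 < U) : ∫ x, gauss U x = U ^ 3 := by
  unfold gauss
  rw [GaussianFourier.integral_rexp_neg_mul_sq_norm (by positivity), finrank_euclideanSpace_fin]
  have : Real.pi / (Real.pi / U ^ 2) = U ^ 2 := by
    have := Real.pi_pos
    field_simp
  rw [this, ← Real.rpow_natCast, ← Real.rpow_mul hU.le, ← Real.rpow_natCast]
  norm_num

lemma integrable_gauss {U : ℝ} (hU : 0 < U) : Integrable (gauss U) := by
  by_contra h
  have h1 := integral_gauss hU
  rw [integral_undef h] at h1
  have : 0 < U ^ 3 := by positivity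
  linarith

lemma fourier_gauss {U : ℝ} (hU : 0 < U) (w : V) :
    𝓕 (fun x => (gauss U x : ℂ)) w = ((U ^ 3 * gauss U⁻¹ w : ℝ) : ℂ) := by
  have hb : 0 < ((Real.pi / U ^ 2 : ℝ) : ℂ).re := by
    rw [Complex.ofReal_re]; positivity
  have h := fourier_gaussian_innerProductSpace hb w
  have hpi : (Real.pi : ℂ) ≠ 0 := by exact_mod_cast Real.pi_ne_zero
  have hU' : (U : ℂ) ≠ 0 := by exact_mod_cast hU.ne'
  have e1 : (fun v : V => Complex.exp (-((Real.pi / U ^ 2 : ℝ) : ℂ) * (‖v‖ : ℂ) ^ 2)) =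
      fun x => (gauss U x : ℂ) := by
    ext v
    rw [gauss, Complex.ofReal_exp]
    push_cast
    rfl
  rw [e1, finrank_euclideanSpace_fin] at h
  rw [h]
  have e2 : (Real.pi : ℂ) / ((Real.pi / U ^ 2 : ℝ) : ℂ) = ((U ^ 2 : ℝ) : ℂ) := by
    push_cast; field_simp
  have e3 : ((U ^ 2 : ℝ) : ℂ) ^ ((3 : ℕ) / 2 : ℂ) = ((U ^ 3 : ℝ) : ℂ) := by
    rw [show ((3 : ℕ) / 2 : ℂ) = ((3 / 2 : ℝ) : ℂ) by push_cast; rfl,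
      ← Complex.ofReal_cpow (by positivity), ← Real.rpow_natCast, ← Real.rpow_mul hU.le,
      ← Real.rpow_natCast]
    norm_num
  rw [e2, e3, Complex.ofReal_mul, gauss, Complex.ofReal_exp]
  congr 2
  push_cast
  field_simp

lemma fourier_add_eq (f : 𝓢(V, ℂ)) (ζ c : V) :
    𝓕 f (ζ + c) = ∫ x, chr (-inner ℝ x (ζ + c)) * f x := by
  rw [SchwartzMap.fourier_coe, fourier_eq_integral_chr]

/-- Opening the square turns a Gaussian average of |f̂|² into a quadratic form in f. Up to a phase
its kernel is the dual Gaussian, of mass 1 and height U³. -/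
lemma integral_gauss_mul_normSq (f : 𝓢(V, ℂ)) {U : ℝ} (hU : 0 < U) (c : V) :
    ∫ ζ, (gauss U ζ : ℂ) * (𝓕 f (ζ + c) * (starRingEnd ℂ) (𝓕 f (ζ + c))) =
      ∫ q : V × V, chr (-inner ℝ (q.1 - q.2) c) * (f q.1 * (starRingEnd ℂ) (f q.2)) *
        ((U ^ 3 * gauss U⁻¹ (q.1 - q.2) : ℝ) : ℂ) ∂(volume.prod volume) := by
  set Θ : V → V × V → ℂ := fun ζ q => ((gauss U ζ : ℂ) * (f q.1 * (starRingEnd ℂ) (f q.2))) *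
    chr (-inner ℝ (q.1 - q.2) (ζ + c)) with hΘ
  have h1 : ∀ ζ, (gauss U ζ : ℂ) * (𝓕 f (ζ + c) * (starRingEnd ℂ) (𝓕 f (ζ + c))) =
      ∫ q, Θ ζ q ∂(volume.prod volume) := by
    intro ζ
    rw [fourier_add_eq, ← integral_conj, ← integral_prod_mul, ← integral_const_mul]
    refine integral_congr_ae (ae_of_all _ fun q => ?_)
    simp only [hΘ, map_mul, conj_chr]
    rw [show -inner ℝ (q.1 - q.2) (ζ + c) = -inner ℝ q.1 (ζ + c) + -(-inner ℝ q.2 (ζ + c)) by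
      rw [inner_sub_left]; ring, chr_add]
    ring
  have hint : Integrable (Function.uncurry Θ) (volume.prod (volume.prod volume)) := by
    have h2 : Integrable (fun q : V × V => f q.1 * (starRingEnd ℂ) (f q.2)) (volume.prod volume) :=
      f.integrable.mul_prod (integrable_conj f)
    have h3 := (integrable_gauss hU).ofReal (𝕜 := ℂ) |>.mul_prod h2
    refine h3.mul_bdd (c := 1) (g := fun p : V × V × V => chr (-inner ℝ (p.2.1 - p.2.2) (p.1 + c)))
      (Continuous.aestronglyMeasurable (by fun_prop)) (ae_of_all _ fun p => by simp)
  simp only [h1]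
  rw [integral_integral_swap hint]
  refine integral_congr_ae (ae_of_all _ fun q => ?_)
  simp only
  rw [← fourier_gauss hU, fourier_eq_integral_chr, ← integral_const_mul]
  refine integral_congr_ae (ae_of_all _ fun ζ => ?_)
  simp only [hΘ]
  rw [inner_add_right, neg_add, chr_add, real_inner_comm (q.1 - q.2) ζ]
  ring

/-- Truncation at height `lam`: where both `s` and `t` exceed it the supremum `R` of the kernel is
used, and elsewhere the kernel is kept, to be integrated later. This does the work of interpolating
between the sup and the L¹ bound of the kernel. -/
lemma mul_mul_le_split {q lam s t k R : ℝ} (hq : 1 ≤ q) (hq₂ : q ≤ 2) (hl : 0 < lam) (hs : 0 ≤ s)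
    (ht : 0 ≤ t) (hk : 0 ≤ k) (hkR : k ≤ R) :
    s * t * k ≤ R * lam ^ (2 - 2 * q) * (s ^ q * t ^ q) + lam ^ (2 - q) * (s ^ q + t ^ q) * k := by
  have hR : 0 ≤ R := hk.trans hkR
  have big : ∀ {x : ℝ}, lam < x → x ≤ lam ^ (1 - q) * x ^ q := fun {x} hx => by
    have hx0 : 0 < x := hl.trans hx
    calc x = x ^ (1 - q) * x ^ q := by rw [← Real.rpow_add hx0]; simp
      _ ≤ _ := by
        gcongr ?_ * _
        exact Real.rpow_le_rpow_of_nonpos hl hx.le (by linarith)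
  have small : ∀ {x : ℝ}, 0 ≤ x → x ≤ lam → x * x ≤ lam ^ (2 - q) * x ^ q := fun {x} hx0 hx => by
    rcases hx0.eq_or_lt with rfl | hx1
    · rw [zero_mul]; positivity
    calc x * x = x ^ (2 - q) * x ^ q := by
          rw [← Real.rpow_add hx1, ← sq, ← Real.rpow_natCast]; congr 1; push_cast; ring
      _ ≤ _ := by gcongr
  have hll : lam * lam ^ (1 - q) = lam ^ (2 - q) := by
    nth_rewrite 1 [← Real.rpow_one lam]
    rw [← Real.rpow_add hl]; congr 1; ring
  have p1 : 0 ≤ R * lam ^ (2 - 2 * q) * (s ^ q * t ^ q) := by positivity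
  have ps : 0 ≤ lam ^ (2 - q) * s ^ q * k := by positivity
  have pt : 0 ≤ lam ^ (2 - q) * t ^ q * k := by positivity
  have hexp : lam ^ (2 - q) * (s ^ q + t ^ q) * k =
    lam ^ (2 - q) * s ^ q * k + lam ^ (2 - q) * t ^ q * k := by ring
  rw [hexp]
  rcases lt_or_ge lam s with h1 | h1 <;> rcases lt_or_ge lam t with h2 | h2
  · have : s * t * k ≤ R * lam ^ (2 - 2 * q) * (s ^ q * t ^ q) := by
      calc s * t * k ≤ (lam ^ (1 - q) * s ^ q) * (lam ^ (1 - q) * t ^ q) * R := by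
            gcongr
            · exact big h1
            · exact big h2
        _ = R * (lam ^ (1 - q) * lam ^ (1 - q)) * (s ^ q * t ^ q) := by ring
        _ = _ := by rw [← Real.rpow_add hl]; congr 3; ring
    linarith
  · have : s * t * k ≤ lam ^ (2 - q) * s ^ q * k := by
      calc s * t * k ≤ (lam ^ (1 - q) * s ^ q) * lam * k := by
            gcongr
            exact big h1
        _ = (lam * lam ^ (1 - q)) * s ^ q * k := by ring
        _ = _ := by rw [hll]
    linarith
  · have : s * t * k ≤ lam ^ (2 - q) * t ^ q * k := by
      calc s * t * k ≤ lam * (lam ^ (1 - q) * t ^ q) * k := by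
            gcongr
            exact big h2
        _ = (lam * lam ^ (1 - q)) * t ^ q * k := by ring
        _ = _ := by rw [hll]
    linarith
  · have h3 := small hs h1
    have h4 := small ht h2
    have h5 : s * t ≤ s * s + t * t := by nlinarith [sq_nonneg (s - t), mul_nonneg hs ht]
    have : s * t * k ≤ (lam ^ (2 - q) * s ^ q + lam ^ (2 - q) * t ^ q) * k := by
      gcongr
      linarith
    linarith

lemma lintegral_gauss_mul_normSq_le (f : 𝓢(V, ℂ)) {U q lam : ℝ} (hU : 0 < U) (hq : 1 ≤ q)
    (hq₂ : q ≤ 2) (hl : 0 < lam) (c : V) :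
    ∫⁻ ζ, ENNReal.ofReal (gauss U ζ * ‖𝓕 f (ζ + c)‖ ^ 2) ≤
      ENNReal.ofReal (U ^ 3 * lam ^ (2 - 2 * q)) * (∫⁻ x, ENNReal.ofReal (‖f x‖ ^ q)) ^ 2 +
        ENNReal.ofReal (lam ^ (2 - q)) * (2 * ∫⁻ x, ENNReal.ofReal (‖f x‖ ^ q)) := by
  set P : V → ℝ≥0∞ := fun x => ENNReal.ofReal (‖f x‖ ^ q) with hP
  set M := ∫⁻ x, P x with hM
  have hfc := f.continuous
  have hPm : Measurable P := by
    have := f.continuous.measurable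
    fun_prop
  set K : V → ℝ≥0∞ := fun z => ENNReal.ofReal (U ^ 3 * gauss U⁻¹ z) with hK
  have hKm : Measurable K := by
    have := (continuous_gauss U⁻¹).measurable
    fun_prop
  have hK1 : ∫⁻ z, K z = 1 := by
    rw [← ofReal_integral_eq_lintegral_ofReal
      ((integrable_gauss (inv_pos.2 hU)).const_mul _)
      (ae_of_all _ fun z => mul_nonneg (by positivity) (gauss_pos _ _).le),
      integral_const_mul, integral_gauss (inv_pos.2 hU), ← mul_pow, mul_inv_cancel₀ hU.ne']
    simp
  have hpt : ∀ q' : V × V, ‖chr (-inner ℝ (q'.1 - q'.2) c) * (f q'.1 * (starRingEnd ℂ) (f q'.2)) *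
      ((U ^ 3 * gauss U⁻¹ (q'.1 - q'.2) : ℝ) : ℂ)‖ₑ ≤
      ENNReal.ofReal (U ^ 3 * lam ^ (2 - 2 * q)) * (P q'.1 * P q'.2) +
        ENNReal.ofReal (lam ^ (2 - q)) * (P q'.1 * K (q'.1 - q'.2) + P q'.2 * K (q'.1 - q'.2)) := by
    intro q'
    have hg := (gauss_pos U⁻¹ (q'.1 - q'.2)).le
    have hg1 : gauss U⁻¹ (q'.1 - q'.2) ≤ 1 := by
      unfold gauss
      rw [Real.exp_le_one_iff]
      have : 0 ≤ Real.pi / U⁻¹ ^ 2 * ‖q'.1 - q'.2‖ ^ 2 := by positivity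
      linarith
    have h := mul_mul_le_split hq hq₂ hl (norm_nonneg (f q'.1)) (norm_nonneg (f q'.2))
      (mul_nonneg (by positivity : 0 ≤ U ^ 3) hg) (R := U ^ 3)
      (mul_le_of_le_one_right (by positivity) hg1)
    simp only [hP, hK]
    rw [← add_mul, ← ENNReal.ofReal_mul (by positivity), ← ENNReal.ofReal_mul (by positivity),
      ← ENNReal.ofReal_add (by positivity) (by positivity),
      ← ENNReal.ofReal_mul (by positivity), ← ENNReal.ofReal_mul (by positivity),
      ← ENNReal.ofReal_add (by positivity) (by positivity), ← ofReal_norm]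
    refine ENNReal.ofReal_le_ofReal ?_
    rw [norm_mul, norm_mul, norm_mul, norm_chr, one_mul, RCLike.norm_conj, Complex.norm_real,
      Real.norm_of_nonneg (by positivity)]
    refine h.trans_eq ?_
    ring
  have hI : ∫⁻ ζ, ENNReal.ofReal (gauss U ζ * ‖𝓕 f (ζ + c)‖ ^ 2) =
      ‖∫ ζ, (gauss U ζ : ℂ) * (𝓕 f (ζ + c) * (starRingEnd ℂ) (𝓕 f (ζ + c)))‖ₑ := by
    have e1 : ∀ ζ, (gauss U ζ : ℂ) * (𝓕 f (ζ + c) * (starRingEnd ℂ) (𝓕 f (ζ + c))) =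
        ((gauss U ζ * ‖𝓕 f (ζ + c)‖ ^ 2 : ℝ) : ℂ) := fun ζ => by
      rw [Complex.mul_conj, Complex.normSq_eq_norm_sq]; push_cast; rfl
    have hnn : ∀ ζ, 0 ≤ gauss U ζ * ‖𝓕 f (ζ + c)‖ ^ 2 := fun ζ =>
      mul_nonneg (gauss_pos _ _).le (by positivity)
    have hint : Integrable fun ζ => gauss U ζ * ‖𝓕 f (ζ + c)‖ ^ 2 := by
      obtain ⟨C, hC, hf⟩ := exists_schwartz_bound (𝓕 f)
      have hc := (𝓕 f).continuous
      refine (integrable_gauss hU).mul_bdd (c := C ^ 2) (Continuous.aestronglyMeasurable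
        (by fun_prop)) (ae_of_all _ fun ζ => ?_)
      rw [norm_pow, norm_norm]
      gcongr
      exact hf _
    simp only [e1]
    rw [integral_complex_ofReal, ← ofReal_norm, Complex.norm_real,
      Real.norm_of_nonneg (integral_nonneg hnn), ofReal_integral_eq_lintegral_ofReal hint
        (ae_of_all _ hnn)]
  rw [hI, integral_gauss_mul_normSq f hU c]
  refine (enorm_integral_le_lintegral_enorm _).trans ((lintegral_mono hpt).trans_eq ?_)
  have hPP : ∫⁻ q' : V × V, P q'.1 * P q'.2 ∂(volume.prod volume) = M ^ 2 := by
    rw [lintegral_prod_mul hPm.aemeasurable hPm.aemeasurable, sq]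
  have hPK1 : ∫⁻ q' : V × V, P q'.1 * K (q'.1 - q'.2) ∂(volume.prod volume) = M := by
    rw [lintegral_prod _ (by fun_prop)]
    refine lintegral_congr fun x => ?_
    simp only
    rw [lintegral_const_mul _ (by fun_prop), lintegral_sub_left_eq_self K x, hK1, mul_one]
  have hPK2 : ∫⁻ q' : V × V, P q'.2 * K (q'.1 - q'.2) ∂(volume.prod volume) = M := by
    rw [lintegral_prod_symm _ (by fun_prop)]
    refine lintegral_congr fun x => ?_
    simp only
    rw [lintegral_const_mul _ (by fun_prop), lintegral_sub_right_eq_self K x, hK1, mul_one]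
  rw [lintegral_add_left (by fun_prop), lintegral_const_mul _ (by fun_prop),
    lintegral_const_mul _ (by fun_prop), lintegral_add_left (by fun_prop), hPP, hPK1, hPK2,
    two_mul M]

/-- The local `L²` bound on the Fourier transform of an `L^q` function. -/
lemma exists_fourier_ball_bound {q : ℝ} (hq : 1 ≤ q) (hq₂ : q ≤ 2) :
    ∃ C : ℝ≥0, ∀ (f : 𝓢(V, ℂ)) (c : V) (U : ℝ), 1 ≤ U →
      ∫⁻ x in Metric.ball c U, ‖𝓕 f x‖ₑ ^ (2 : ℝ) ≤
        (C * eLpNorm f (ENNReal.ofReal q) volume * ENNReal.ofReal (U ^ (3 / q - 3 / 2))) ^ (2 : ℝ) := by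
  refine ⟨Real.toNNReal √(3 * Real.exp Real.pi), fun f c U hU1 => ?_⟩
  have hU : 0 < U := by linarith
  have hq0 : 0 < q := by linarith
  have hqne : ENNReal.ofReal q ≠ 0 := by simpa using hq0
  set P : V → ℝ≥0∞ := fun x => ENNReal.ofReal (‖f x‖ ^ q) with hP
  set M := ∫⁻ x, P x with hM
  have hnM : eLpNorm f (ENNReal.ofReal q) volume = M ^ (1 / q) := by
    rw [eLpNorm_eq_lintegral_rpow_enorm_toReal hqne ENNReal.ofReal_ne_top,
      ENNReal.toReal_ofReal hq0.le]
    congr 1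
    refine lintegral_congr fun x => ?_
    rw [hP, ← ofReal_norm, ENNReal.ofReal_rpow_of_nonneg (norm_nonneg _) hq0.le]
  have hfin : eLpNorm f (ENNReal.ofReal q) volume ≠ ∞ := (f.memLp _ volume).eLpNorm_lt_top.ne
  set n := (eLpNorm f (ENNReal.ofReal q) volume).toReal with hn
  have hn0 : 0 ≤ n := ENNReal.toReal_nonneg
  have hnn : eLpNorm f (ENNReal.ofReal q) volume = ENNReal.ofReal n := (ENNReal.ofReal_toReal hfin).symm
  have hMn : M = ENNReal.ofReal (n ^ q) := by
    rw [← ENNReal.ofReal_rpow_of_nonneg hn0 hq0.le, ← hnn, hnM, ← ENNReal.rpow_mul]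
    rw [one_div_mul_cancel hq0.ne', ENNReal.rpow_one]
  -- On the ball the Gaussian of width U centred at c is at least e^(-π).
  have hball : ∫⁻ x in Metric.ball c U, ‖𝓕 f x‖ₑ ^ (2 : ℝ) ≤
      ENNReal.ofReal (Real.exp Real.pi) *
        ∫⁻ ζ, ENNReal.ofReal (gauss U ζ * ‖𝓕 f (ζ + c)‖ ^ 2) := by
    have e1 := lintegral_sub_right_eq_self (μ := (volume : Measure V))
      (fun ζ => ENNReal.ofReal (gauss U ζ * ‖𝓕 f (ζ + c)‖ ^ 2)) c
    rw [← e1, ← lintegral_const_mul' _ _ ENNReal.ofReal_ne_top]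
    refine le_trans (setLIntegral_mono' measurableSet_ball fun x hx => ?_)
      (setLIntegral_le_lintegral (Metric.ball c U) _)
    rw [sub_add_cancel, ← ENNReal.ofReal_mul (by positivity), ← ofReal_norm,
      ENNReal.ofReal_rpow_of_nonneg (norm_nonneg _) (by norm_num)]
    refine ENNReal.ofReal_le_ofReal ?_
    rw [← mul_assoc, gauss, ← Real.exp_add]
    have h2 : ‖𝓕 f x‖ ^ (2 : ℝ) = ‖𝓕 f x‖ ^ 2 := by norm_num
    rw [h2]
    refine le_mul_of_one_le_left (by positivity) (Real.one_le_exp ?_)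
    have h3 : ‖x - c‖ ≤ U := (mem_ball_iff_norm.1 hx).le
    have h4 : Real.pi / U ^ 2 * ‖x - c‖ ^ 2 ≤ Real.pi / U ^ 2 * U ^ 2 := by
      have := Real.pi_pos
      gcongr
    rw [div_mul_cancel₀ _ (by positivity)] at h4
    linarith
  have hmain : ∫⁻ ζ, ENNReal.ofReal (gauss U ζ * ‖𝓕 f (ζ + c)‖ ^ 2) ≤
      ENNReal.ofReal (3 * (n * U ^ (3 / q - 3 / 2)) ^ 2) := by
    rcases hn0.eq_or_lt with h0 | hnpos
    · have h := lintegral_gauss_mul_normSq_le f hU hq hq₂ one_pos c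
      rw [← hM, hMn, ← h0, Real.zero_rpow hq0.ne'] at h
      refine h.trans ?_
      simp
    -- The height n U^(3/q) balances the two terms of the truncation; it has to be positive, hence
    -- the separate case n = 0.
    have h := lintegral_gauss_mul_normSq_le f hU hq hq₂
      (by positivity : 0 < n * U ^ (3 / q)) c
    rw [← hM, hMn] at h
    refine h.trans_eq ?_
    rw [← ENNReal.ofReal_pow (by positivity), show (2 : ℝ≥0∞) = ENNReal.ofReal 2 by simp,
      ← ENNReal.ofReal_mul (by positivity), ← ENNReal.ofReal_mul (by positivity),
      ← ENNReal.ofReal_mul (by positivity), ← ENNReal.ofReal_add (by positivity) (by positivity)]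
    congr 1
    have hsq : (n * U ^ (3 / q - 3 / 2)) ^ 2 = n ^ (2 : ℝ) * U ^ (6 / q - 3) := by
      rw [mul_pow, ← Real.rpow_natCast (U ^ _), ← Real.rpow_mul hU.le]
      norm_num
      left; congr 1; ring
    have t1 : U ^ 3 * (n * U ^ (3 / q)) ^ (2 - 2 * q) * (n ^ q) ^ 2 =
        n ^ (2 : ℝ) * U ^ (6 / q - 3) := by
      rw [Real.mul_rpow hn0 (by positivity), ← Real.rpow_mul hU.le, ← Real.rpow_natCast,
        ← Real.rpow_natCast, ← Real.rpow_mul hn0]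
      calc _ = (n ^ (2 - 2 * q) * n ^ (q * ((2 : ℕ) : ℝ))) *
            (U ^ ((3 : ℕ) : ℝ) * U ^ (3 / q * (2 - 2 * q))) := by ring
        _ = _ := by
          rw [← Real.rpow_add hnpos, ← Real.rpow_add hU]
          congr 2
          · push_cast; ring
          · push_cast; field_simp; ring
    have t2 : (n * U ^ (3 / q)) ^ (2 - q) * (2 * n ^ q) = 2 * (n ^ (2 : ℝ) * U ^ (6 / q - 3)) := by
      rw [Real.mul_rpow hn0 (by positivity), ← Real.rpow_mul hU.le]
      calc _ = 2 * ((n ^ (2 - q) * n ^ q) * U ^ (3 / q * (2 - q))) := by ring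
        _ = _ := by
          rw [← Real.rpow_add hnpos]
          congr 3
          · ring
          · field_simp; ring
    rw [t1, t2, hsq]; ring
  refine hball.trans ((mul_le_mul_right hmain _).trans_eq ?_)
  rw [hnn, ← ENNReal.ofReal_mul (by positivity), ← ENNReal.ofReal_coe_nnreal,
    Real.coe_toNNReal _ (by positivity), ← ENNReal.ofReal_mul (by positivity),
    ← ENNReal.ofReal_mul (by positivity), ENNReal.ofReal_rpow_of_nonneg (by positivity) (by norm_num)]
  congr 1
  rw [show (2 : ℝ) = ((2 : ℕ) : ℝ) by norm_num, Real.rpow_natCast, mul_assoc √_, mul_pow √_,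
    Real.sq_sqrt (by positivity)]
  push_cast
  ring

/-- From local to weighted `L²` bounds. -/
lemma exists_weighted_bound {κ κ₀ : ℝ} (hκ : 0 ≤ κ) (hκκ : κ₀ < κ) :
    ∃ C : ℝ≥0, ∀ (F : V → ℝ≥0∞) (N : ℝ≥0∞), Measurable F →
      (∀ (c : V) (U : ℝ), 1 ≤ U →
        ∫⁻ x in Metric.ball c U, F x ^ (2 : ℝ) ≤ (N * ENNReal.ofReal (U ^ κ₀)) ^ (2 : ℝ)) →
      nrm volume (fun x => ENNReal.ofReal ((1 + ‖x‖) ^ (-κ)) * F x) ≤ C * N := by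
  set r : ℝ := 2 ^ (2 * (κ₀ - κ)) with hr
  have hr0 : 0 < r := by positivity
  have hr1 : r < 1 := Real.rpow_lt_one_of_one_lt_of_neg (by norm_num) (by linarith)
  set K : ℝ := 2 ^ (2 * κ₀) with hK
  refine ⟨Real.toNNReal (K * (1 - r)⁻¹) ^ (1 / 2 : ℝ), fun F N hF hN => ?_⟩
  have hpt : ∀ x : V, (ENNReal.ofReal ((1 + ‖x‖) ^ (-κ)) * F x) ^ (2 : ℝ) ≤
      ∑' j : ℕ, ENNReal.ofReal ((2 ^ j) ^ (-(2 * κ))) *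
        (Metric.ball (0 : V) (2 ^ (j + 1))).indicator (fun x => F x ^ (2 : ℝ)) x := by
    intro x
    obtain ⟨j, hj1, hj2⟩ := exists_nat_pow_near (by linarith [norm_nonneg x] : (1 : ℝ) ≤ 1 + ‖x‖)
      (by norm_num : (1 : ℝ) < 2)
    refine le_trans ?_ (ENNReal.le_tsum j)
    rw [Set.indicator_of_mem (by rw [mem_ball_zero_iff]; linarith),
      ENNReal.mul_rpow_of_nonneg _ _ (by norm_num),
      ENNReal.ofReal_rpow_of_nonneg (by positivity) (by norm_num), ← Real.rpow_mul (by positivity)]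
    gcongr ENNReal.ofReal ?_ * _
    rw [show -κ * 2 = -(2 * κ) by ring]
    exact Real.rpow_le_rpow_of_nonpos (by positivity) hj1 (by linarith)
  have hterm : ∀ j : ℕ, ∫⁻ x, ENNReal.ofReal ((2 ^ j) ^ (-(2 * κ))) *
        (Metric.ball (0 : V) (2 ^ (j + 1))).indicator (fun x => F x ^ (2 : ℝ)) x ≤
      ENNReal.ofReal (K * r ^ j) * N ^ (2 : ℝ) := by
    intro j
    have h2j : (0 : ℝ) < 2 ^ j := by positivity
    rw [lintegral_const_mul' _ _ ENNReal.ofReal_ne_top, lintegral_indicator measurableSet_ball]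
    refine (mul_le_mul_right (hN 0 (2 ^ (j + 1)) (one_le_pow₀ (by norm_num))) _).trans_eq ?_
    rw [ENNReal.mul_rpow_of_nonneg _ _ (by norm_num),
      ENNReal.ofReal_rpow_of_nonneg (by positivity) (by norm_num), mul_left_comm,
      ← ENNReal.ofReal_mul (by positivity), mul_comm]
    congr 2
    rw [pow_succ, ← Real.rpow_mul (by positivity), Real.mul_rpow h2j.le (by norm_num), ← mul_assoc,
      ← Real.rpow_add h2j, hr, hK, ← Real.rpow_natCast, ← Real.rpow_natCast,
      ← Real.rpow_mul (by norm_num), ← Real.rpow_mul (by norm_num), mul_comm]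
    congr 2 <;> ring
  have hsum : ∫⁻ x : V, (ENNReal.ofReal ((1 + ‖x‖) ^ (-κ)) * F x) ^ (2 : ℝ) ≤
      ENNReal.ofReal (K * (1 - r)⁻¹) * N ^ (2 : ℝ) := by
    calc _ ≤ ∫⁻ x : V, ∑' j : ℕ, ENNReal.ofReal ((2 ^ j) ^ (-(2 * κ))) *
          (Metric.ball (0 : V) (2 ^ (j + 1))).indicator (fun x => F x ^ (2 : ℝ)) x :=
          lintegral_mono hpt
      _ = ∑' j : ℕ, ∫⁻ x : V, ENNReal.ofReal ((2 ^ j) ^ (-(2 * κ))) *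
          (Metric.ball (0 : V) (2 ^ (j + 1))).indicator (fun x => F x ^ (2 : ℝ)) x :=
          lintegral_tsum fun j => (((hF.pow_const _).indicator
            measurableSet_ball).const_mul _).aemeasurable
      _ ≤ ∑' j : ℕ, ENNReal.ofReal (K * r ^ j) * N ^ (2 : ℝ) := ENNReal.tsum_le_tsum hterm
      _ = _ := by rw [ENNReal.tsum_mul_right, tsum_ofReal_geometric (by positivity) hr0.le hr1]
  unfold nrm
  refine (ENNReal.rpow_le_rpow hsum (by norm_num)).trans_eq ?_
  rw [ENNReal.mul_rpow_of_nonneg _ _ (by norm_num), ← ENNReal.rpow_mul,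
    ENNReal.coe_rpow_of_nonneg _ (by norm_num), ENNReal.ofReal]
  norm_num

/-! ### Uniform estimate for the truncated forms. -/

lemma measurable_kap (ν : ℝ) : Measurable (kap ν) :=
  Measurable.ite measurableSet_Iic measurable_id (measurable_id.pow_const _)

lemma angularBound_truncKernel {ν B : ℝ} {b : ℝ → ℝ} (hb : IsNonCutoffKernel ν b) (hB : 0 ≤ B)
    (hbB : ∀ e σ : S2, e ≠ σ → b (sdot e σ) ≤ B * ‖(e : V) - σ‖ ^ (-2 - ν)) {ε : ℝ} (hε : 0 < ε) :
    AngularBound ν B (truncKernel b ε) where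
  measurable := measurable_truncKernel hb ε
  nonneg := truncKernel_nonneg hb ε
  eq_zero _ ht := truncKernel_of_neg hb ε ht
  bounded := (exists_truncKernel_le hb hε).imp fun _ h => h.2
  bound := truncKernel_bound hb hB hbB hε

/-- The modulus of the Fourier transform, with a weight of order `s`. -/
noncomputable def wHat (s : ℝ) (f : 𝓢(V, ℂ)) (x : V) : ℝ≥0∞ :=
  ENNReal.ofReal ((1 + ‖x‖) ^ s) * ‖𝓕 f x‖ₑ

lemma measurable_wHat (s : ℝ) (f : 𝓢(V, ℂ)) : Measurable (wHat s f) := by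
  have := (𝓕 f).continuous.measurable
  unfold wHat
  fun_prop

lemma ofReal_rpow_mul_wHat (s : ℝ) (f : 𝓢(V, ℂ)) (x : V) :
    ENNReal.ofReal ((1 + ‖x‖) ^ (-s)) * wHat s f x = ‖𝓕 f x‖ₑ := by
  rw [wHat, ← mul_assoc, ofReal_rpow_neg_mul_rpow, one_mul]

/-- Based on (1+|x|)² ≤ 2(1+|x|²); the restriction `s ≤ 2` only keeps the constant equal to 2. -/
lemma nrm_wHat_le {s : ℝ} (hs : 0 ≤ s) (hs₂ : s ≤ 2) (f : 𝓢(V, ℂ)) :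
    nrm volume (wHat s f) ≤ 2 * sobolevNorm s (f.toLp 2 volume) := by
  unfold sobolevNorm
  rw [SchwartzMap.toLp_fourier_eq]
  have hae : (fun ξ : V => (((1 + ‖ξ‖ ^ 2) ^ (s / 2) : ℝ) : ℂ) * ((𝓕 f).toLp 2 volume) ξ) =ᵐ[volume]
      fun ξ : V => (((1 + ‖ξ‖ ^ 2) ^ (s / 2) : ℝ) : ℂ) * 𝓕 f ξ := by
    filter_upwards [(𝓕 f).coeFn_toLp 2 volume] with ξ hξ
    rw [hξ]
  rw [eLpNorm_congr_ae hae,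
    eLpNorm_eq_lintegral_rpow_enorm_toReal (by norm_num) (by norm_num), ENNReal.toReal_ofNat, nrm]
  have hpt : ∀ x : V, wHat s f x ^ (2 : ℝ) ≤ 4 *
      ‖(((1 + ‖x‖ ^ 2) ^ (s / 2) : ℝ) : ℂ) * 𝓕 f x‖ₑ ^ (2 : ℝ) := by
    intro x
    have h1 : (1 + ‖x‖) ^ s ≤ 2 * (1 + ‖x‖ ^ 2) ^ (s / 2) := by
      have h2 : (1 + ‖x‖) ^ s = ((1 + ‖x‖) ^ 2) ^ (s / 2) := by
        rw [← Real.rpow_natCast, ← Real.rpow_mul (by positivity)]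
        congr 1; push_cast; ring
      rw [h2]
      calc ((1 + ‖x‖) ^ 2) ^ (s / 2) ≤ (2 * (1 + ‖x‖ ^ 2)) ^ (s / 2) := by
            gcongr
            nlinarith [sq_nonneg (1 - ‖x‖)]
        _ = 2 ^ (s / 2) * (1 + ‖x‖ ^ 2) ^ (s / 2) := Real.mul_rpow (by norm_num) (by positivity)
        _ ≤ _ := by
            gcongr
            have := Real.rpow_le_rpow_of_exponent_le (by norm_num : (1 : ℝ) ≤ 2)
              (by linarith : s / 2 ≤ 1)
            rwa [Real.rpow_one] at this
    have h3 : wHat s f x ≤ 2 * ‖(((1 + ‖x‖ ^ 2) ^ (s / 2) : ℝ) : ℂ) * 𝓕 f x‖ₑ := by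
      rw [enorm_mul, ← mul_assoc, wHat]
      gcongr
      rw [← ofReal_norm, Complex.norm_real, Real.norm_of_nonneg (by positivity)]
      refine (ENNReal.ofReal_le_ofReal h1).trans_eq ?_
      rw [ENNReal.ofReal_mul (by norm_num), ENNReal.ofReal_ofNat]
    refine (ENNReal.rpow_le_rpow h3 (by norm_num)).trans_eq ?_
    rw [ENNReal.mul_rpow_of_nonneg _ _ (by norm_num)]
    norm_num
  refine (ENNReal.rpow_le_rpow (lintegral_mono hpt) (by norm_num)).trans_eq ?_
  rw [lintegral_const_mul' _ _ (by norm_num), ENNReal.mul_rpow_of_nonneg _ _ (by norm_num),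
    show (4 : ℝ≥0∞) = 2 ^ (2 : ℝ) by norm_num, ← ENNReal.rpow_mul]
  norm_num

section Bound

variable {ν γ : ℝ} {b φ₀ : ℝ → ℝ}

/-- The trilinear estimate for the truncated collision operators, uniformly in the truncation. -/
lemma exists_pairing_trunc_bound (hν₀ : 0 < ν) (hν₂ : ν < 2) (hb : IsNonCutoffKernel ν b)
    (hφ : IsCutoff φ₀) {q a r : ℝ} (hq : 1 ≤ q) (hq₂ : q ≤ 2) (ha : 0 ≤ a) (hr : 0 ≤ r)
    (har : a + r = ν) (hγ : -3 < γ) (hγr : 3 / q - 3 / 2 < γ + 3 + r) (hγν : 3 / q < γ + 3 + ν) :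
    ∃ C : ℝ≥0, ∀ ε : ℝ, 0 < ε → ∀ f g h : 𝓢(V, ℂ),
      ‖∫ v, collisionCTrunc b φ₀ γ ε f g v * (starRingEnd ℂ) (h v)‖ₑ ≤
      C * eLpNorm f (ENNReal.ofReal q) volume * sobolevNorm a (g.toLp 2 volume) *
        sobolevNorm r (h.toLp 2 volume) := by
  -- The margin δ is spent twice in the non-resonant part, once because p must stay below γ+3 and
  -- once because κ must exceed κ₀; hence 2δ in the last two conditions.
  obtain ⟨δ, hδ0, hδ1, hδ2, hδ3⟩ : ∃ δ : ℝ, 0 < δ ∧ δ < γ + 3 ∧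
      2 * δ < γ + 3 + r - (3 / q - 3 / 2) ∧ 2 * δ < γ + 3 + ν - 3 / q := by
    refine ⟨min ((γ + 3) / 2) (min ((γ + 3 + r - (3 / q - 3 / 2)) / 4) ((γ + 3 + ν - 3 / q) / 4)),
      ?_, ?_, ?_, ?_⟩
    · refine lt_min (by linarith) (lt_min (by linarith) (by linarith))
    · exact (min_le_left _ _).trans_lt (by linarith)
    · have := (min_le_right ((γ + 3) / 2) (min ((γ + 3 + r - (3 / q - 3 / 2)) / 4)
        ((γ + 3 + ν - 3 / q) / 4))).trans (min_le_left _ _)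
      linarith
    · have := (min_le_right ((γ + 3) / 2) (min ((γ + 3 + r - (3 / q - 3 / 2)) / 4)
        ((γ + 3 + ν - 3 / q) / 4))).trans (min_le_right _ _)
      linarith
  set p := γ + 3 - δ with hp
  have hp0 : 0 ≤ p := by linarith
  set κ₀ := 3 / q - 3 / 2 with hκ₀
  have hκ₀0 : 0 ≤ κ₀ := by
    have : 3 / 2 ≤ 3 / q := by gcongr
    linarith
  set κ := κ₀ + δ with hκ
  obtain ⟨A, hA, hS⟩ := exists_symbolBound_phiC (γ := γ) hφ hp0 (by linarith)
  obtain ⟨B, hB, hbB⟩ := hb.exists_bound hν₀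
  obtain ⟨C₁, hC₁, hmult⟩ := exists_multiplier_bound hν₀ hν₂ B hB p A hp0 hA
  -- Only (1+|ξ_*|)^(-κ) f̂ is square-integrable with the right bound, so the power -p of the symbol
  -- is weakened to κ - p.
  obtain ⟨C₂, hnon⟩ := exists_nonresonant_bound (s := κ - p) ha hr har hν₂ (by linarith)
    (by linarith)
  obtain ⟨C₃, hres⟩ := exists_resonant_bound (κ₀ := κ₀) hν₀ hν₂ hB hp0 ha hr har (by linarith)
  obtain ⟨C₄, hmor⟩ := exists_fourier_ball_bound hq hq₂
  obtain ⟨C₅, hwei⟩ := exists_weighted_bound (κ := κ) (κ₀ := κ₀) (by linarith) (by linarith)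
  have hΦ := integrable_phiC hφ hγ
  have hcont := continuous_radialHat hΦ
  refine ⟨(Real.toNNReal C₁ * (C₂ * C₅) + Real.toNNReal A * C₃) * C₄ * 4, fun ε hε f g h => ?_⟩
  set β := truncKernel b ε with hβdef
  have hβ : AngularBound ν B β := angularBound_truncKernel hb hB hbB hε
  obtain ⟨M, hM⟩ := hβ.bounded
  simp only [collisionCTrunc_eq]
  rw [integral_collDiff_eq hΦ hβ.measurable
    (fun e σ => (abs_of_nonneg (hβ.nonneg _)).le.trans (hM e σ)) f g h]
  set F : V → ℝ≥0∞ := fun x => ‖𝓕 f x‖ₑ with hF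
  have hFm : Measurable F := (𝓕 f).continuous.measurable.enorm
  set G := wHat a g with hG
  set H := wHat r h with hH
  have hGm : Measurable G := measurable_wHat a g
  have hHm : Measurable H := measurable_wHat r h
  set F' : V → ℝ≥0∞ := fun x => ENNReal.ofReal ((1 + ‖x‖) ^ (-κ)) * F x with hF'
  have hF'm : Measurable F' := by fun_prop
  set N := (C₄ : ℝ≥0∞) * eLpNorm f (ENNReal.ofReal q) volume with hN
  have hFN : ∀ (c : V) (U : ℝ), 1 ≤ U →
      ∫⁻ x in Metric.ball c U, F x ^ (2 : ℝ) ≤ (N * ENNReal.ofReal (U ^ κ₀)) ^ (2 : ℝ) :=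
    fun c U hU => hmor f c U hU
  have hFF' : ∀ x, F x = ENNReal.ofReal ((1 + ‖x‖) ^ κ) * F' x := fun x => by
    rw [hF', ← mul_assoc, mul_comm (ENNReal.ofReal _) (ENNReal.ofReal _), ofReal_rpow_neg_mul_rpow,
      one_mul]
  have htriple : ∀ x : V × V, ‖tripleHat f g h x‖ₑ =
      ENNReal.ofReal ((1 + ‖x.1 - x.2‖) ^ (-a) * (1 + ‖x.1‖) ^ (-r)) *
        (F x.2 * G (x.1 - x.2) * H x.1) := fun x => by
    rw [tripleHat, enorm_mul, enorm_mul, RCLike.enorm_conj, ← ofReal_rpow_mul_wHat a g,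
      ← ofReal_rpow_mul_wHat r h, ENNReal.ofReal_mul (by positivity)]
    ring
  have hpt : ∀ x : V × V, ‖tripleHat f g h x * collKernel (phiC φ₀ γ) β x.1 x.2‖ₑ ≤
      ENNReal.ofReal C₁ * (ENNReal.ofReal ((1 + ‖x.2‖) ^ (κ - p) *
        kap ν ((1 + ‖x.1‖) / (1 + ‖x.2‖)) * (1 + ‖x.1 - x.2‖) ^ (-a) * (1 + ‖x.1‖) ^ (-r)) *
        (F' x.2 * G (x.1 - x.2) * H x.1)) +
      ENNReal.ofReal A * (resonantPart β p x.1 x.2 *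
        ENNReal.ofReal ((1 + ‖x.1 - x.2‖) ^ (-a) * (1 + ‖x.1‖) ^ (-r)) *
        (F x.2 * G (x.1 - x.2) * H x.1)) := by
    intro x
    have h1 := hmult _ hcont hS β hβ x.1 x.2
    have hk0 : 0 ≤ kap ν ((1 + ‖x.1‖) / (1 + ‖x.2‖)) := kap_nonneg (by positivity)
    rw [enorm_mul]
    refine (mul_le_mul_right h1 _).trans_eq ?_
    rw [mul_add]
    congr 1
    · have e1 : (1 + ‖x.2‖) ^ (κ - p) * kap ν ((1 + ‖x.1‖) / (1 + ‖x.2‖)) *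
          (1 + ‖x.1 - x.2‖) ^ (-a) * (1 + ‖x.1‖) ^ (-r) = (1 + ‖x.2‖) ^ κ *
          (((1 + ‖x.2‖) ^ (-p) * kap ν ((1 + ‖x.1‖) / (1 + ‖x.2‖))) *
          ((1 + ‖x.1 - x.2‖) ^ (-a) * (1 + ‖x.1‖) ^ (-r))) := by
        rw [sub_eq_add_neg, Real.rpow_add (by positivity)]; ring
      rw [htriple, hFF' x.2, e1, ENNReal.ofReal_mul hC₁,
        ENNReal.ofReal_mul (p := (1 + ‖x.2‖) ^ κ) (by positivity),
        ENNReal.ofReal_mul (p := (1 + ‖x.2‖) ^ (-p) * _) (by positivity)]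
      ring
    · rw [htriple]; ring
  have hker : Measurable fun x : V × V => ENNReal.ofReal C₁ * (ENNReal.ofReal
      ((1 + ‖x.2‖) ^ (κ - p) * kap ν ((1 + ‖x.1‖) / (1 + ‖x.2‖)) *
        (1 + ‖x.1 - x.2‖) ^ (-a) * (1 + ‖x.1‖) ^ (-r)) * (F' x.2 * G (x.1 - x.2) * H x.1)) := by
    have hk : Measurable fun x : V × V => kap ν ((1 + ‖x.1‖) / (1 + ‖x.2‖)) :=
      (measurable_kap ν).comp (by fun_prop)
    fun_prop
  calc _ ≤ ∫⁻ x : V × V, ‖tripleHat f g h x * collKernel (phiC φ₀ γ) β x.1 x.2‖ₑ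
        ∂(volume.prod volume) := enorm_integral_le_lintegral_enorm _
    _ ≤ ENNReal.ofReal C₁ * (C₂ * (nrm volume F' * nrm volume G * nrm volume H)) +
        ENNReal.ofReal A * (C₃ * (N * nrm volume G * nrm volume H)) := by
        refine (lintegral_mono hpt).trans ?_
        rw [lintegral_add_left hker, lintegral_const_mul' _ _ ENNReal.ofReal_ne_top,
          lintegral_const_mul' _ _ ENNReal.ofReal_ne_top]
        gcongr
        · exact hnon F' G H hF'm hGm hHm
        · exact hres β hβ F G H N hFm hGm hHm hFN
    _ ≤ ENNReal.ofReal C₁ * (C₂ * ((C₅ * N) * (2 * sobolevNorm a (g.toLp 2 volume)) *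
          (2 * sobolevNorm r (h.toLp 2 volume)))) +
        ENNReal.ofReal A * (C₃ * (N * (2 * sobolevNorm a (g.toLp 2 volume)) *
          (2 * sobolevNorm r (h.toLp 2 volume)))) := by
        have e1 := hwei F N hFm hFN
        have e2 := nrm_wHat_le ha (by linarith) g
        have e3 := nrm_wHat_le hr (by linarith) h
        gcongr
    _ = _ := by
        rw [hN]
        simp only [ENNReal.ofReal]
        push_cast
        ring

/-- The trilinear estimate on Schwartz functions. -/
lemma exists_pairing_bound (hν₀ : 0 < ν) (hν₂ : ν < 2) (hb : IsNonCutoffKernel ν b)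
    (hφ : IsCutoff φ₀) {q a r : ℝ} (hq : 1 ≤ q) (hq₂ : q ≤ 2) (ha : 0 ≤ a) (hr : 0 ≤ r)
    (har : a + r = ν) (hγ : -3 < γ) (hγr : 3 / q - 3 / 2 < γ + 3 + r) (hγν : 3 / q < γ + 3 + ν) :
    ∃ C : ℝ≥0, ∀ f g h : 𝓢(V, ℂ), ‖pairingC b φ₀ γ f g h‖ₑ ≤
      C * eLpNorm f (ENNReal.ofReal q) volume * sobolevNorm a (g.toLp 2 volume) *
        sobolevNorm r (h.toLp 2 volume) := by
  obtain ⟨C, hC⟩ := exists_pairing_trunc_bound hν₀ hν₂ hb hφ hq hq₂ ha hr har hγ hγr hγν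
  refine ⟨C, fun f g h => ?_⟩
  refine le_of_tendsto (tendsto_pairing_trunc hb hφ hγ hν₀ hν₂ f g h).enorm ?_
  filter_upwards [self_mem_nhdsWithin] with ε hε
  exact hC ε hε f g h

end Bound

/-! ### Additivity and extension by continuity. -/

section Trilinear

variable {ν γ : ℝ} {b φ₀ : ℝ → ℝ}

/-- Additivity holds for the truncated integrals, which converge absolutely, and passes to the
principal value. -/
lemma collisionC_sub_left (hb : IsNonCutoffKernel ν b) (hφ : IsCutoff φ₀) (hγ : -3 < γ)
    (hν₀ : 0 < ν) (hν₂ : ν < 2) (f₁ f₂ g : 𝓢(V, ℂ)) (v : V) :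
    collisionC b φ₀ γ (f₁ - f₂ : 𝓢(V, ℂ)) g v =
      collisionC b φ₀ γ f₁ g v - collisionC b φ₀ γ f₂ g v := by
  refine tendsto_nhds_unique_of_eventuallyEq
    (tendsto_collisionCTrunc hb hφ hγ hν₀ hν₂ (f₁ - f₂) g v)
    ((tendsto_collisionCTrunc hb hφ hγ hν₀ hν₂ f₁ g v).sub
      (tendsto_collisionCTrunc hb hφ hγ hν₀ hν₂ f₂ g v)) ?_
  filter_upwards [self_mem_nhdsWithin] with ε hε
  rw [collisionCTrunc, collisionCTrunc, collisionCTrunc, ← integral_sub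
    (integrable_integrandC hb hφ hγ hε f₁ g v) (integrable_integrandC hb hφ hγ hε f₂ g v)]
  refine integral_congr_ae (ae_of_all _ fun p => ?_)
  simp only [integrandC, sub_apply]
  split_ifs <;> ring

lemma collisionC_sub_right (hb : IsNonCutoffKernel ν b) (hφ : IsCutoff φ₀) (hγ : -3 < γ)
    (hν₀ : 0 < ν) (hν₂ : ν < 2) (f g₁ g₂ : 𝓢(V, ℂ)) (v : V) :
    collisionC b φ₀ γ f (g₁ - g₂ : 𝓢(V, ℂ)) v =
      collisionC b φ₀ γ f g₁ v - collisionC b φ₀ γ f g₂ v := by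
  refine tendsto_nhds_unique_of_eventuallyEq
    (tendsto_collisionCTrunc hb hφ hγ hν₀ hν₂ f (g₁ - g₂) v)
    ((tendsto_collisionCTrunc hb hφ hγ hν₀ hν₂ f g₁ v).sub
      (tendsto_collisionCTrunc hb hφ hγ hν₀ hν₂ f g₂ v)) ?_
  filter_upwards [self_mem_nhdsWithin] with ε hε
  rw [collisionCTrunc, collisionCTrunc, collisionCTrunc, ← integral_sub
    (integrable_integrandC hb hφ hγ hε f g₁ v) (integrable_integrandC hb hφ hγ hε f g₂ v)]
  refine integral_congr_ae (ae_of_all _ fun p => ?_)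
  simp only [integrandC, sub_apply]
  split_ifs <;> ring

end Trilinear

/-- Forms on Schwartz functions that are additive in each argument. -/
structure IsTriadditive (P : 𝓢(V, ℂ) → 𝓢(V, ℂ) → 𝓢(V, ℂ) → ℂ) : Prop where
  sub_fst : ∀ f₁ f₂ g h, P (f₁ - f₂) g h = P f₁ g h - P f₂ g h
  sub_snd : ∀ f g₁ g₂ h, P f (g₁ - g₂) h = P f g₁ h - P f g₂ h
  sub_trd : ∀ f g h₁ h₂, P f g (h₁ - h₂) = P f g h₁ - P f g h₂

lemma isTriadditive_pairingC {ν γ : ℝ} {b φ₀ : ℝ → ℝ} (hb : IsNonCutoffKernel ν b)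
    (hφ : IsCutoff φ₀) (hγ : -3 < γ) (hν₀ : 0 < ν) (hν₂ : ν < 2) :
    IsTriadditive fun f g h => pairingC b φ₀ γ f g h where
  sub_fst f₁ f₂ g h := by
    simp only [pairingC]
    rw [← integral_sub (integrable_collisionC_mul hb hφ hγ hν₀ hν₂ f₁ g h)
      (integrable_collisionC_mul hb hφ hγ hν₀ hν₂ f₂ g h)]
    refine integral_congr_ae (ae_of_all _ fun v => ?_)
    simp only [collisionC_sub_left hb hφ hγ hν₀ hν₂]
    ring
  sub_snd f g₁ g₂ h := by
    simp only [pairingC]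
    rw [← integral_sub (integrable_collisionC_mul hb hφ hγ hν₀ hν₂ f g₁ h)
      (integrable_collisionC_mul hb hφ hγ hν₀ hν₂ f g₂ h)]
    refine integral_congr_ae (ae_of_all _ fun v => ?_)
    simp only [collisionC_sub_right hb hφ hγ hν₀ hν₂]
    ring
  sub_trd f g h₁ h₂ := by
    simp only [pairingC]
    rw [← integral_sub (integrable_collisionC_mul hb hφ hγ hν₀ hν₂ f g h₁)
      (integrable_collisionC_mul hb hφ hγ hν₀ hν₂ f g h₂)]
    refine integral_congr_ae (ae_of_all _ fun v => ?_)
    simp only [sub_apply, map_sub]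
    ring

lemma sobolevNorm_add_le (s : ℝ) (u v : Lp ℂ 2 (volume : Measure V)) :
    sobolevNorm s (u + v) ≤ sobolevNorm s u + sobolevNorm s v := by
  unfold sobolevNorm
  have hw : Continuous fun ξ : V => (((1 + ‖ξ‖ ^ 2) ^ (s / 2) : ℝ) : ℂ) := by
    refine Complex.continuous_ofReal.comp (Continuous.rpow_const (by fun_prop) fun x => ?_)
    left; positivity
  have hae : (fun ξ : V => (((1 + ‖ξ‖ ^ 2) ^ (s / 2) : ℝ) : ℂ) *
      (𝓕 (u + v) : Lp ℂ 2 (volume : Measure V)) ξ) =ᵐ[volume]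
      (fun ξ : V => (((1 + ‖ξ‖ ^ 2) ^ (s / 2) : ℝ) : ℂ) * (𝓕 u : Lp ℂ 2 (volume : Measure V)) ξ) +
      fun ξ : V => (((1 + ‖ξ‖ ^ 2) ^ (s / 2) : ℝ) : ℂ) * (𝓕 v : Lp ℂ 2 (volume : Measure V)) ξ := by
    rw [FourierTransform.fourier_add]
    filter_upwards [Lp.coeFn_add (𝓕 u : Lp ℂ 2 (volume : Measure V)) (𝓕 v)] with ξ hξ
    rw [hξ, Pi.add_apply, Pi.add_apply, mul_add]
  rw [eLpNorm_congr_ae hae]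
  exact eLpNorm_add_le (hw.aestronglyMeasurable.mul (Lp.aestronglyMeasurable _))
    (hw.aestronglyMeasurable.mul (Lp.aestronglyMeasurable _)) (by norm_num)

lemma sobolevNorm_neg (s : ℝ) (u : Lp ℂ 2 (volume : Measure V)) :
    sobolevNorm s (-u) = sobolevNorm s u := by
  unfold sobolevNorm
  rw [← eLpNorm_neg]
  refine eLpNorm_congr_ae ?_
  rw [FourierTransform.fourier_neg]
  filter_upwards [Lp.coeFn_neg (𝓕 u : Lp ℂ 2 (volume : Measure V))] with ξ hξ
  rw [Pi.neg_apply, hξ, Pi.neg_apply, mul_neg, neg_neg]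

lemma sobolevNorm_sub_le (s : ℝ) (u v : Lp ℂ 2 (volume : Measure V)) :
    sobolevNorm s (u - v) ≤ sobolevNorm s u + sobolevNorm s v := by
  rw [sub_eq_add_neg, ← sobolevNorm_neg s v]
  exact sobolevNorm_add_le s u (-v)

lemma toLp_sub (f g : 𝓢(V, ℂ)) :
    (f - g).toLp 2 (volume : Measure V) = f.toLp 2 volume - g.toLp 2 volume := by
  have := map_sub (SchwartzMap.toLpCLM ℝ ℂ 2 (volume : Measure V)) f g
  simpa using this

/-- Approximation of `(f, g, h)` by Schwartz functions in `L^q × H^s × H^r`. -/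
structure Approximates (q : ℝ≥0∞) (s r : ℝ) (f : Lp ℂ q (volume : Measure V))
    (g h : Lp ℂ 2 (volume : Measure V)) (F G H : ℕ → 𝓢(V, ℂ)) : Prop where
  fst : Tendsto (fun n => eLpNorm (fun v => F n v - f v) q volume) atTop (𝓝 0)
  snd : Tendsto (fun n => sobolevNorm s ((G n).toLp 2 volume - g)) atTop (𝓝 0)
  trd : Tendsto (fun n => sobolevNorm r ((H n).toLp 2 volume - h)) atTop (𝓝 0)

section Extension

variable {q : ℝ≥0∞} {s r : ℝ} {P : 𝓢(V, ℂ) → 𝓢(V, ℂ) → 𝓢(V, ℂ) → ℂ} {C : ℝ≥0}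
  {f : Lp ℂ q (volume : Measure V)} {g h : Lp ℂ 2 (volume : Measure V)}

lemma eLpNorm_sub_schwartz_le (hq : 1 ≤ q) (F F' : 𝓢(V, ℂ)) (f : Lp ℂ q (volume : Measure V)) :
    eLpNorm (F - F' : 𝓢(V, ℂ)) q volume ≤
      eLpNorm (fun v => F v - f v) q volume + eLpNorm (fun v => F' v - f v) q volume := by
  have e : ((F - F' : 𝓢(V, ℂ)) : V → ℂ) = (fun v => F v - f v) - fun v => F' v - f v := by
    ext v; simp
  rw [e]
  exact eLpNorm_sub_le (F.continuous.aestronglyMeasurable.sub (Lp.aestronglyMeasurable f))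
    (F'.continuous.aestronglyMeasurable.sub (Lp.aestronglyMeasurable f)) hq

lemma eLpNorm_schwartz_le (hq : 1 ≤ q) (F : 𝓢(V, ℂ)) (f : Lp ℂ q (volume : Measure V)) :
    eLpNorm F q volume ≤ eLpNorm (fun v => F v - f v) q volume + eLpNorm f q volume := by
  have e : (F : V → ℂ) = (fun v => F v - f v) + f := by ext v; simp
  conv_lhs => rw [e]
  exact eLpNorm_add_le (F.continuous.aestronglyMeasurable.sub (Lp.aestronglyMeasurable f))
    (Lp.aestronglyMeasurable f) hq

lemma sobolevNorm_sub_schwartz_le (s : ℝ) (G G' : 𝓢(V, ℂ)) (g : Lp ℂ 2 (volume : Measure V)) :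
    sobolevNorm s ((G - G').toLp 2 volume) ≤
      sobolevNorm s (G.toLp 2 volume - g) + sobolevNorm s (G'.toLp 2 volume - g) := by
  rw [toLp_sub, ← sub_sub_sub_cancel_right _ _ g]
  exact sobolevNorm_sub_le _ _ _

lemma sobolevNorm_schwartz_le (s : ℝ) (G : 𝓢(V, ℂ)) (g : Lp ℂ 2 (volume : Measure V)) :
    sobolevNorm s (G.toLp 2 volume) ≤ sobolevNorm s (G.toLp 2 volume - g) + sobolevNorm s g := by
  conv_lhs => rw [← sub_add_cancel (G.toLp 2 volume) g]
  exact sobolevNorm_add_le _ _ _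

lemma tendsto_mul_three {ι : Type*} {l : Filter ι} {x y z : ι → ℝ≥0∞} {a b c : ℝ≥0∞} (K : ℝ≥0)
    (hx : Tendsto x l (𝓝 a)) (hy : Tendsto y l (𝓝 b)) (hz : Tendsto z l (𝓝 c)) (ha : a ≠ ∞)
    (hb : b ≠ ∞) (hc : c ≠ ∞) :
    Tendsto (fun i => K * x i * y i * z i) l (𝓝 (K * a * b * c)) := by
  refine ENNReal.Tendsto.mul (ENNReal.Tendsto.mul (ENNReal.Tendsto.const_mul hx
    (Or.inr ENNReal.coe_ne_top)) (Or.inr hb) hy (Or.inr ?_)) (Or.inr hc) hz (Or.inr ?_)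
  · exact ENNReal.mul_ne_top ENNReal.coe_ne_top ha
  · exact ENNReal.mul_ne_top (ENNReal.mul_ne_top ENNReal.coe_ne_top ha) hb

/-- Changing one argument at a time leaves three terms, each with one factor tending to 0 and two
bounded ones. The indices are independent so that the same statement yields the Cauchy property (a
sequence against itself) and, on the diagonal, uniqueness of the limit. -/
lemma tendsto_sub_of_approximates (hP : IsTriadditive P) (hq : 1 ≤ q)
    (hbound : ∀ f g h, ‖P f g h‖ₑ ≤ C * eLpNorm f q volume * sobolevNorm s (g.toLp 2 volume) *
      sobolevNorm r (h.toLp 2 volume))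
    (hg : sobolevNorm s g < ∞) (hh : sobolevNorm r h < ∞) {F G H F' G' H' : ℕ → 𝓢(V, ℂ)}
    (h₁ : Approximates q s r f g h F G H) (h₂ : Approximates q s r f g h F' G' H') :
    Tendsto (fun p : ℕ × ℕ => P (F p.1) (G p.1) (H p.1) - P (F' p.2) (G' p.2) (H' p.2))
      (atTop ×ˢ atTop) (𝓝 0) := by
  have hf : eLpNorm f q volume ≠ ∞ := (Lp.eLpNorm_lt_top f).ne
  have a1 := h₁.fst.comp (tendsto_fst (f := (atTop : Filter ℕ)) (g := (atTop : Filter ℕ)))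
  have a2 := h₁.snd.comp (tendsto_fst (f := (atTop : Filter ℕ)) (g := (atTop : Filter ℕ)))
  have a3 := h₁.trd.comp (tendsto_fst (f := (atTop : Filter ℕ)) (g := (atTop : Filter ℕ)))
  have b1 := h₂.fst.comp (tendsto_snd (f := (atTop : Filter ℕ)) (g := (atTop : Filter ℕ)))
  have b2 := h₂.snd.comp (tendsto_snd (f := (atTop : Filter ℕ)) (g := (atTop : Filter ℕ)))
  have b3 := h₂.trd.comp (tendsto_snd (f := (atTop : Filter ℕ)) (g := (atTop : Filter ℕ)))
  have t1 := tendsto_mul_three C (a1.add b1) (a2.add_const (sobolevNorm s g))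
    (a3.add_const (sobolevNorm r h)) (by simp) (by simpa using hg.ne) (by simpa using hh.ne)
  have t2 := tendsto_mul_three C (b1.add_const (eLpNorm f q volume)) (a2.add b2)
    (a3.add_const (sobolevNorm r h)) (by simpa using hf) (by simp) (by simpa using hh.ne)
  have t3 := tendsto_mul_three C (b1.add_const (eLpNorm f q volume))
    (b2.add_const (sobolevNorm s g)) (a3.add b3)
    (by simpa using hf) (by simpa using hg.ne) (by simp)
  have t := (t1.add t2).add t3
  simp only [add_zero, mul_zero, zero_mul] at t
  rw [tendsto_zero_iff_enorm_tendsto_zero]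
  refine tendsto_of_tendsto_of_tendsto_of_le_of_le tendsto_const_nhds t (fun _ => zero_le)
    fun p => ?_
  have hsplit : P (F p.1) (G p.1) (H p.1) - P (F' p.2) (G' p.2) (H' p.2) =
      P (F p.1 - F' p.2) (G p.1) (H p.1) + P (F' p.2) (G p.1 - G' p.2) (H p.1) +
        P (F' p.2) (G' p.2) (H p.1 - H' p.2) := by
    rw [hP.sub_fst, hP.sub_snd, hP.sub_trd]; ring
  simp only [Function.comp_apply]
  rw [hsplit]
  refine (enorm_add_le _ _).trans (add_le_add ((enorm_add_le _ _).trans (add_le_add ?_ ?_)) ?_)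
  · refine (hbound _ _ _).trans ?_
    gcongr
    · exact eLpNorm_sub_schwartz_le hq _ _ f
    · exact sobolevNorm_schwartz_le _ _ _
    · exact sobolevNorm_schwartz_le _ _ _
  · refine (hbound _ _ _).trans ?_
    gcongr
    · exact eLpNorm_schwartz_le hq _ f
    · exact sobolevNorm_sub_schwartz_le _ _ _ _
    · exact sobolevNorm_schwartz_le _ _ _
  · refine (hbound _ _ _).trans ?_
    gcongr
    · exact eLpNorm_schwartz_le hq _ f
    · exact sobolevNorm_schwartz_le _ _ _
    · exact sobolevNorm_sub_schwartz_le _ _ _ _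

lemma exists_tendsto_of_approximates (hP : IsTriadditive P) (hq : 1 ≤ q)
    (hbound : ∀ f g h, ‖P f g h‖ₑ ≤ C * eLpNorm f q volume * sobolevNorm s (g.toLp 2 volume) *
      sobolevNorm r (h.toLp 2 volume))
    (hg : sobolevNorm s g < ∞) (hh : sobolevNorm r h < ∞) {F G H : ℕ → 𝓢(V, ℂ)}
    (h₁ : Approximates q s r f g h F G H) :
    ∃ L, Tendsto (fun n => P (F n) (G n) (H n)) atTop (𝓝 L) := by
  have h0 := tendsto_sub_of_approximates hP hq hbound hg hh h₁ h₁
  refine cauchySeq_tendsto_of_complete (Metric.cauchySeq_iff.2 fun ε hε => ?_)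
  have h2 := (Metric.tendsto_nhds.1 h0 ε hε)
  rw [prod_atTop_atTop_eq, eventually_atTop] at h2
  obtain ⟨N, hN⟩ := h2
  refine ⟨max N.1 N.2, fun m hm n hn => ?_⟩
  have := hN (m, n) ⟨(le_max_left _ _).trans hm, (le_max_right _ _).trans hn⟩
  rwa [dist_zero_right, ← dist_eq_norm] at this

lemma tendsto_unique_of_approximates (hP : IsTriadditive P) (hq : 1 ≤ q)
    (hbound : ∀ f g h, ‖P f g h‖ₑ ≤ C * eLpNorm f q volume * sobolevNorm s (g.toLp 2 volume) *
      sobolevNorm r (h.toLp 2 volume))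
    (hg : sobolevNorm s g < ∞) (hh : sobolevNorm r h < ∞) {F G H F' G' H' : ℕ → 𝓢(V, ℂ)}
    (h₁ : Approximates q s r f g h F G H) (h₂ : Approximates q s r f g h F' G' H') {L L' : ℂ}
    (hL : Tendsto (fun n => P (F n) (G n) (H n)) atTop (𝓝 L))
    (hL' : Tendsto (fun n => P (F' n) (G' n) (H' n)) atTop (𝓝 L')) : L = L' := by
  have h0 := tendsto_sub_of_approximates hP hq hbound hg hh h₁ h₂
  have hdiag : Tendsto (fun n : ℕ => (n, n)) atTop (atTop ×ˢ atTop) :=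
    tendsto_id.prodMk tendsto_id
  exact sub_eq_zero.1 (tendsto_nhds_unique (hL.sub hL') (h0.comp hdiag))

/-- The extension by continuity of a bounded trilinear form. -/
lemma exists_extension (hP : IsTriadditive P) (hq : 1 ≤ q)
    (hbound : ∀ f g h, ‖P f g h‖ₑ ≤ C * eLpNorm f q volume * sobolevNorm s (g.toLp 2 volume) *
      sobolevNorm r (h.toLp 2 volume)) :
    ∃ T : Lp ℂ q (volume : Measure V) → Lp ℂ 2 (volume : Measure V) →
        Lp ℂ 2 (volume : Measure V) → ℂ,
      IsExtension q s r P T ∧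
      ∀ (f : Lp ℂ q (volume : Measure V)) (g h : Lp ℂ 2 (volume : Measure V)),
        sobolevNorm s g < ∞ → sobolevNorm r h < ∞ →
        ‖T f g h‖ₑ ≤ C * eLpNorm f q volume * sobolevNorm s g * sobolevNorm r h := by
  classical
  have key : ∀ (f : Lp ℂ q (volume : Measure V)) (g h : Lp ℂ 2 (volume : Measure V)), ∃ L : ℂ,
      sobolevNorm s g < ∞ → sobolevNorm r h < ∞ →
      (∀ F G H : ℕ → 𝓢(V, ℂ), Approximates q s r f g h F G H →
        Tendsto (fun n => P (F n) (G n) (H n)) atTop (𝓝 L)) ∧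
      ‖L‖ₑ ≤ C * eLpNorm f q volume * sobolevNorm s g * sobolevNorm r h := by
    intro f g h
    -- If no approximating sequences exist the convergence requirement is void and the value 0 obeys
    -- the bound, so density of Schwartz functions is not needed.
    by_cases hex : ∃ F G H : ℕ → 𝓢(V, ℂ), Approximates q s r f g h F G H
    swap
    · exact ⟨0, fun _ _ => ⟨fun F G H h₁ => absurd ⟨F, G, H, h₁⟩ hex, by simp⟩⟩
    by_cases hfin : sobolevNorm s g < ∞ ∧ sobolevNorm r h < ∞
    swap
    · exact ⟨0, fun hg hh => absurd ⟨hg, hh⟩ hfin⟩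
    obtain ⟨hg, hh⟩ := hfin
    obtain ⟨F, G, H, h₁⟩ := hex
    obtain ⟨L, hL⟩ := exists_tendsto_of_approximates hP hq hbound hg hh h₁
    refine ⟨L, fun _ _ => ⟨fun F' G' H' h₂ => ?_, ?_⟩⟩
    · obtain ⟨L', hL'⟩ := exists_tendsto_of_approximates hP hq hbound hg hh h₂
      rwa [tendsto_unique_of_approximates hP hq hbound hg hh h₁ h₂ hL hL']
    · have hf : eLpNorm f q volume ≠ ∞ := (Lp.eLpNorm_lt_top f).ne
      have t := tendsto_mul_three C (h₁.fst.add_const (eLpNorm f q volume))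
        (h₁.snd.add_const (sobolevNorm s g)) (h₁.trd.add_const (sobolevNorm r h))
        (by simpa using hf) (by simpa using hg.ne) (by simpa using hh.ne)
      simp only [zero_add] at t
      refine le_of_tendsto_of_tendsto' hL.enorm t fun n => (hbound _ _ _).trans ?_
      gcongr
      · exact eLpNorm_schwartz_le hq _ f
      · exact sobolevNorm_schwartz_le _ _ _
      · exact sobolevNorm_schwartz_le _ _ _
  choose T hT using key
  exact ⟨T, fun f g h hg hh F G H hF hG hH => (hT f g h hg hh).1 F G H ⟨hF, hG, hH⟩,
    fun f g h hg hh => (hT f g h hg hh).2⟩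

end Extension

lemma trilinearEstimate {ν γ : ℝ} {b φ₀ : ℝ → ℝ} (hν₀ : 0 < ν) (hν₂ : ν < 2)
    (hb : IsNonCutoffKernel ν b) (hφ : IsCutoff φ₀) {q a r : ℝ} (hq : 1 ≤ q) (hq₂ : q ≤ 2)
    (ha : 0 ≤ a) (hr : 0 ≤ r) (har : a + r = ν) (hγ : -3 < γ)
    (hγr : 3 / q - 3 / 2 < γ + 3 + r) (hγν : 3 / q < γ + 3 + ν) :
    TrilinearEstimate b φ₀ γ (ENNReal.ofReal q) a r := by
  obtain ⟨C, hC⟩ := exists_pairing_bound hν₀ hν₂ hb hφ hq hq₂ ha hr har hγ hγr hγν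
  exact ⟨C, hC, exists_extension (isTriadditive_pairingC hb hφ hγ hν₀ hν₂)
    (by rwa [ENNReal.one_le_ofReal]) hC⟩

end Boltzmann

open Boltzmann in
theorem proposition7p9 (ν γ : ℝ) (hν₀ : 0 < ν) (hν₂ : ν < 2)
    (hγ : max (-3) (-ν - 3 / 2) < γ)
    (b : ℝ → ℝ) (hb : IsNonCutoffKernel ν b)
    (φ₀ : ℝ → ℝ) (hφ₀ : IsCutoff φ₀) :
    -- `Q_c(f, g)` and its pairing with `h` are well defined for Schwartz functions
    (∀ f g : 𝓢(V, ℂ),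
      (∀ (v : V) (ε : ℝ), 0 < ε →
        Integrable (integrandC b φ₀ γ ε f g v) ((volume : Measure V).prod sphereMeasure)) ∧
      (∀ v : V, Tendsto (fun ε => collisionCTrunc b φ₀ γ ε f g v) (𝓝[>] 0)
        (𝓝 (collisionC b φ₀ γ f g v))) ∧
      ∀ h : 𝓢(V, ℂ), Integrable (fun v => collisionC b φ₀ γ f g v * (starRingEnd ℂ) (h v))) ∧
    -- the `L²` estimate
    (∀ m ∈ Set.Icc (-ν / 2) (ν / 2),
      TrilinearEstimate b φ₀ γ 2 (ν / 2 + m) (ν / 2 - m)) ∧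
    -- the `L^q` variant
    (∀ q : ℝ, 1 ≤ q → q < 2 → max (-3) (-ν - 3 + 3 / q) < γ →
      ∀ m ∈ Set.Icc (-ν / 2) (min (ν / 2) (3 / 2 - ν / 2)),
        TrilinearEstimate b φ₀ γ (ENNReal.ofReal q) (ν / 2 + m) (ν / 2 - m)) := by
  obtain ⟨hγ3, hγν⟩ := max_lt_iff.1 hγ
  refine ⟨fun f g => ⟨fun v ε hε => integrable_integrandC hb hφ₀ hγ3 hε f g v,
    fun v => tendsto_collisionCTrunc hb hφ₀ hγ3 hν₀ hν₂ f g v,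
    fun h => integrable_collisionC_mul hb hφ₀ hγ3 hν₀ hν₂ f g h⟩, fun m hm => ?_,
    fun q hq hq₂ hγq m hm => ?_⟩
  -- For q = 2 one has 3/q - 3/2 = 0, so the condition involving r follows from γ > -3, and the
  -- other one reads γ > -ν - 3/2.
  · have h := trilinearEstimate hν₀ hν₂ hb hφ₀ (q := 2) (a := ν / 2 + m) (r := ν / 2 - m)
      (by norm_num) le_rfl (by linarith [hm.1]) (by linarith [hm.2]) (by ring) hγ3
      (by linarith [hm.2]) (by linarith)
    rwa [ENNReal.ofReal_ofNat] at h
  · have h1 := (max_lt_iff.1 hγq).2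
    have h2 := hm.2.trans (min_le_left _ _)
    -- The bound m ≤ 3/2 - ν/2 means r = ν/2 - m ≥ ν - 3/2; with 3/q < γ+3+ν this gives 3/q - 3/2 <
    -- γ+3+r.
    have h3 := hm.2.trans (min_le_right _ _)
    exact trilinearEstimate hν₀ hν₂ hb hφ₀ hq hq₂.le (by linarith [hm.1]) (by linarith) (by ring)
      hγ3 (by linarith) (by linarith)
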